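/- **Set-up.** Let $0<\lambda_1<\lambda_2<\cdots\to\infty$ and $0<\mu_1<\mu_2<\cdots\to\infty$ satisfy $\lambda_k\lambda_l=\lambda_m\iff kl=m$ and $\mu_k\mu_l=\mu_m\iff kl=m$; let $f,g$ be nonzero complex sequences and $\delta>0$. Suppose $$\varphi(s)=\sum_{n\ge1}\frac{f(n)}{\lambda_n^{s}}\ (\Re s>\sigma_{a,\varphi}),\qquad \psi(s)=\sum_{n\ge1}\frac{g(n)}{\mu_n^{s}}\ (\Re s>\sigma_{a,\psi}),$$ with finite abscissae of absolute convergence $\sigma_{a,\varphi},\sigma_{a,\psi}$, extend meromorphically to $\mathbb C$ with finitely many poles, all simple and real: $\varphi$ has poles $p_{\varphi,i}$ with residues $r_{\varphi,i}$ ($1\le i\le n_\varphi$), $\psi$ has poles $p_{\psi,i}$ with residues $r_{\psi,i}$ ($1\le i\le n_\psi$). If $\varphi$ has a pole, assume $\sigma_{a,\varphi}\le\delta$; if $\psi$ has a pole, assume $\sigma_{a,\psi}\le\delta$. Assume $$(2\pi)^{-s}\Gamma(s)\varphi(s)=(2\pi)^{s-\delta}\Gamma(\delta-s)\psi(\delta-s),\qquad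 (2\pi)^{-s}\Gamma(s)\psi(s)=(2\pi)^{s-\delta}\Gamma(\delta-s)\varphi(\delta-s)$$ in the following sense: these are identities of meromorphic functions, and there are a bounded closed set $S$ with connected complement $D$, a holomorphic function $\chi$ on $D$, constants $\alpha,\beta\in\mathbb R$ and $0<\epsilon<\pi/2$ such that $\chi(s)=(2\pi)^{-s}\Gamma(s)\varphi(s)$ for $\Re s>\alpha$, $\chi(s)=(2\pi)^{s-\delta}\Gamma(\delta-s)\psi(\delta-s)$ for $\Re s<\beta$, and $\chi(\sigma+it)=O(e^{\epsilon|t|})$ as $|t|\to\infty$, uniformly in every strip $\sigma_1\le\sigma\le\sigma_2$. Put $M=\max(\sigma_{a,\varphi},\sigma_{a,\psi})$. Let $\gamma\in\mathbb R$ with $\gamma>M$ and $\gamma>\delta/2$, let $k$ be an integer with $k>2\gamma-\delta$, and let $u,v\in\mathbb C$ with $\Re u>\sigma_{a,\varphi}$, $\Re v>\sigma_{a,\psi}$ and $\Re u+\Re v-\gamma>M$. Assume moreover $\Re u+\gamma-\delta,\ \Re v+\gamma-\delta\notin\{0,1,\dots,k\}$ (that is, no pole of the integrands of the $G$-functions below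 lies on the line $\Re s=\gamma$). **Notation.** Let $$G^{1,1}_{3,1}\Big({}^{1,b,c}_{\ d}\,\Big|\,z\Big)=\frac1{2\pi i}\int_{\gamma-i\infty}^{\gamma+i\infty}\frac{\Gamma(d-s)\Gamma(s)}{\Gamma(b-s)\Gamma(c-s)}z^s\,ds,$$ the Meijer $G$-integral taken along the line $\Re s=\gamma$. With $f_a(n)=\sum_{d\mid n}\lambda_d^a f(d)f(n/d)$ and $g_a(n)=\sum_{d\mid n}\mu_d^a g(d)g(n/d)$, set for $x>0$ $$G_{f,k}(v,u,x)=(2\pi)^\delta\sum_{n\ge1}f_{\delta-v-u}(n)\,x^{\delta-v+k}\,G^{1,1}_{3,1}\Big({}^{1,\,\delta-v+k+1,\,\delta}_{\ \delta-v}\,\Big|\,\frac1{4\pi^2\lambda_nx}\Big),$$ $$G_{g,k}(u,v,x)=(2\pi)^\delta\sum_{n\ge1}g_{\delta-u-v}(n)\,x^{\delta-u+k}\,G^{1,1}_{3,1}\Big({}^{1,\,\delta-u+k+1,\,\delta}_{\ \delta-u}\,\Big|\,\frac1{4\pi^2\mu_nx}\Big).$$ For a function $F$ that is $C^{k-1}$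 near $x=1$, let $\frac{d^{(k)}}{dx}\big|_{x=1}F$ be the mean of the left and the right derivative of $F^{(k-1)}$ at $1$; it is the ordinary $k$-th derivative whenever that exists. **Theorem.** For all $x>0$ the integrals and series defining $G_{f,k}(v,u,x)$ and $G_{g,k}(u,v,x)$ converge absolutely; as functions of $x$, both are $C^{k-1}$ near $x=1$, their $(k-1)$-st derivatives have left and right derivatives at $1$, and $$\varphi(u)\psi(v)=-\sum_{i=1}^{n_\psi}\frac{r_{\psi,i}}{p_{\psi,i}-v}\varphi(v+u-p_{\psi,i})-\sum_{i=1}^{n_\varphi}\frac{r_{\varphi,i}}{p_{\varphi,i}-u}\psi(v+u-p_{\varphi,i})-\frac{d^{(k)}}{dx}\Big|_{x=1}G_{f,k}(v,u,x)-\frac{d^{(k)}}{dx}\Big|_{x=1}G_{g,k}(u,v,x).$$ Moreover, for every $x>0$ the following hold, with absolutely convergent outer series on the left. (i) If $C$ is a closed curve (continuous, differentiable off finitely many parameter values, with integrable derivative) in the strip $\delta-\gamma<\Re z<\Re u+\Re v-M$ (which contains $\delta-\gamma<\Re z\le\gamma$) with winding number $1$ about every pole of $\varphi$ and of $\psi$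 and about each of the points $u,u-1,\dots,u-k$ whose real part exceeds $\delta-\gamma$, then $$\frac1{\Gamma(k+1)}\sum_{n\ge1}\frac{g(n)}{\mu_n^{v+k}}\sum_{\lambda_m\le\mu_nx}\frac{f(m)}{\lambda_m^u}(\mu_nx-\lambda_m)^k=\frac1{2\pi i}\int_C\frac{\Gamma(z-u)}{\Gamma(z-u+k+1)}\varphi(z)\psi(v+u-z)x^{z-u+k}\,dz+G_{g,k}(u,v,x).$$ (ii) If $C$ is such a curve, with $v,v-1,\dots,v-k$ in place of $u,u-1,\dots,u-k$, then $$\frac1{\Gamma(k+1)}\sum_{m\ge1}\frac{f(m)}{\lambda_m^{u+k}}\sum_{\mu_n\le\lambda_mx}\frac{g(n)}{\mu_n^v}(\lambda_mx-\mu_n)^k=\frac1{2\pi i}\int_C\frac{\Gamma(z-v)}{\Gamma(z-v+k+1)}\psi(z)\varphi(v+u-z)x^{z-v+k}\,dz+G_{f,k}(v,u,x).$$ -/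

import Mathlib

noncomputable section

/-- The data of one generalized Dirichlet series `φ(s) = ∑_{n ≥ 1} f(n) λ_n^{-s}`:
* `lam` is a strictly increasing sequence of positive reals (indexed by `n ≥ 1`) tending to infinity
  with `λ_k λ_l = λ_m ↔ k l = m`, and `f` is a nonzero sequence;
* `σ` is the (finite) abscissa of absolute convergence;
* `φ` continues the series to the whole plane, holomorphically except for simple poles exactly at
  the finitely many real points of `P`, with residue `r p` at `p ∈ P`.
The values of `lam`, `f` at `0` and of `r` outside `P` play no role. -/
structure IsContinuedDirichletSeries (lam : ℕ → ℝ) (f : ℕ → ℂ) (σ : ℝ) (φ : ℂ → ℂ)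
    (P : Finset ℝ) (r : ℝ → ℂ) : Prop where
  lam_pos : ∀ n, 1 ≤ n → 0 < lam n
  lam_strictMono : ∀ m n, 1 ≤ m → m < n → lam m < lam n
  lam_tendsto : Filter.Tendsto lam Filter.atTop Filter.atTop
  lam_mul : ∀ k l m, 1 ≤ k → 1 ≤ l → 1 ≤ m → (lam k * lam l = lam m ↔ k * l = m)
  coeff_ne_zero : ∃ n, 1 ≤ n ∧ f n ≠ 0
  summable_of_lt : ∀ s : ℂ, σ < s.re → Summable fun n : ℕ+ => ‖f n / (lam n : ℂ) ^ s‖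
  not_summable_of_lt : ∀ s : ℂ, s.re < σ → ¬ Summable fun n : ℕ+ => ‖f n / (lam n : ℂ) ^ s‖
  eq_tsum : ∀ s : ℂ, σ < s.re → φ s = ∑' n : ℕ+, f n / (lam n : ℂ) ^ s
  differentiableAt : ∀ s : ℂ, (∀ p ∈ P, s ≠ (p : ℂ)) → DifferentiableAt ℂ φ s
  simple_pole : ∀ p ∈ P, r p ≠ 0 ∧
    Filter.Tendsto (fun s : ℂ => (s - p) * φ s) (nhdsWithin (p : ℂ) {(p : ℂ)}ᶜ) (nhds (r p))

/-- `(2π)^{-s} Γ(s) φ(s) = (2π)^{s-δ} Γ(δ-s) ψ(δ-s)` as an identity of meromorphic functions: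
at all `s` at which none of the four factors has a pole. `P`, `Q` are the poles of `φ`, `ψ`. -/
def FunctionalEquation (δ : ℝ) (φ ψ : ℂ → ℂ) (P Q : Finset ℝ) : Prop :=
  ∀ s : ℂ, (∀ m : ℕ, s ≠ -(m : ℂ)) → (∀ m : ℕ, (δ : ℂ) - s ≠ -(m : ℂ)) →
    (∀ p ∈ P, s ≠ (p : ℂ)) → (∀ q ∈ Q, (δ : ℂ) - s ≠ (q : ℂ)) →
    (2 * Real.pi : ℂ) ^ (-s) * Complex.Gamma s * φ s =
      (2 * Real.pi : ℂ) ^ (s - δ) * Complex.Gamma (δ - s) * ψ (δ - s)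

/-- The sense in which the functional equation is assumed to hold: a function `χ`, holomorphic on
the (connected) exterior of a bounded closed set `S`, and `O(e^{ε|t|})` with `0 < ε < π/2` in
vertical strips, equals one side far to the right and the other side far to the left. -/
def HasHeckeContinuation (δ : ℝ) (φ ψ : ℂ → ℂ) : Prop :=
  ∃ (S : Set ℂ) (χ : ℂ → ℂ) (ε α β : ℝ),
    IsClosed S ∧ Bornology.IsBounded S ∧ IsConnected Sᶜ ∧ DifferentiableOn ℂ χ Sᶜ ∧
    0 < ε ∧ ε < Real.pi / 2 ∧
    (∀ σ₁ σ₂ : ℝ, σ₁ < σ₂ → ∃ M T : ℝ, ∀ s : ℂ, σ₁ ≤ s.re → s.re ≤ σ₂ → T ≤ |s.im| →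
      ‖χ s‖ ≤ M * Real.exp (ε * |s.im|)) ∧
    (∀ s : ℂ, α < s.re → χ s = (2 * Real.pi : ℂ) ^ (-s) * Complex.Gamma s * φ s) ∧
    (∀ s : ℂ, s.re < β →
      χ s = (2 * Real.pi : ℂ) ^ (s - δ) * Complex.Gamma (δ - s) * ψ (δ - s))

/-- The complete set-up: two Dirichlet series linked by Hecke's functional equation. -/
structure HeckePair (δ : ℝ) (lam mu : ℕ → ℝ) (f g : ℕ → ℂ) (σφ σψ : ℝ) (φ ψ : ℂ → ℂ)
    (Pφ Pψ : Finset ℝ) (rφ rψ : ℝ → ℂ) : Prop where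
  delta_pos : 0 < δ
  left : IsContinuedDirichletSeries lam f σφ φ Pφ rφ
  right : IsContinuedDirichletSeries mu g σψ ψ Pψ rψ
  functionalEquation_left : FunctionalEquation δ φ ψ Pφ Pψ
  functionalEquation_right : FunctionalEquation δ ψ φ Pψ Pφ
  continuation : HasHeckeContinuation δ φ ψ
  abscissa_left : Pφ.Nonempty → σφ ≤ δ
  abscissa_right : Pψ.Nonempty → σψ ≤ δ

/-- Integrand of the Meijer `G`-function `G^{m,n}_{p,q}` with parameters `a_1, …, a_p` and
`b_1, …, b_q`. (`Complex.Gamma` is `0` at its poles, so a quotient by it vanishes there, as `1/Γ`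
does.) -/
def meijerIntegrand (m n : ℕ) {p q : ℕ} (a : Fin p → ℂ) (b : Fin q → ℂ) (z s : ℂ) : ℂ :=
  ((∏ j : Fin q with j.val < m, Complex.Gamma (b j - s)) *
      ∏ j : Fin p with j.val < n, Complex.Gamma (1 - a j + s)) /
    ((∏ j : Fin q with m ≤ j.val, Complex.Gamma (1 - b j + s)) *
      ∏ j : Fin p with n ≤ j.val, Complex.Gamma (a j - s)) * z ^ s

/-- The Meijer `G`-function integral `(1 / 2πi) ∫ ds` along the upward vertical line
`Re s = c`; with `s = c + it` one has `ds = i dt`. -/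
def meijerG (c : ℝ) (m n : ℕ) {p q : ℕ} (a : Fin p → ℂ) (b : Fin q → ℂ) (z : ℂ) : ℂ :=
  (1 / (2 * Real.pi : ℂ)) *
    ∫ t : ℝ, meijerIntegrand m n a b z ((c : ℂ) + (t : ℂ) * Complex.I)

/-- `f_a(n) = ∑_{d ∣ n} λ_d^a f(d) f(n/d)`. -/
def twistedConv (lam : ℕ → ℝ) (f : ℕ → ℂ) (a : ℂ) (n : ℕ) : ℂ :=
  ∑ d ∈ n.divisors, (lam d : ℂ) ^ a * f d * f (n / d)

/-- Upper parameters `1, δ - u + k + 1, δ`. -/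
def upperParams (δ : ℝ) (k : ℕ) (u : ℂ) : Fin 3 → ℂ := ![1, (δ : ℂ) - u + k + 1, (δ : ℂ)]

/-- Lower parameter `δ - u`. -/
def lowerParams (δ : ℝ) (u : ℂ) : Fin 1 → ℂ := ![(δ : ℂ) - u]

/-- The argument `1 / (4 π² λ_n x)`. -/
def gArg (lam : ℕ → ℝ) (x : ℝ) (n : ℕ) : ℂ := 1 / (4 * (Real.pi : ℂ) ^ 2 * lam n * x)

/-- The `n`-th term
`f_{δ-u-v}(n) x^{δ-u+k} G^{1,1}_{3,1}(1, δ-u+k+1, δ; δ-u | 1/(4π² λ_n x))`. -/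
def gTerm (γ δ : ℝ) (k : ℕ) (lam : ℕ → ℝ) (f : ℕ → ℂ) (u v : ℂ) (x : ℝ) (n : ℕ) : ℂ :=
  twistedConv lam f (δ - u - v) n * (x : ℂ) ^ ((δ : ℂ) - u + k) *
    meijerG γ 1 1 (upperParams δ k u) (lowerParams δ u) (gArg lam x n)

/-- `G_{f,k}(u,v,x) = (2π)^δ ∑_{n ≥ 1} gTerm`. -/
def gSeries (γ δ : ℝ) (k : ℕ) (lam : ℕ → ℝ) (f : ℕ → ℂ) (u v : ℂ) (x : ℝ) : ℂ :=
  (2 * Real.pi : ℂ) ^ (δ : ℂ) * ∑' n : ℕ+, gTerm γ δ k lam f u v x n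

/-- The `n`-th term `g(n) μ_n^{-v-k} ∑_{λ_m ≤ μ_n x} f(m) λ_m^{-u} (μ_n x - λ_m)^k` of the
double Riesz sum. The inner sum has finitely many nonzero terms. -/
def rieszTerm (k : ℕ) (lam mu : ℕ → ℝ) (f g : ℕ → ℂ) (u v : ℂ) (x : ℝ) (n : ℕ) : ℂ :=
  g n / (mu n : ℂ) ^ (v + k) *
    ∑' m : ℕ+, if lam m ≤ mu n * x then
      f m / (lam m : ℂ) ^ u * ((mu n : ℂ) * x - lam m) ^ k else 0

/-- Closed curves `c : [0,1] → ℂ`: continuous, differentiable off finitely many parameters, with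
integrable derivative. All piecewise `C¹` closed curves are of this kind. -/
structure IsClosedCurve (c : ℝ → ℂ) : Prop where
  continuousOn : ContinuousOn c (Set.Icc 0 1)
  closed : c 0 = c 1
  differentiable : ∃ E : Finset ℝ, ∀ t ∈ Set.Ioo (0 : ℝ) 1, t ∉ E → DifferentiableAt ℝ c t
  integrable : IntervalIntegrable (deriv c) MeasureTheory.volume 0 1

/-- `∫_c F(z) dz`. -/
def contourIntegral (c : ℝ → ℂ) (F : ℂ → ℂ) : ℂ := ∫ t in (0 : ℝ)..1, F (c t) * deriv c t

/-- `c` encircles `p` once counterclockwise: it avoids `p` and has winding number `1` about it. -/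
def Encircles (c : ℝ → ℂ) (p : ℂ) : Prop :=
  (∀ t ∈ Set.Icc (0 : ℝ) 1, c t ≠ p) ∧
    contourIntegral c (fun z => (z - p)⁻¹) = 2 * Real.pi * Complex.I

/-- Admissible contours for the identity attached to `u`: closed curves in the strip
`δ - γ < Re z < B` encircling the points of `P` and of `Q` and, among the points
`u, u - 1, …, u - k` (the poles of `Γ(z-u)/Γ(z-u+k+1)`), those with real part above `δ - γ`. -/
structure IsAdmissibleContour (γ δ B : ℝ) (k : ℕ) (u : ℂ) (P Q : Finset ℝ) (c : ℝ → ℂ) :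
    Prop where
  isClosedCurve : IsClosedCurve c
  in_strip : ∀ t ∈ Set.Icc (0 : ℝ) 1, δ - γ < (c t).re ∧ (c t).re < B
  encircles_left : ∀ p ∈ P, Encircles c (p : ℂ)
  encircles_right : ∀ q ∈ Q, Encircles c (q : ℂ)
  encircles_gamma : ∀ j : ℕ, j ≤ k → δ - γ < (u - j).re → Encircles c (u - j)

/-- `(1 / 2πi) ∫_c Γ(z-u)/Γ(z-u+k+1) φ(z) ψ(v+u-z) x^{z-u+k} dz`. -/
def polarTerm (k : ℕ) (φ ψ : ℂ → ℂ) (u v : ℂ) (x : ℝ) (c : ℝ → ℂ) : ℂ :=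
  1 / (2 * Real.pi * Complex.I) *
    contourIntegral c (fun z =>
      Complex.Gamma (z - u) / Complex.Gamma (z - u + k + 1) * φ z * ψ (v + u - z) *
        (x : ℂ) ^ (z - u + k))

/-- `D` is the `k`-th derivative of `F` at `x` in the following sense: for `k ≥ 1`, `F` is `C^{k-1}`
near `x`, its `(k-1)`-st derivative has a left and a right derivative at `x`, and `D` is their mean.
If `F` is `k` times differentiable at `x`, this is the ordinary `k`-th derivative. -/
def HasMeanDerivAt : ℕ → (ℝ → ℂ) → ℝ → ℂ → Prop
  | 0, F, x, D => F x = D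
  | k + 1, F, x, D => ContDiffAt ℝ k F x ∧ ∃ L R : ℂ,
      HasDerivWithinAt (iteratedDeriv k F) L (Set.Iic x) x ∧
      HasDerivWithinAt (iteratedDeriv k F) R (Set.Ici x) x ∧
      D = (L + R) / 2

end

noncomputable section

/-! ### Bounds for the Gamma function on vertical lines -/

/-! The product `φ(u) ψ(v)` is the absolutely convergent double series over pairs `(n, m)` of the
weights `g(n) μ_n^{-v} f(m) λ_m^{-u}`. It is split along `λ_m = μ_n`, the diagonal being shared
equally, and each half is reached from a smoothed version, the Riesz mean with the factor `(x -
λ_m/μ_n)_+^k / k!`.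

The smoothed half is a Perron integral: Mellin inversion of a truncated power
(`integral_rieszKernel_mul_cpow`) turns it into the integral of `x^{z-u+k} φ(z) ψ(v+u-z) /
((z-u)⋯(z-u+k))` over a line `Re z = b` on which both Dirichlet series converge absolutely
(`hasSum_riesz_eq_integral`). The line is moved to `Re z = δ - γ`. There the functional equation
replaces `φ(z)` by a Gamma quotient times `ψ(δ-z)`; with `s = δ - z` the product `ψ(s) ψ(s-δ+u+v)`
is the Dirichlet series of the twisted convolution, and termwise integration produces Meijer
`G`-functions and the series `G_{g,k}` (`gSeries_eq_integral`). The residues crossed form the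
integral over a rectangle, hence over any closed curve that encloses the same poles. This gives (i),
and exchanging the two Dirichlet series gives (ii).

Moving the line needs `φ(z) = O(|Im z|^k)` in the strip (`HeckePair.exists_norm_le_strip`).
Stirling's upper bound controls `φ` on the left edge, absolute convergence on the right edge,
Hecke's function `χ` supplies the a priori exponential bound, and Phragmén–Lindelöf interpolates.
The kernel decays like `|Im z|^{-k-1}`, which leaves `O(1/|Im z|)` on the horizontal sides.

For the product formula the identity is differentiated `k` times at `x = 1`. Each derivative lowers
the order of the kernel and of the truncated power by one. At order zero the rectangle integral is
evaluated by Cauchy's formula: the pole at `u` gives `φ(u) ψ(v)` and the poles of `φ` give the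
residue sum (`rectIntegral_rieszIntegrand_zero`). The truncated powers of order one have corners,
and the mean of the one-sided derivatives is the half sum with diagonal weight `1/2`. So the mean
derivative of each `G`-series is its half sum minus `φ(u) ψ(v)` minus its residue sum
(`hasMeanDerivAt_gSeries`). The half sums add up to `φ(u) ψ(v)` (`tsum_rieszWeight_add`), and adding
the two relations gives the theorem. -/

theorem norm_Gamma_le_Gamma_re {s : ℂ} (hs : 0 < s.re) :
    ‖Complex.Gamma s‖ ≤ Real.Gamma s.re := by
  rw [Complex.Gamma_eq_integral hs, Complex.GammaIntegral, Real.Gamma_eq_integral hs]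
  refine (MeasureTheory.norm_integral_le_integral_norm _).trans (le_of_eq ?_)
  refine MeasureTheory.setIntegral_congr_fun measurableSet_Ioi fun x hx => ?_
  have hx : 0 < x := hx
  simp only [norm_mul]
  rw [Complex.norm_cpow_eq_rpow_re_of_pos hx]
  rw [Complex.norm_real, Real.norm_of_nonneg (Real.exp_pos _).le, Complex.sub_re, Complex.one_re]

theorem norm_sin_le_exp (z : ℂ) : ‖Complex.sin z‖ ≤ Real.exp |z.im| := by
  have h1 : ‖Complex.exp (-z * Complex.I)‖ ≤ Real.exp |z.im| := by
    rw [Complex.norm_exp]; simpa using le_abs_self z.im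
  have h2 : ‖Complex.exp (z * Complex.I)‖ ≤ Real.exp |z.im| := by
    rw [Complex.norm_exp]; simpa using neg_le_abs z.im
  rw [Complex.sin, norm_div, norm_mul, Complex.norm_I, mul_one, Complex.norm_two]
  have := norm_sub_le (Complex.exp (-z * Complex.I)) (Complex.exp (z * Complex.I))
  linarith

/-- On the critical line `1 - s` is the complex conjugate of `s`, so the reflection formula computes
the modulus exactly: `|Γ(s)|² = π / cosh(π t)`. -/
theorem norm_Gamma_half_le (t : ℝ) :
    ‖Complex.Gamma (1 / 2 + t * Complex.I)‖ ≤
      Real.sqrt (2 * Real.pi) * Real.exp (-(Real.pi / 2 * |t|)) := by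
  have h1 : (‖Complex.Gamma (1 / 2 + t * Complex.I)‖ : ℝ) ^ 2 = Real.pi / Real.cosh (Real.pi * t) := by
    have h := Complex.Gamma_mul_Gamma_one_sub (1 / 2 + t * Complex.I)
    have hc : (1 : ℂ) - (1 / 2 + t * Complex.I) =
        (starRingEnd ℂ) (1 / 2 + t * Complex.I) := by
      apply Complex.ext <;> simp; norm_num
    have hs : Complex.sin (Real.pi * (1 / 2 + t * Complex.I)) = (Real.cosh (Real.pi * t) : ℝ) := by
      rw [mul_add, ← mul_assoc, Complex.sin_add, Complex.cos_mul_I, Complex.sin_mul_I]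
      have : (Real.pi : ℂ) * (1 / 2) = Real.pi / 2 := by ring
      rw [this, Complex.sin_pi_div_two, Complex.cos_pi_div_two]
      push_cast; ring
    rw [hc, Complex.Gamma_conj, Complex.mul_conj, hs, Complex.normSq_eq_norm_sq] at h
    exact_mod_cast h
  have h2 : Real.pi / Real.cosh (Real.pi * t) ≤
      (Real.sqrt (2 * Real.pi) * Real.exp (-(Real.pi / 2 * |t|))) ^ 2 := by
    rw [mul_pow, Real.sq_sqrt (by positivity), ← Real.exp_nat_mul, div_le_iff₀ (Real.cosh_pos _)]
    have h3 : Real.exp (Real.pi * |t|) ≤ 2 * Real.cosh (Real.pi * t) := by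
      rw [← Real.cosh_abs, abs_mul, abs_of_pos Real.pi_pos, Real.cosh_eq]
      have := Real.exp_pos (-(Real.pi * |t|))
      linarith
    have h4 : Real.exp ((2 : ℕ) * -(Real.pi / 2 * |t|)) * Real.exp (Real.pi * |t|) = 1 := by
      rw [← Real.exp_add]; simp; ring_nf
    have := Real.exp_pos ((2 : ℕ) * -(Real.pi / 2 * |t|))
    nlinarith [mul_le_mul_of_nonneg_left h3 this.le, Real.pi_pos]
  exact abs_le_of_sq_le_sq' (h1 ▸ h2) (by positivity) |>.2

theorem norm_Gamma_add_one (s : ℂ) (hs : s ≠ 0) :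
    ‖Complex.Gamma (s + 1)‖ = ‖s‖ * ‖Complex.Gamma s‖ := by
  rw [Complex.Gamma_add_one s hs, norm_mul]

theorem norm_Gamma_mul_cpow (s : ℂ) (hs : s ≠ 0) :
    ‖Complex.Gamma s * s ^ (-(s - 1 / 2))‖ =
      ‖Complex.Gamma s‖ * ‖s‖ ^ (-(s.re - 1 / 2)) * Real.exp (s.arg * s.im) := by
  rw [norm_mul, Complex.norm_cpow_of_ne_zero hs]
  simp [Real.exp_neg]
  ring

theorem arg_mul_im_le {s : ℂ} (hs : 0 ≤ s.re) : s.arg * s.im ≤ Real.pi / 2 * |s.im| := by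
  refine (le_abs_self _).trans ?_
  rw [abs_mul]
  exact mul_le_mul_of_nonneg_right (Complex.abs_arg_le_pi_div_two_iff.2 hs) (abs_nonneg _)

/-- Phragmén–Lindelöf in a strip of width one. On `Re s = 1/2` the power contributes `exp(arg s · Im
s) ≤ exp(π|t|/2)`, which the decay of `Γ` cancels; on `Re s = 3/2` the recursion costs a factor
`|s|`, and the power supplies `|s|⁻¹`. -/
theorem norm_Gamma_mul_cpow_le {s : ℂ} (h1 : 1 / 2 ≤ s.re) (h2 : s.re ≤ 3 / 2) :
    ‖Complex.Gamma s * s ^ (-(s - 1 / 2))‖ ≤ Real.sqrt (2 * Real.pi) := by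
  have hne : ∀ z : ℂ, 1 / 2 ≤ z.re → z ≠ 0 := by
    rintro z hz rfl; norm_num at hz
  have key : ∀ t : ℝ, ‖Complex.Gamma (1 / 2 + t * Complex.I)‖ * Real.exp (Real.pi / 2 * |t|) ≤
      Real.sqrt (2 * Real.pi) := fun t => by
    have h := mul_le_mul_of_nonneg_right (norm_Gamma_half_le t)
      (Real.exp_pos (Real.pi / 2 * |t|)).le
    rwa [mul_assoc, ← Real.exp_add, neg_add_cancel, Real.exp_zero, mul_one] at h
  refine PhragmenLindelof.vertical_strip (a := 1 / 2) (b := 3 / 2)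
    (f := fun s : ℂ => Complex.Gamma s * s ^ (-(s - 1 / 2))) ?_ ?_ ?_ ?_ h1 h2
  · refine DifferentiableOn.diffContOnCl fun z hz => ?_
    rw [Complex.closure_preimage_re, closure_Ioo (by norm_num)] at hz
    have hz1 : 1 / 2 ≤ z.re := hz.1
    refine DifferentiableAt.differentiableWithinAt (DifferentiableAt.mul ?_ ?_)
    · refine Complex.differentiableAt_Gamma _ fun m hm => ?_
      rw [hm] at hz1
      have : (0 : ℝ) ≤ m := m.cast_nonneg
      simp at hz1; linarith
    · exact DifferentiableAt.cpow (by fun_prop) (by fun_prop) (Or.inl (by linarith))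
  · obtain ⟨C, hC⟩ := (isCompact_Icc (a := (1 / 2 : ℝ)) (b := 3 / 2)).exists_bound_of_continuousOn
      (f := Real.Gamma) (fun x hx => by
        refine (Real.differentiableAt_Gamma fun m hm => ?_).continuousAt.continuousWithinAt
        rw [hm] at hx
        have : (0 : ℝ) ≤ m := m.cast_nonneg
        linarith [hx.1])
    -- The admissible growth is `exp(B exp(c|t|))` with `c < π / (3/2 - 1/2) = π`; here `c = 1` and
    -- `B = π/2`.
    refine ⟨1, by norm_num; linarith [Real.pi_gt_three], Real.pi / 2, ?_⟩
    refine Asymptotics.IsBigO.of_bound (C * 2) ?_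
    refine Filter.Eventually.filter_mono inf_le_right (Filter.mem_principal.2 fun z hz => ?_)
    have hz1 : 1 / 2 < z.re := hz.1
    have hz2 : z.re < 3 / 2 := hz.2
    show ‖Complex.Gamma z * z ^ (-(z - 1 / 2))‖ ≤ _
    rw [norm_Gamma_mul_cpow z (hne z hz1.le), Real.norm_of_nonneg (Real.exp_pos _).le]
    have hG : ‖Complex.Gamma z‖ ≤ C := (norm_Gamma_le_Gamma_re (by linarith)).trans
      ((le_abs_self _).trans (hC z.re ⟨hz1.le, hz2.le⟩))
    have hn : 1 / 2 ≤ ‖z‖ := hz1.le.trans (Complex.re_le_norm z)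
    have hp : ‖z‖ ^ (-(z.re - 1 / 2)) ≤ 2 := by
      have h3 : ‖z‖ ^ (-(z.re - 1 / 2)) ≤ (1 / 2 : ℝ) ^ (-(z.re - 1 / 2)) :=
        Real.rpow_le_rpow_of_nonpos (by norm_num) hn (by linarith)
      have h4 : (1 / 2 : ℝ) ^ (-(z.re - 1 / 2)) ≤ (1 / 2 : ℝ) ^ (-1 : ℝ) :=
        Real.rpow_le_rpow_of_exponent_ge (by norm_num) (by norm_num) (by linarith)
      refine h3.trans (h4.trans (by rw [Real.rpow_neg_one]; norm_num))
    have he : Real.exp (z.arg * z.im) ≤ Real.exp (Real.pi / 2 * Real.exp (1 * |z.im|)) := by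
      refine Real.exp_le_exp.2 ((arg_mul_im_le (by linarith)).trans ?_)
      have := Real.add_one_le_exp |z.im|
      rw [one_mul]
      exact mul_le_mul_of_nonneg_left (by linarith) (by positivity)
    have hC0 : 0 ≤ C := (norm_nonneg _).trans hG
    gcongr
  · intro z hz
    show ‖Complex.Gamma z * z ^ (-(z - 1 / 2))‖ ≤ _
    rw [norm_Gamma_mul_cpow z (hne z hz.ge), hz]
    have hze : z = 1 / 2 + z.im * Complex.I := by
      apply Complex.ext <;> simp [hz]
    have := key z.im
    rw [← hze] at this
    simp only [sub_self, neg_zero, Real.rpow_zero, mul_one]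
    refine le_trans ?_ this
    have hle := arg_mul_im_le (s := z) (by rw [hz]; norm_num)
    exact mul_le_mul_of_nonneg_left (Real.exp_le_exp.2 hle) (norm_nonneg _)
  · intro z hz
    show ‖Complex.Gamma z * z ^ (-(z - 1 / 2))‖ ≤ _
    have hz1 : 1 / 2 ≤ z.re := by rw [hz]; norm_num
    rw [norm_Gamma_mul_cpow z (hne z hz1), hz]
    have hze : z = (1 / 2 + z.im * Complex.I) + 1 := by
      apply Complex.ext <;> simp [hz]; norm_num
    have := key z.im
    have h5 : ‖Complex.Gamma z‖ ≤ ‖z‖ * ‖Complex.Gamma (1 / 2 + z.im * Complex.I)‖ := by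
      conv_lhs => rw [hze]
      rw [norm_Gamma_add_one _ (hne _ (by simp))]
      gcongr
      rw [← sq_le_sq₀ (norm_nonneg _) (norm_nonneg _), ← Complex.normSq_eq_norm_sq,
        ← Complex.normSq_eq_norm_sq, Complex.normSq_apply, Complex.normSq_apply, hz]
      simp; norm_num
    have hpos : 0 < ‖z‖ := norm_pos_iff.2 (hne z hz1)
    have h6 : ‖z‖ ^ (-((3 : ℝ) / 2 - 1 / 2)) = ‖z‖⁻¹ := by
      norm_num [Real.rpow_neg_one]
    rw [h6]
    calc ‖Complex.Gamma z‖ * ‖z‖⁻¹ * Real.exp (z.arg * z.im)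
        ≤ (‖z‖ * ‖Complex.Gamma (1 / 2 + z.im * Complex.I)‖) * ‖z‖⁻¹ *
          Real.exp (Real.pi / 2 * |z.im|) := by
          have hle := arg_mul_im_le (s := z) (by linarith)
          refine mul_le_mul (by gcongr) (Real.exp_le_exp.2 hle) (Real.exp_pos _).le (by positivity)
      _ = ‖Complex.Gamma (1 / 2 + z.im * Complex.I)‖ * Real.exp (Real.pi / 2 * |z.im|) := by
          field_simp
      _ ≤ _ := this

/-- Jordan's inequality bounds `π/2 - arg s` by `(π/2) cos(arg s) = (π/2) Re s / |s|`, and `Im s ≤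
|s|`. The defect from `π/2 · Im s` is therefore bounded on each vertical line. -/
theorem le_arg_mul_im {s : ℂ} (hs : 0 < s.re) (ht : 0 < s.im) :
    Real.pi / 2 * s.im - Real.pi / 2 * s.re ≤ s.arg * s.im := by
  have h1 : |s.arg| ≤ Real.pi / 2 := Complex.abs_arg_le_pi_div_two_iff.2 hs.le
  have h0 : 0 ≤ s.arg := Complex.arg_nonneg_iff.2 ht.le
  rw [abs_of_nonneg h0] at h1
  have h2 := Real.mul_le_sin (x := Real.pi / 2 - s.arg) (by linarith) (by linarith)
  have hne : s ≠ 0 := fun h => by rw [h] at hs; simp at hs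
  rw [Real.sin_pi_div_two_sub, Complex.cos_arg hne, le_div_iff₀ (norm_pos_iff.2 hne)] at h2
  have h3 : s.im ≤ ‖s‖ := Complex.im_le_norm s
  have h4 : 2 / Real.pi * (Real.pi / 2 - s.arg) * s.im ≤ s.re := by
    refine le_trans (mul_le_mul_of_nonneg_left h3 ?_) h2
    have := Real.pi_pos
    have : 0 ≤ Real.pi / 2 - s.arg := by linarith
    positivity
  have h5 : 2 / Real.pi * (Real.pi / 2 - s.arg) * s.im * (Real.pi / 2) =
    Real.pi / 2 * s.im - s.arg * s.im := by
    field_simp [Real.pi_pos.ne']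
  have h6 := mul_le_mul_of_nonneg_right h4 (Real.pi_div_two_pos).le
  rw [h5] at h6
  linarith

theorem norm_add_mul_I_le (σ : ℝ) {t : ℝ} (ht : 1 ≤ t) :
    ‖(σ : ℂ) + t * Complex.I‖ ≤ (|σ| + 1) * t := by
  refine (norm_add_le _ _).trans ?_
  simp only [norm_mul, Complex.norm_real, Complex.norm_I, mul_one, Real.norm_eq_abs]
  rw [abs_of_nonneg (by linarith : (0 : ℝ) ≤ t)]
  nlinarith [abs_nonneg σ]

/-- The upper bound in Stirling's formula on the upper half of the line `Re s = σ`. -/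
def GammaLineBound (σ : ℝ) : Prop :=
  ∃ C, 0 < C ∧ ∀ t : ℝ, 1 ≤ t → ‖Complex.Gamma (σ + t * Complex.I)‖ ≤
    C * t ^ (σ - 1 / 2) * Real.exp (-(Real.pi / 2 * t))

theorem gammaLineBound_of_mem {σ : ℝ} (h1 : 1 / 2 ≤ σ) (h2 : σ ≤ 3 / 2) :
    GammaLineBound σ := by
  refine ⟨Real.sqrt (2 * Real.pi) * (|σ| + 1) ^ (σ - 1 / 2) * Real.exp (Real.pi / 2 * σ),
    by positivity, fun t ht => ?_⟩
  set s : ℂ := σ + t * Complex.I with hs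
  have hre : s.re = σ := by simp [hs]
  have him : s.im = t := by simp [hs]
  have hne : s ≠ 0 := fun h => by rw [h] at hre; simp at hre; linarith
  have hpos : 0 < ‖s‖ := norm_pos_iff.2 hne
  have h := norm_Gamma_mul_cpow_le (s := s) (by rw [hre]; exact h1) (by rw [hre]; exact h2)
  rw [norm_Gamma_mul_cpow s hne, hre, him, Real.rpow_neg hpos.le] at h
  have hp : 0 < ‖s‖ ^ (σ - 1 / 2) := Real.rpow_pos_of_pos hpos _
  have hE := Real.exp_pos (s.arg * t)
  have hG : ‖Complex.Gamma s‖ ≤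
      Real.sqrt (2 * Real.pi) * ‖s‖ ^ (σ - 1 / 2) * Real.exp (-(s.arg * t)) := by
    rw [Real.exp_neg, ← div_eq_mul_inv, le_div_iff₀ hE]
    rw [mul_assoc, mul_left_comm, ← div_eq_inv_mul, div_le_iff₀ hp] at h
    exact h
  have hle := le_arg_mul_im (s := s) (by rw [hre]; linarith) (by rw [him]; linarith)
  rw [hre, him] at hle
  calc ‖Complex.Gamma s‖ ≤ _ := hG
    _ ≤ Real.sqrt (2 * Real.pi) * ((|σ| + 1) * t) ^ (σ - 1 / 2) *
        Real.exp (-(Real.pi / 2 * t) + Real.pi / 2 * σ) := by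
        gcongr
        · exact norm_add_mul_I_le σ ht
        · linarith
    _ = _ := by
        rw [Real.mul_rpow (by positivity) (by linarith), Real.exp_add]; ring

/-- In `Γ(s+1) = s Γ(s)` the factor `|s|` lies between `t` and `(|σ|+1) t`, so the bound can be
carried by one unit in either direction. -/
theorem gammaLineBound_add_one_iff (σ : ℝ) : GammaLineBound σ ↔ GammaLineBound (σ + 1) := by
  have hne : ∀ t : ℝ, 1 ≤ t → (σ : ℂ) + t * Complex.I ≠ 0 := fun t ht h => by
    have := congrArg Complex.im h
    simp at this; linarith
  have hG : ∀ t : ℝ, 1 ≤ t → ‖Complex.Gamma (((σ + 1 : ℝ) : ℂ) + t * Complex.I)‖ =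
      ‖(σ : ℂ) + t * Complex.I‖ * ‖Complex.Gamma (σ + t * Complex.I)‖ := fun t ht => by
    rw [← norm_Gamma_add_one _ (hne t ht)]
    congr 2; push_cast; ring
  have hpw : ∀ t : ℝ, 1 ≤ t → t ^ (σ + 1 - 1 / 2) = t ^ (σ - 1 / 2) * t := fun t ht => by
    rw [show σ + 1 - 1 / 2 = σ - 1 / 2 + 1 by ring, Real.rpow_add_one (by linarith)]
  constructor
  · rintro ⟨C, hC, h⟩
    refine ⟨(|σ| + 1) * C, by positivity, fun t ht => ?_⟩
    rw [hG t ht, hpw t ht]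
    calc _ ≤ ((|σ| + 1) * t) * (C * t ^ (σ - 1 / 2) * Real.exp (-(Real.pi / 2 * t))) := by
          gcongr
          · exact norm_add_mul_I_le σ ht
          · exact h t ht
      _ = _ := by ring
  · rintro ⟨C, hC, h⟩
    refine ⟨C, hC, fun t ht => ?_⟩
    have h' := h t ht
    rw [hG t ht, hpw t ht] at h'
    have hn : t ≤ ‖(σ : ℂ) + t * Complex.I‖ := by
      have := Complex.im_le_norm ((σ : ℂ) + t * Complex.I)
      simpa using this
    have ht0 : 0 < t := by linarith
    refine le_of_mul_le_mul_left (a := t) ?_ ht0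
    calc t * ‖Complex.Gamma (σ + t * Complex.I)‖ ≤ _ := by gcongr
      _ ≤ _ := h'
      _ = _ := by ring

/-- The upper bound in Stirling's formula on a vertical line. -/
theorem exists_norm_Gamma_le (σ : ℝ) :
    ∃ C, 0 < C ∧ ∀ t : ℝ, 1 ≤ |t| → ‖Complex.Gamma (σ + t * Complex.I)‖ ≤
      C * |t| ^ (σ - 1 / 2) * Real.exp (-(Real.pi / 2 * |t|)) := by
  have hZ : ∀ (n : ℤ) (τ : ℝ), 1 / 2 ≤ τ → τ ≤ 3 / 2 → GammaLineBound (τ + n) := by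
    intro n τ h1 h2
    induction n with
    | zero => simpa using gammaLineBound_of_mem h1 h2
    | succ i ih =>
      have := (gammaLineBound_add_one_iff (τ + i)).1 (by simpa using ih)
      simpa [add_assoc] using this
    | pred i ih =>
      refine (gammaLineBound_add_one_iff (τ + ((-i - 1 : ℤ) : ℝ))).2 ?_
      simpa [add_assoc] using ih
  -- Every `σ` is an integer plus a point of the base strip `[1/2, 3/2]`.
  have hτ1 : 1 / 2 ≤ σ - (⌊σ - 1 / 2⌋ : ℤ) := by linarith [Int.floor_le (σ - 1 / 2)]
  have hτ2 : σ - (⌊σ - 1 / 2⌋ : ℤ) ≤ 3 / 2 := by linarith [Int.lt_floor_add_one (σ - 1 / 2)]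
  obtain ⟨C, hC, h⟩ := hZ ⌊σ - 1 / 2⌋ _ hτ1 hτ2
  simp only [sub_add_cancel] at h
  refine ⟨C, hC, fun t ht => ?_⟩
  rcases le_total 0 t with h0 | h0
  · rw [abs_of_nonneg h0] at ht ⊢
    exact h t ht
  · rw [abs_of_nonpos h0] at ht ⊢
    refine le_of_eq_of_le ?_ (h (-t) ht)
    rw [← Complex.norm_conj, ← Complex.Gamma_conj]
    simp

/-- The positive integers have to be excluded: there `Γ(1 - s)` has a pole, to which `Complex.Gamma`
assigns the value `0`, whereas `1/Γ(s)` is not zero. -/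
theorem Gamma_inv_eq (s : ℂ) :
    (Complex.Gamma s)⁻¹ = Complex.Gamma (1 - s) * Complex.sin (Real.pi * s) / Real.pi ∨
      ∃ m : ℕ, s = m + 1 := by
  by_cases h : ∀ m : ℕ, 1 - s ≠ -m
  · left
    have h1 := Complex.Gamma_mul_Gamma_one_sub s
    have h2 := Complex.Gamma_ne_zero h
    by_cases h3 : Complex.Gamma s = 0
    · rw [h3, inv_zero]
      rw [h3, zero_mul, eq_comm, div_eq_zero_iff] at h1
      rcases h1 with h1 | h1
      · simp [Real.pi_ne_zero] at h1
      · simp [h1]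
    · have h4 : Complex.sin (Real.pi * s) ≠ 0 := by
        intro h4
        rw [h4, div_zero] at h1
        exact (mul_ne_zero h3 h2) h1
      rw [eq_div_iff h4] at h1
      have : (Real.pi : ℂ) ≠ 0 := by simp [Real.pi_ne_zero]
      rw [inv_eq_one_div, div_eq_div_iff h3 this, one_mul]
      linear_combination -h1
  · right
    push Not at h
    obtain ⟨m, hm⟩ := h
    exact ⟨m, by linear_combination -hm⟩

theorem Gamma_inv_eq_of_im_ne_zero {s : ℂ} (hs : s.im ≠ 0) :
    (Complex.Gamma s)⁻¹ = Complex.Gamma (1 - s) * Complex.sin (Real.pi * s) / Real.pi := by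
  rcases Gamma_inv_eq s with h | ⟨m, hm⟩
  · exact h
  · rw [hm] at hs; simp at hs

theorem exists_norm_Gamma_inv_le (σ : ℝ) :
    ∃ C, 0 < C ∧ ∀ t : ℝ, 1 ≤ |t| → ‖(Complex.Gamma (σ + t * Complex.I))⁻¹‖ ≤
      C * |t| ^ (1 / 2 - σ) * Real.exp (Real.pi / 2 * |t|) := by
  obtain ⟨C, hC, h⟩ := exists_norm_Gamma_le (1 - σ)
  refine ⟨C / Real.pi, by positivity, fun t ht => ?_⟩
  have h0 : ((σ : ℂ) + t * Complex.I).im ≠ 0 := by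
    have : t ≠ 0 := fun h => by rw [h] at ht; simp at ht; linarith
    simpa using this
  rw [Gamma_inv_eq_of_im_ne_zero h0, norm_div, norm_mul, Complex.norm_real,
    Real.norm_of_nonneg Real.pi_pos.le]
  have h1 := h (-t) (by simpa using ht)
  have h2 : ‖Complex.sin (Real.pi * (σ + t * Complex.I))‖ ≤ Real.exp (Real.pi * |t|) := by
    refine (norm_sin_le_exp _).trans (le_of_eq ?_)
    simp [abs_mul, abs_of_pos Real.pi_pos]
  have h3 : (1 : ℂ) - (σ + t * Complex.I) = ((1 - σ : ℝ) : ℂ) + (-t : ℝ) * Complex.I := by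
    push_cast; ring
  rw [h3]
  rw [abs_neg] at h1
  calc _ ≤ (C * |t| ^ (1 - σ - 1 / 2) * Real.exp (-(Real.pi / 2 * |t|))) *
        Real.exp (Real.pi * |t|) / Real.pi := by gcongr
    _ = C / Real.pi * |t| ^ (1 - σ - 1 / 2) *
        Real.exp (-(Real.pi / 2 * |t|) + Real.pi * |t|) := by rw [Real.exp_add]; ring
    _ = _ := by congr 3 <;> ring

/-- The two arguments have opposite imaginary parts, so the exponential factors of Stirling's bound
cancel and only a power survives. With `a = γ`, `b = δ - γ` this is the Gamma factor of the
functional equation, of size `|t|^(2γ-δ)`. -/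
theorem exists_norm_Gamma_div_le (a b : ℝ) :
    ∃ C, 0 < C ∧ ∀ t : ℝ, 1 ≤ |t| →
      ‖Complex.Gamma (a + t * Complex.I) * (Complex.Gamma (b - t * Complex.I))⁻¹‖ ≤
      C * |t| ^ (a - b) := by
  obtain ⟨C, hC, h⟩ := exists_norm_Gamma_le a
  obtain ⟨C', hC', h'⟩ := exists_norm_Gamma_inv_le b
  refine ⟨C * C', by positivity, fun t ht => ?_⟩
  have h1 := h' (-t) (by simpa using ht)
  have ht0 : 0 < |t| := by linarith
  rw [norm_mul]
  have h2 : (b : ℂ) - t * Complex.I = b + (-t : ℝ) * Complex.I := by push_cast; ring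
  rw [h2]
  rw [abs_neg] at h1
  calc _ ≤ (C * |t| ^ (a - 1 / 2) * Real.exp (-(Real.pi / 2 * |t|))) *
      (C' * |t| ^ (1 / 2 - b) * Real.exp (Real.pi / 2 * |t|)) := by
        gcongr
        exact h t ht
    _ = C * C' * (|t| ^ (a - 1 / 2) * |t| ^ (1 / 2 - b)) *
        Real.exp (-(Real.pi / 2 * |t|) + Real.pi / 2 * |t|) := by rw [Real.exp_add]; ring
    _ = _ := by rw [← Real.rpow_add ht0]; simp

/-- Each factor `s + j` of the recursion has modulus at least `|Im s| ≥ 1`. -/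
theorem norm_Gamma_le_norm_Gamma_add_nat {s : ℂ} (hs : 1 ≤ |s.im|) (n : ℕ) :
    ‖Complex.Gamma s‖ ≤ ‖Complex.Gamma (s + n)‖ := by
  induction n with
  | zero => simp
  | succ n ih =>
    have h1 : 1 ≤ ‖s + n‖ := hs.trans (by simpa using Complex.abs_im_le_norm (s + n))
    have h2 : s + n ≠ 0 := norm_pos_iff.1 (by linarith)
    rw [Nat.cast_succ, ← add_assoc, norm_Gamma_add_one _ h2]
    nlinarith [norm_nonneg (Complex.Gamma (s + n))]

/-- A crude bound for `1 / Γ` in vertical strips. -/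
theorem exists_norm_Gamma_inv_le_strip (a b : ℝ) :
    ∃ C, 0 ≤ C ∧ ∀ s : ℂ, a ≤ s.re → s.re ≤ b → 1 ≤ |s.im| →
      ‖(Complex.Gamma s)⁻¹‖ ≤ C * Real.exp (Real.pi * |s.im|) := by
  -- After the shift by `n > b`, `Re(1 - s) + n` is positive throughout the strip, so the real Gamma
  -- function on a compact interval is a bound.
  obtain ⟨n, hn⟩ := exists_nat_gt b
  obtain ⟨C, hC⟩ := (isCompact_Icc (a := 1 - b + n) (b := 1 - a + n)).exists_bound_of_continuousOn
      (f := Real.Gamma) (fun x hx => by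
        refine (Real.differentiableAt_Gamma fun m hm => ?_).continuousAt.continuousWithinAt
        rw [hm] at hx
        have : (0 : ℝ) ≤ m := m.cast_nonneg
        linarith [hx.1])
  refine ⟨|C| / Real.pi, by positivity, fun s h1 h2 h3 => ?_⟩
  have h0 : s.im ≠ 0 := fun h => by rw [h] at h3; simp at h3; linarith
  rw [Gamma_inv_eq_of_im_ne_zero h0, norm_div, norm_mul, Complex.norm_real,
    Real.norm_of_nonneg Real.pi_pos.le]
  have h4 : ‖Complex.Gamma (1 - s)‖ ≤ |C| := by
    refine (norm_Gamma_le_norm_Gamma_add_nat (by simpa using h3) n).trans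
      ((norm_Gamma_le_Gamma_re (by simp; linarith)).trans ?_)
    refine (le_abs_self _).trans ((hC _ ?_).trans (le_abs_self _))
    simp; constructor <;> linarith
  have h5 : ‖Complex.sin (Real.pi * s)‖ ≤ Real.exp (Real.pi * |s.im|) := by
    refine (norm_sin_le_exp _).trans (le_of_eq ?_)
    simp [abs_mul, abs_of_pos Real.pi_pos]
  calc _ ≤ |C| * Real.exp (Real.pi * |s.im|) / Real.pi := by gcongr
    _ = _ := by ring

end

noncomputable section

/-! ### Integrals over the boundary of a rectangle and over closed curves -/

/-- The integral of `F` over the boundary of `[a, b] × [-T, T]`, counterclockwise. -/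
def rectIntegral (a b T : ℝ) (F : ℂ → ℂ) : ℂ :=
  (∫ x in a..b, F (x + (-T : ℝ) * Complex.I)) - (∫ x in a..b, F (x + T * Complex.I)) +
    Complex.I * (∫ y in (-T)..T, F (b + y * Complex.I)) -
    Complex.I * (∫ y in (-T)..T, F (a + y * Complex.I))

/-- The boundary of `[a, b] × [-T, T]`. -/
def rectFrame (a b T : ℝ) : Set ℂ :=
  {z | z.re ∈ Set.Icc a b ∧ z.im ∈ Set.Icc (-T) T ∧
    (z.re = a ∨ z.re = b ∨ z.im = T ∨ z.im = -T)}

section rect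

variable {a b T : ℝ}

theorem bottom_mem_rectFrame (hT : 0 ≤ T) {x : ℝ} (hx : x ∈ Set.Icc a b) :
    (x : ℂ) + (-T : ℝ) * Complex.I ∈ rectFrame a b T := by
  refine ⟨by simpa using hx, ?_, Or.inr (Or.inr (Or.inr ?_))⟩
  · simp; linarith
  · simp

theorem top_mem_rectFrame (hT : 0 ≤ T) {x : ℝ} (hx : x ∈ Set.Icc a b) :
    (x : ℂ) + T * Complex.I ∈ rectFrame a b T := by
  refine ⟨by simpa using hx, ?_, Or.inr (Or.inr (Or.inl ?_))⟩
  · simp; linarith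
  · simp

theorem right_mem_rectFrame (hab : a ≤ b) {y : ℝ} (hy : y ∈ Set.Icc (-T) T) :
    (b : ℂ) + y * Complex.I ∈ rectFrame a b T := by
  refine ⟨?_, by simpa using hy, Or.inr (Or.inl ?_)⟩
  · simp [hab]
  · simp

theorem left_mem_rectFrame (hab : a ≤ b) {y : ℝ} (hy : y ∈ Set.Icc (-T) T) :
    (a : ℂ) + y * Complex.I ∈ rectFrame a b T := by
  refine ⟨?_, by simpa using hy, Or.inl ?_⟩
  · simp [hab]
  · simp

theorem rectIntegral_congr (hab : a ≤ b) (hT : 0 ≤ T) {F G : ℂ → ℂ}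
    (h : Set.EqOn F G (rectFrame a b T)) : rectIntegral a b T F = rectIntegral a b T G := by
  have hT' : -T ≤ T := by linarith
  unfold rectIntegral
  have e1 : ∫ x in a..b, F (x + (-T : ℝ) * Complex.I) = ∫ x in a..b, G (x + (-T : ℝ) * Complex.I) :=
    intervalIntegral.integral_congr fun x hx =>
      h (bottom_mem_rectFrame hT (by rwa [Set.uIcc_of_le hab] at hx))
  have e2 : ∫ x in a..b, F (x + T * Complex.I) = ∫ x in a..b, G (x + T * Complex.I) :=
    intervalIntegral.integral_congr fun x hx =>
      h (top_mem_rectFrame hT (by rwa [Set.uIcc_of_le hab] at hx))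
  have e3 : ∫ y in (-T)..T, F (b + y * Complex.I) = ∫ y in (-T)..T, G (b + y * Complex.I) :=
    intervalIntegral.integral_congr fun x hx =>
      h (right_mem_rectFrame hab (by rwa [Set.uIcc_of_le hT'] at hx))
  have e4 : ∫ y in (-T)..T, F (a + y * Complex.I) = ∫ y in (-T)..T, G (a + y * Complex.I) :=
    intervalIntegral.integral_congr fun x hx =>
      h (left_mem_rectFrame hab (by rwa [Set.uIcc_of_le hT'] at hx))
  rw [e1, e2, e3, e4]

theorem continuousOn_sides (hab : a ≤ b) (hT : 0 ≤ T) {F : ℂ → ℂ}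
    (hF : ContinuousOn F (rectFrame a b T)) :
    ContinuousOn (fun x : ℝ => F (x + (-T : ℝ) * Complex.I)) (Set.uIcc a b) ∧
    ContinuousOn (fun x : ℝ => F (x + T * Complex.I)) (Set.uIcc a b) ∧
    ContinuousOn (fun y : ℝ => F (b + y * Complex.I)) (Set.uIcc (-T) T) ∧
    ContinuousOn (fun y : ℝ => F (a + y * Complex.I)) (Set.uIcc (-T) T) := by
  have hT' : -T ≤ T := by linarith
  rw [Set.uIcc_of_le hab, Set.uIcc_of_le hT']
  exact ⟨hF.comp (by fun_prop) fun x hx => bottom_mem_rectFrame hT hx,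
    hF.comp (by fun_prop) fun x hx => top_mem_rectFrame hT hx,
    hF.comp (by fun_prop) fun x hx => right_mem_rectFrame hab hx,
    hF.comp (by fun_prop) fun x hx => left_mem_rectFrame hab hx⟩

theorem rectIntegral_add (hab : a ≤ b) (hT : 0 ≤ T) {F G : ℂ → ℂ}
    (hF : ContinuousOn F (rectFrame a b T)) (hG : ContinuousOn G (rectFrame a b T)) :
    rectIntegral a b T (fun z => F z + G z) = rectIntegral a b T F + rectIntegral a b T G := by
  obtain ⟨f1, f2, f3, f4⟩ := continuousOn_sides hab hT hF
  obtain ⟨g1, g2, g3, g4⟩ := continuousOn_sides hab hT hG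
  unfold rectIntegral
  rw [intervalIntegral.integral_add f1.intervalIntegrable g1.intervalIntegrable,
    intervalIntegral.integral_add f2.intervalIntegrable g2.intervalIntegrable,
    intervalIntegral.integral_add f3.intervalIntegrable g3.intervalIntegrable,
    intervalIntegral.integral_add f4.intervalIntegrable g4.intervalIntegrable]
  ring

theorem rectIntegral_const_mul (c : ℂ) (F : ℂ → ℂ) :
    rectIntegral a b T (fun z => c * F z) = c * rectIntegral a b T F := by
  unfold rectIntegral
  simp only [intervalIntegral.integral_const_mul]
  ring

theorem rectIntegral_sum (hab : a ≤ b) (hT : 0 ≤ T) {ι : Type*} (s : Finset ι) {F : ι → ℂ → ℂ}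
    (hF : ∀ i ∈ s, ContinuousOn (F i) (rectFrame a b T)) :
    rectIntegral a b T (fun z => ∑ i ∈ s, F i z) = ∑ i ∈ s, rectIntegral a b T (F i) := by
  classical
  induction s using Finset.induction_on with
  | empty => simp [rectIntegral]
  | insert i s hi ih =>
    simp only [Finset.sum_insert hi]
    rw [rectIntegral_add hab hT (hF i (Finset.mem_insert_self i s)) (continuousOn_finsetSum s
      fun j hj => hF j (Finset.mem_insert_of_mem hj)),
      ih fun j hj => hF j (Finset.mem_insert_of_mem hj)]

theorem rectIntegral_eq_zero_of_differentiableOn (hab : a ≤ b) {F : ℂ → ℂ}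
    (hF : DifferentiableOn ℂ F {z | z.re ∈ Set.Icc a b}) : rectIntegral a b T F = 0 := by
  have h := Complex.integral_boundary_rect_eq_zero_of_differentiableOn F
    ((a : ℂ) + (-T : ℝ) * Complex.I) ((b : ℂ) + T * Complex.I) (hF.mono ?_)
  · simpa [rectIntegral] using h
  · intro z hz
    have h1 := hz.1
    simp only [Complex.add_re, Complex.ofReal_re, Complex.mul_re, Complex.I_re, mul_zero,
      Complex.ofReal_im, Complex.I_im, zero_mul, sub_zero, add_zero, Set.mem_preimage,
      Set.uIcc_of_le hab] at h1
    exact h1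

theorem integral_horizontal_eq_sub {F G : ℂ → ℂ} {c : ℂ} (hab : a ≤ b)
    (h : ∀ x : ℝ, x ∈ Set.Icc a b → HasDerivAt G (F (x + c)) (x + c))
    (hF : ContinuousOn (fun x : ℝ => F (x + c)) (Set.uIcc a b)) :
    ∫ x in a..b, F (x + c) = G (b + c) - G (a + c) := by
  refine intervalIntegral.integral_eq_sub_of_hasDerivAt (f := fun x : ℝ => G (x + c))
    (fun x hx => ?_) hF.intervalIntegrable
  rw [Set.uIcc_of_le hab] at hx
  have h1 : HasDerivAt (fun z : ℂ => G (z + c)) (F (x + c)) (x : ℂ) := by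
    simpa using (h x hx).comp_add_const (x : ℂ) c
  exact h1.comp_ofReal

theorem integral_vertical_eq_sub {F G : ℂ → ℂ} {c : ℂ} (hT : 0 ≤ T)
    (h : ∀ y : ℝ, y ∈ Set.Icc (-T) T → HasDerivAt G (F (c + y * Complex.I)) (c + y * Complex.I))
    (hF : ContinuousOn (fun y : ℝ => F (c + y * Complex.I)) (Set.uIcc (-T) T)) :
    Complex.I * ∫ y in (-T)..T, F (c + y * Complex.I) =
      G (c + T * Complex.I) - G (c + (-T : ℝ) * Complex.I) := by
  rw [← intervalIntegral.integral_const_mul]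
  refine intervalIntegral.integral_eq_sub_of_hasDerivAt (f := fun y : ℝ => G (c + y * Complex.I))
    (fun y hy => ?_) (hF.intervalIntegrable.const_mul _)
  rw [Set.uIcc_of_le (by linarith)] at hy
  have h0 : HasDerivAt (fun z : ℂ => c + z * Complex.I) Complex.I (y : ℂ) := by
    simpa using ((hasDerivAt_id (y : ℂ)).mul_const Complex.I).const_add c
  have h1 := HasDerivAt.comp (y : ℂ) (h y hy) h0
  rw [mul_comm] at h1
  exact h1.comp_ofReal

theorem rectIntegral_eq_zero_of_hasDerivAt (hab : a ≤ b) (hT : 0 ≤ T) {F G : ℂ → ℂ}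
    (hF : ContinuousOn F (rectFrame a b T))
    (h : ∀ z ∈ rectFrame a b T, HasDerivAt G (F z) z) : rectIntegral a b T F = 0 := by
  obtain ⟨f1, f2, f3, f4⟩ := continuousOn_sides hab hT hF
  unfold rectIntegral
  rw [integral_horizontal_eq_sub hab (fun x hx => h _ (bottom_mem_rectFrame hT hx)) f1,
    integral_horizontal_eq_sub hab (fun x hx => h _ (top_mem_rectFrame hT hx)) f2,
    integral_vertical_eq_sub hT (fun x hx => h _ (right_mem_rectFrame hab hx)) f3,
    integral_vertical_eq_sub hT (fun x hx => h _ (left_mem_rectFrame hab hx)) f4]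
  ring

theorem hasDerivAt_inv_pow (p z : ℂ) (n : ℕ) (hz : z ≠ p) :
    HasDerivAt (fun z => -((n : ℂ) + 1)⁻¹ * ((z - p) ^ (n + 1))⁻¹) ((z - p) ^ (n + 2))⁻¹ z := by
  have h0 : z - p ≠ 0 := sub_ne_zero.2 hz
  have h1 := ((((hasDerivAt_id z).sub_const p).pow (n + 1)).inv (pow_ne_zero _ h0)).const_mul
    (-((n : ℂ) + 1)⁻¹)
  have h2 : (n : ℂ) + 1 ≠ 0 := by exact_mod_cast n.succ_ne_zero
  refine h1.congr_deriv ?_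
  simp
  field_simp
  ring

theorem log_sub_log_neg_of_im_pos {w : ℂ} (hw : 0 < w.im) :
    Complex.log w - Complex.log (-w) = Real.pi * Complex.I := by
  rw [Complex.log, Complex.log, norm_neg, Complex.arg_neg_eq_arg_sub_pi_of_im_pos hw]
  push_cast; ring

theorem log_sub_log_neg_of_im_neg {w : ℂ} (hw : w.im < 0) :
    Complex.log w - Complex.log (-w) = -(Real.pi * Complex.I) := by
  rw [Complex.log, Complex.log, norm_neg, Complex.arg_neg_eq_arg_add_pi_of_im_neg hw]
  push_cast; ring

theorem ne_of_mem_rectFrame {p z : ℂ} (h1 : p.re ≠ a) (h2 : p.re ≠ b) (h3 : |p.im| < T)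
    (hz : z ∈ rectFrame a b T) : z ≠ p := by
  rintro rfl
  rw [abs_lt] at h3
  rcases hz.2.2 with h | h | h | h
  · exact h1 h
  · exact h2 h
  · linarith
  · linarith

/-- `log(z - p)` is a primitive along the bottom, right and top sides. The left side crosses its
cut, so there `log(-(z - p))` is used; the two branches differ by `±πi` at the two left corners,
which adds up to `2πi`. -/
theorem rectIntegral_inv_sub {p : ℂ} (h1 : a < p.re) (h2 : p.re < b) (h3 : |p.im| < T) :
    rectIntegral a b T (fun z => (z - p)⁻¹) = 2 * Real.pi * Complex.I := by
  have hab : a ≤ b := by linarith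
  have hT : 0 ≤ T := (abs_nonneg _).trans h3.le
  have hF : ContinuousOn (fun z : ℂ => (z - p)⁻¹) (rectFrame a b T) :=
    ContinuousOn.inv₀ (by fun_prop) fun z hz =>
      sub_ne_zero.2 (ne_of_mem_rectFrame h1.ne' h2.ne h3 hz)
  obtain ⟨f1, f2, f3, f4⟩ := continuousOn_sides hab hT hF
  rw [abs_lt] at h3
  have hlog : ∀ z : ℂ, z - p ∈ Complex.slitPlane →
      HasDerivAt (fun z => Complex.log (z - p)) (z - p)⁻¹ z := fun z hz => by
    simpa using ((hasDerivAt_id z).sub_const p).clog hz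
  have hlog' : ∀ z : ℂ, -(z - p) ∈ Complex.slitPlane →
      HasDerivAt (fun z => Complex.log (-(z - p))) (z - p)⁻¹ z := fun z hz => by
    refine ((((hasDerivAt_id z).sub_const p).neg).clog hz).congr_deriv ?_
    simp only [id, Pi.neg_apply, neg_div_neg_eq, one_div]
  unfold rectIntegral
  rw [integral_horizontal_eq_sub (F := fun z => (z - p)⁻¹) hab (fun x hx => hlog _ ?_) f1,
    integral_horizontal_eq_sub (F := fun z => (z - p)⁻¹) hab (fun x hx => hlog _ ?_) f2,
    integral_vertical_eq_sub (F := fun z => (z - p)⁻¹) hT (fun x hx => hlog _ ?_) f3,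
    integral_vertical_eq_sub (F := fun z => (z - p)⁻¹) hT (fun x hx => hlog' _ ?_) f4]
  · have e1 := log_sub_log_neg_of_im_pos (w := (a : ℂ) + T * Complex.I - p) (by simp; linarith)
    have e2 := log_sub_log_neg_of_im_neg (w := (a : ℂ) + (-T : ℝ) * Complex.I - p)
      (by simp; linarith)
    linear_combination e1 - e2
  · left; simp; linarith
  · left; simp; linarith
  · right; simp; intro h; linarith
  · right; simp; intro h; linarith

end rect

/-! ### Integrals over closed curves. -/

section curve

variable {c : ℝ → ℂ}

theorem IsClosedCurve.intervalIntegrable (hc : IsClosedCurve c) {F : ℂ → ℂ} {K : Set ℂ}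
    (hK : ∀ t ∈ Set.Icc (0 : ℝ) 1, c t ∈ K) (hF : ContinuousOn F K) :
    IntervalIntegrable (fun t => F (c t) * deriv c t) MeasureTheory.volume 0 1 := by
  refine hc.integrable.continuousOn_mul ?_
  rw [Set.uIcc_of_le zero_le_one]
  exact hF.comp hc.continuousOn hK

theorem IsClosedCurve.contourIntegral_eq_zero (hc : IsClosedCurve c) {F G : ℂ → ℂ} {K : Set ℂ}
    (hK : ∀ t ∈ Set.Icc (0 : ℝ) 1, c t ∈ K) (hF : ContinuousOn F K)
    (h : ∀ z ∈ K, HasDerivAt G (F z) z) : contourIntegral c F = 0 := by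
  obtain ⟨E, hE⟩ := hc.differentiable
  have h1 := MeasureTheory.integral_eq_of_hasDerivAt_off_countable (a := 0) (b := 1)
    (fun t => G (c t)) (fun t => F (c t) * deriv c t) (s := (E : Set ℝ)) E.countable_toSet ?_ ?_
    (hc.intervalIntegrable hK hF)
  · rw [contourIntegral, h1, hc.closed, sub_self]
  · rw [Set.uIcc_of_le zero_le_one]
    exact ContinuousOn.comp (t := K)
      (fun z hz => (h z hz).continuousAt.continuousWithinAt) hc.continuousOn hK
  · rintro t ⟨ht, htE⟩
    rw [min_eq_left zero_le_one, max_eq_right zero_le_one] at ht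
    exact (h _ (hK t ⟨ht.1.le, ht.2.le⟩)).comp t (hE t ht htE).hasDerivAt

/-- The discs tangent to the line `Re z = B` from the left exhaust the half-plane: `z` lies in the
disc of radius `R` exactly when `|z - B|² < 2R (B - Re z)`. -/
theorem exists_ball_of_isCompact {K : Set ℂ} (hK : IsCompact K) {B : ℝ}
    (hB : ∀ z ∈ K, z.re < B) :
    ∃ R : ℝ, K ⊆ Metric.ball ((B - R : ℝ) : ℂ) R ∧
      Metric.ball ((B - R : ℝ) : ℂ) R ⊆ {z : ℂ | z.re < B} := by
  obtain ⟨R, hR⟩ : ∃ R : ℝ, ∀ z ∈ K, ‖z - B‖ ^ 2 / (2 * (B - z.re)) < R := by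
    obtain ⟨R, hR⟩ := (hK.image_of_continuousOn
      (f := fun z : ℂ => ‖z - B‖ ^ 2 / (2 * (B - z.re))) (fun z hz => by
        refine ContinuousAt.continuousWithinAt (ContinuousAt.div (by fun_prop) (by fun_prop) ?_)
        have := hB z hz
        have : 0 < B - z.re := by linarith
        positivity)).bddAbove
    exact ⟨R + 1, fun z hz => lt_of_le_of_lt (hR ⟨z, hz, rfl⟩) (by linarith)⟩
  refine ⟨R, fun z hz => ?_, fun z hz => ?_⟩
  · have h1 := hR z hz
    have h2 : 0 < B - z.re := by linarith [hB z hz]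
    have hR0 : 0 < R := lt_of_le_of_lt (by positivity) h1
    rw [div_lt_iff₀ (by positivity)] at h1
    rw [Metric.mem_ball, dist_eq_norm]
    refine lt_of_pow_lt_pow_left₀ 2 hR0.le ?_
    rw [← Complex.normSq_eq_norm_sq, Complex.normSq_apply] at h1 ⊢
    simp at h1 ⊢
    nlinarith
  · rw [Metric.mem_ball, dist_eq_norm] at hz
    have h1 := (Complex.re_le_norm _).trans_lt hz
    simp at h1
    show z.re < B
    linarith

/-- The curve lies in a disc inside the half-plane, and on a disc a holomorphic function has a
primitive. -/
theorem IsClosedCurve.contourIntegral_eq_zero_of_differentiableOn (hc : IsClosedCurve c)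
    {F : ℂ → ℂ} {B : ℝ} (hB : ∀ t ∈ Set.Icc (0 : ℝ) 1, (c t).re < B)
    (hF : DifferentiableOn ℂ F {z | z.re < B}) : contourIntegral c F = 0 := by
  obtain ⟨R, h1, h2⟩ := exists_ball_of_isCompact (isCompact_Icc.image_of_continuousOn
    hc.continuousOn) (B := B) (by rintro _ ⟨t, ht, rfl⟩; exact hB t ht)
  obtain ⟨G, hG⟩ := (hF.mono h2).isExactOn_ball
  exact hc.contourIntegral_eq_zero (fun t ht => h1 ⟨t, ht, rfl⟩) (hF.mono h2).continuousOn hG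

/-- To the right of `p` the principal branch of `log(z - p)` is a primitive. This disposes of poles
on the far side of the line `Re z = a`. -/
theorem IsClosedCurve.contourIntegral_inv_sub_eq_zero (hc : IsClosedCurve c) {p : ℂ}
    (hp : ∀ t ∈ Set.Icc (0 : ℝ) 1, p.re < (c t).re) :
    contourIntegral c (fun z => (z - p)⁻¹) = 0 := by
  refine hc.contourIntegral_eq_zero (K := {z | p.re < z.re}) (G := fun z => Complex.log (z - p))
    hp (ContinuousOn.inv₀ (by fun_prop) fun z hz => sub_ne_zero.2 ?_) fun z hz => ?_
  · rintro rfl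
    exact lt_irrefl _ (show z.re < z.re from hz)
  · have hz : p.re < z.re := hz
    simpa using ((hasDerivAt_id z).sub_const p).clog (Or.inl (by simpa using hz))

end curve

/-! ### Linear functionals vanishing on holomorphic functions and on higher order poles -/

/-- A linear functional that vanishes on holomorphic functions and on all negative powers
`(z - p)⁻ⁿ`, `p ∈ S`, vanishes on `H(z) / ∏ (z - p)` for every holomorphic `H` and all finite
families of points of `S`. -/
theorem eq_zero_of_principal_parts {U S : Set ℂ} (hU : IsOpen U) (hSU : S ⊆ U)
    (Λ : (ℂ → ℂ) → ℂ)
    (hcongr : ∀ F G : ℂ → ℂ, Set.EqOn F G (U \ S) → Λ F = Λ G)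
    (hadd : ∀ F G : ℂ → ℂ, ContinuousOn F (U \ S) → ContinuousOn G (U \ S) →
      Λ (fun z => F z + G z) = Λ F + Λ G)
    (hmul : ∀ (a : ℂ) (F : ℂ → ℂ), Λ (fun z => a * F z) = a * Λ F)
    (hhol : ∀ F : ℂ → ℂ, DifferentiableOn ℂ F U → Λ F = 0)
    (hpow : ∀ p ∈ S, ∀ n : ℕ, Λ (fun z => ((z - p) ^ (n + 1))⁻¹) = 0)
    (m : Multiset ℂ) (hm : ∀ p ∈ m, p ∈ S) (H : ℂ → ℂ) (hH : DifferentiableOn ℂ H U) :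
    Λ (fun z => H z * (m.map (fun p => z - p)).prod⁻¹) = 0 := by
  have hne : ∀ p ∈ S, ∀ z ∈ U \ S, z - p ≠ 0 := fun p hp z hz h =>
    hz.2 (by rw [sub_eq_zero.1 h]; exact hp)
  have hcont : ∀ m : Multiset ℂ, (∀ p ∈ m, p ∈ S) →
      ContinuousOn (fun z => (m.map (fun p => z - p)).prod⁻¹) (U \ S) := by
    intro m hm
    refine ContinuousOn.inv₀ (Continuous.continuousOn
      (continuous_multiset_prod _ fun p _ => by fun_prop)) fun z hz h => ?_
    obtain ⟨p, hp, h⟩ := Multiset.mem_map.1 (Multiset.prod_eq_zero_iff.1 h)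
    exact hne p (hm p hp) z hz h
  -- The case `H = 1`, by partial fractions. If two points differ, `1/((z-p)(z-q)) = (p-q)⁻¹
  -- (1/(z-p) - 1/(z-q))` removes one factor; otherwise the product is a pure power or empty.
  have hone : ∀ (n : ℕ) (m : Multiset ℂ), m.card = n → (∀ p ∈ m, p ∈ S) →
      Λ (fun z => (m.map (fun p => z - p)).prod⁻¹) = 0 := by
    intro n
    induction n using Nat.strong_induction_on with
    | _ n ih =>
      intro m hmn hm
      by_cases h : ∃ p, m = Multiset.replicate m.card p
      · obtain ⟨p, hp⟩ := h
        rcases hk : m.card with _ | j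
        · rw [Multiset.card_eq_zero.1 hk]
          exact hhol _ (by simp)
        · rw [hk] at hp
          have hpS : p ∈ S := hm p (by rw [hp]; simp)
          rw [hp]
          simpa only [Multiset.map_replicate, Multiset.prod_replicate] using hpow p hpS j
      · have hm0 : m ≠ 0 := fun h0 => h ⟨0, by simp [h0]⟩
        obtain ⟨p, hp⟩ := Multiset.exists_mem_of_ne_zero hm0
        obtain ⟨q, hq, hqp⟩ : ∃ q ∈ m, q ≠ p := by
          by_contra hcon
          push Not at hcon
          exact h ⟨p, Multiset.eq_replicate_card.2 hcon⟩
        obtain ⟨m₁, rfl⟩ := Multiset.exists_cons_of_mem hp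
        have hq1 : q ∈ m₁ := (Multiset.mem_cons.1 hq).resolve_left hqp
        obtain ⟨m₂, rfl⟩ := Multiset.exists_cons_of_mem hq1
        have hmp : ∀ r ∈ p ::ₘ m₂, r ∈ S := fun r hr => hm r (by
          simp only [Multiset.mem_cons] at hr ⊢; tauto)
        have hmq : ∀ r ∈ q ::ₘ m₂, r ∈ S := fun r hr => hm r (by
          simp only [Multiset.mem_cons] at hr ⊢; tauto)
        have hpq : p - q ≠ 0 := sub_ne_zero.2 (Ne.symm hqp)
        rw [hcongr _ (fun z => (p - q)⁻¹ * ((p ::ₘ m₂).map (fun r => z - r)).prod⁻¹ +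
          (-(p - q)⁻¹) * ((q ::ₘ m₂).map (fun r => z - r)).prod⁻¹) ?_,
          hadd (fun z => (p - q)⁻¹ * ((p ::ₘ m₂).map (fun r => z - r)).prod⁻¹)
            (fun z => (-(p - q)⁻¹) * ((q ::ₘ m₂).map (fun r => z - r)).prod⁻¹)
            (continuousOn_const.mul (hcont _ hmp)) (continuousOn_const.mul (hcont _ hmq)),
          hmul, hmul, ih _ (by rw [← hmn]; simp) (p ::ₘ m₂) rfl hmp,
          ih _ (by rw [← hmn]; simp) (q ::ₘ m₂) rfl hmq]
        · simp
        · intro z hz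
          have h1 := hne p (hm p hp) z hz
          have h2 := hne q (hm q hq) z hz
          simp only [Multiset.map_cons, Multiset.prod_cons, mul_inv]
          field_simp
          ring
  induction m using Multiset.induction_on generalizing H with
  | empty => exact hhol _ (by simpa using hH)
  | cons p m ih =>
    have hp : p ∈ S := hm p (Multiset.mem_cons_self p m)
    have hm' : ∀ q ∈ m, q ∈ S := fun q hq => hm q (Multiset.mem_cons_of_mem hq)
    -- Writing `H(z) = H(p) + (z - p) · dslope H p z` splits off a constant numerator and cancels
    -- one factor in the remainder.
    have hd : DifferentiableOn ℂ (dslope H p) U :=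
      (Complex.differentiableOn_dslope (hU.mem_nhds (hSU hp))).2 hH
    rw [hcongr _ (fun z => H p * ((p ::ₘ m).map (fun r => z - r)).prod⁻¹ +
      dslope H p z * (m.map (fun r => z - r)).prod⁻¹) ?_,
      hadd (fun z => H p * ((p ::ₘ m).map (fun r => z - r)).prod⁻¹)
        (fun z => dslope H p z * (m.map (fun r => z - r)).prod⁻¹)
        (continuousOn_const.mul (hcont _ hm)) ((hd.continuousOn.mono Set.sdiff_subset).mul (hcont _ hm')),
      hmul, ih hm' _ hd, hone _ _ rfl hm]
    · simp
    · intro z hz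
      have h1 := hne p hp z hz
      have h2 : H z = H p + (z - p) * dslope H p z := by
        have := sub_smul_dslope H p z
        rw [smul_eq_mul] at this
        rw [this]; ring
      simp only [Multiset.map_cons, Multiset.prod_cons, mul_inv]
      rw [h2]
      field_simp

/-- Shift of a contour: a closed curve and the boundary of a large rectangle give the same
integral of a function with finitely many poles, if they enclose the same poles. -/
theorem IsClosedCurve.contourIntegral_eq_rectIntegral {c : ℝ → ℂ} (hc : IsClosedCurve c)
    {a b B T : ℝ} (hab : a ≤ b) (hbB : b < B) (hT : 0 ≤ T)
    (hstrip : ∀ t ∈ Set.Icc (0 : ℝ) 1, a < (c t).re ∧ (c t).re < B)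
    (m : Multiset ℂ) (hmb : ∀ p ∈ m, p.re < b) (hmT : ∀ p ∈ m, |p.im| < T)
    (hma : ∀ p ∈ m, p.re ≠ a) (hmc : ∀ p ∈ m, a < p.re → Encircles c p)
    (H : ℂ → ℂ) (hH : DifferentiableOn ℂ H {z | z.re < B}) :
    contourIntegral c (fun z => H z * (m.map (fun p => z - p)).prod⁻¹) =
      rectIntegral a b T (fun z => H z * (m.map (fun p => z - p)).prod⁻¹) := by
  set U : Set ℂ := {z | z.re < B}
  set S : Set ℂ := {p | p ∈ m}
  have hfr : ∀ z ∈ rectFrame a b T, z ∈ U \ S := fun z hz =>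
    ⟨lt_of_le_of_lt hz.1.2 hbB, fun hzm =>
      ne_of_mem_rectFrame (hma z hzm) (hmb z hzm).ne (hmT z hzm) hz rfl⟩
  have hcv : ∀ t ∈ Set.Icc (0 : ℝ) 1, c t ∈ U \ S := fun t ht =>
    ⟨(hstrip t ht).2, fun hm => (hmc _ hm (hstrip t ht).1).1 t ht rfl⟩
  -- The functional is the difference of the two integrals, so the residues never have to be
  -- computed and the order of the poles does not matter.
  have key := eq_zero_of_principal_parts (U := U) (S := S)
    (isOpen_lt Complex.continuous_re continuous_const)
    (fun p hp => (hmb p hp).trans hbB)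
    (fun F => contourIntegral c F - rectIntegral a b T F) ?_ ?_ ?_ ?_ ?_ m (fun p hp => hp) H hH
  · exact sub_eq_zero.1 key
  · intro F G hFG
    congr 1
    · refine intervalIntegral.integral_congr fun t ht => ?_
      rw [Set.uIcc_of_le zero_le_one] at ht
      simp only [hFG (hcv t ht)]
    · exact rectIntegral_congr hab hT fun z hz => hFG (hfr z hz)
  · intro F G hF hG
    rw [rectIntegral_add hab hT (hF.mono hfr) (hG.mono hfr)]
    have : contourIntegral c (fun z => F z + G z) = contourIntegral c F + contourIntegral c G := by
      rw [contourIntegral, contourIntegral, contourIntegral,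
        ← intervalIntegral.integral_add (hc.intervalIntegrable hcv hF)
          (hc.intervalIntegrable hcv hG)]
      simp only [add_mul]
    rw [this]; ring
  · intro r F
    rw [rectIntegral_const_mul]
    have : contourIntegral c (fun z => r * F z) = r * contourIntegral c F := by
      rw [contourIntegral, contourIntegral, ← intervalIntegral.integral_const_mul]
      simp only [mul_assoc]
    rw [this]; ring
  · intro F hF
    rw [hc.contourIntegral_eq_zero_of_differentiableOn (fun t ht => (hstrip t ht).2) hF,
      rectIntegral_eq_zero_of_differentiableOn hab
        (hF.mono fun z hz => lt_of_le_of_lt hz.2 hbB), sub_self]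
  · intro p hp n
    have hcont : ContinuousOn (fun z => ((z - p) ^ (n + 1))⁻¹) (U \ S) :=
      ContinuousOn.inv₀ (by fun_prop) fun z hz => pow_ne_zero _ (sub_ne_zero.2 fun h =>
        hz.2 (h ▸ hp))
    -- A simple pole contributes zero to both integrals if it lies left of `Re z = a`, and `2πi` to
    -- both otherwise; higher powers have single-valued primitives.
    rcases n with _ | n
    · simp only [zero_add, pow_one]
      rcases lt_or_gt_of_ne (hma p hp) with h | h
      · rw [hc.contourIntegral_inv_sub_eq_zero fun t ht => h.trans (hstrip t ht).1,
          rectIntegral_eq_zero_of_differentiableOn hab, sub_self]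
        intro z hz
        refine (DifferentiableAt.inv (by fun_prop) (sub_ne_zero.2 ?_)).differentiableWithinAt
        rintro rfl
        exact absurd hz.1 (not_le.2 h)
      · rw [(hmc p hp h).2, rectIntegral_inv_sub h (hmb p hp) (hmT p hp), sub_self]
    · have hder : ∀ z ∈ U \ S, HasDerivAt (fun z => -((n : ℂ) + 1)⁻¹ * ((z - p) ^ (n + 1))⁻¹)
          ((z - p) ^ (n + 2))⁻¹ z := fun z hz =>
        hasDerivAt_inv_pow p z n fun h => hz.2 (h ▸ hp)
      show contourIntegral c (fun z => ((z - p) ^ (n + 2))⁻¹) -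
        rectIntegral a b T (fun z => ((z - p) ^ (n + 2))⁻¹) = 0
      rw [hc.contourIntegral_eq_zero hcv hcont hder,
        rectIntegral_eq_zero_of_hasDerivAt hab hT (hcont.mono hfr) fun z hz => hder z (hfr z hz),
        sub_self]

end

noncomputable section

/-! ### Integration of series of functions -/

/-- The kernel is integrable and the series is dominated by a constant series uniformly in `t`, so
Fubini applies. Mean values, Perron integrals and `G`-series are all expanded in this way. -/
theorem hasSum_integral_mul {ι : Type*} [Countable ι] {μ : MeasureTheory.Measure ℝ} {K : ℝ → ℂ}
    (hK : MeasureTheory.Integrable K μ) {e : ι → ℝ → ℂ} (he : ∀ i, Continuous (e i)) {b : ι → ℝ}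
    (hb : Summable b) (hle : ∀ i t, ‖e i t‖ ≤ b i) :
    (∀ i, MeasureTheory.Integrable (fun t => K t * e i t) μ) ∧
    HasSum (fun i => ∫ t, K t * e i t ∂μ) (∫ t, K t * ∑' i, e i t ∂μ) := by
  have hint : ∀ i, MeasureTheory.Integrable (fun t => K t * e i t) μ := fun i =>
    hK.mul_bdd (c := b i) (he i).aestronglyMeasurable (Filter.Eventually.of_forall fun t => hle i t)
  refine ⟨hint, ?_⟩
  have h := MeasureTheory.hasSum_integral_of_summable_integral_norm (μ := μ)
    (F := fun i t => K t * e i t) hint ?_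
  · simpa only [tsum_mul_left] using h
  · refine Summable.of_nonneg_of_le (fun i => MeasureTheory.integral_nonneg fun t => norm_nonneg _)
      (fun i => ?_) (hb.mul_left (∫ t, ‖K t‖ ∂μ))
    rw [← MeasureTheory.integral_mul_const]
    refine MeasureTheory.integral_mono (hint i).norm (hK.norm.mul_const _) fun t => ?_
    simp only [norm_mul]
    exact mul_le_mul_of_nonneg_left (hle i t) (norm_nonneg _)

theorem tendsto_integral_exp_mul_atTop {θ : ℝ} (hθ : θ ≠ 0) :
    Filter.Tendsto (fun T : ℝ => ∫ x in (0 : ℝ)..1, Complex.exp ((T * θ * Complex.I) * x))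
      Filter.atTop (nhds 0) := by
  refine squeeze_zero_norm' (a := fun T : ℝ => 2 / |θ| * T⁻¹) ?_ ?_
  · filter_upwards [Filter.eventually_gt_atTop 0] with T hT
    have hne : (T * θ * Complex.I : ℂ) ≠ 0 := by
      simp [hT.ne', hθ]
    rw [integral_exp_mul_complex hne, norm_div]
    have h1 : ‖(T * θ * Complex.I : ℂ)‖ = T * |θ| := by
      simp [abs_of_pos hT]
    have h2 : ‖Complex.exp (T * θ * Complex.I * (1 : ℝ)) - Complex.exp (T * θ * Complex.I * (0 : ℝ))‖
        ≤ 2 := by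
      refine (norm_sub_le _ _).trans ?_
      have e1 : (T * θ * Complex.I * (1 : ℝ) : ℂ) = (T * θ : ℝ) * Complex.I := by push_cast; ring
      rw [e1, Complex.norm_exp_ofReal_mul_I]
      simp; norm_num
    rw [h1]
    have : 0 < |θ| := abs_pos.2 hθ
    calc _ ≤ 2 / (T * |θ|) := by gcongr
      _ = _ := by field_simp
  · simpa using (tendsto_inv_atTop_zero (𝕜 := ℝ)).const_mul (2 / |θ|)

/-! ### Removal of finitely many singularities -/

/-- Riemann's theorem, applied at all points at once: the limit of `f` along the punctured
neighbourhood defines one global extension. -/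
theorem exists_differentiable_eq_off_finset {P : Finset ℂ} {f : ℂ → ℂ}
    (hf : ∀ z ∉ P, DifferentiableAt ℂ f z)
    (hP : ∀ p ∈ P, Filter.Tendsto (fun z => (z - p) * f z) (nhdsWithin p {p}ᶜ) (nhds 0)) :
    ∃ h : ℂ → ℂ, Differentiable ℂ h ∧ ∀ z ∉ P, f z = h z := by
  have heq : ∀ z ∉ P, (nhdsWithin z {z}ᶜ).limUnder f = f z := fun z hz =>
    Filter.Tendsto.limUnder_eq ((hf z hz).continuousAt.tendsto.mono_left nhdsWithin_le_nhds)
  refine ⟨fun z => (nhdsWithin z {z}ᶜ).limUnder f, fun p => ?_, fun z hz => (heq z hz).symm⟩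
  have hs : ((P.erase p : Finset ℂ) : Set ℂ)ᶜ ∈ nhds p :=
    (P.erase p).finite_toSet.isClosed.isOpen_compl.mem_nhds (by simp)
  have ho : (fun z => f z - f p) =o[nhdsWithin p {p}ᶜ] fun z => (z - p)⁻¹ := by
    refine (Asymptotics.isLittleO_iff_tendsto' ?_).2 ?_
    · filter_upwards [self_mem_nhdsWithin] with z hz h
      exact absurd (inv_eq_zero.1 h) (sub_ne_zero.2 hz)
    · have h1 : Filter.Tendsto (fun z => (z - p) * f z) (nhdsWithin p {p}ᶜ) (nhds 0) := by
        by_cases hp : p ∈ P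
        · exact hP p hp
        · have : ContinuousAt (fun z => (z - p) * f z) p :=
            (by fun_prop : ContinuousAt (fun z : ℂ => z - p) p).mul (hf p hp).continuousAt
          have h := this.tendsto.mono_left (nhdsWithin_le_nhds (s := {p}ᶜ))
          simpa using h
      have h2 : Filter.Tendsto (fun z => (z - p) * f p) (nhdsWithin p {p}ᶜ) (nhds 0) := by
        have : ContinuousAt (fun z => (z - p) * f p) p := by fun_prop
        have h := this.tendsto.mono_left (nhdsWithin_le_nhds (s := {p}ᶜ))
        simpa using h
      refine (Filter.Tendsto.congr (fun z => ?_) (by simpa using h1.sub h2))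
      rw [div_inv_eq_mul]; ring
  have hd := Complex.differentiableOn_update_limUnder_of_isLittleO (f := f) (c := p) hs
    (fun z hz => (hf z fun hzP => hz.1 (by
      have : z ≠ p := hz.2
      simp [hzP, this])).differentiableWithinAt) ho
  refine ((hd.differentiableAt hs).congr_of_eventuallyEq ?_)
  filter_upwards [hs] with z hz
  by_cases hzp : z = p
  · subst hzp; simp
  · rw [Function.update_of_ne hzp, heq z fun hzP => hz (by simp [hzP, hzp])]

/-! ### Continued Dirichlet series -/

theorem sigmaAntidiagonalEquivProd_coe (n : ℕ+) (x : Nat.divisorsAntidiagonal n) :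
    ((sigmaAntidiagonalEquivProd ⟨n, x⟩).1 : ℕ) = (x : ℕ × ℕ).1 ∧
      ((sigmaAntidiagonalEquivProd ⟨n, x⟩).2 : ℕ) = (x : ℕ × ℕ).2 := ⟨rfl, rfl⟩

namespace IsContinuedDirichletSeries

variable {lam : ℕ → ℝ} {f : ℕ → ℂ} {σ : ℝ} {φ : ℂ → ℂ} {P : Finset ℝ} {r : ℝ → ℂ}

theorem lam_one (h : IsContinuedDirichletSeries lam f σ φ P r) : lam 1 = 1 := by
  have h1 := (h.lam_mul 1 1 1 le_rfl le_rfl le_rfl).2 rfl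
  have h2 := h.lam_pos 1 le_rfl
  nlinarith

theorem one_le_lam (h : IsContinuedDirichletSeries lam f σ φ P r) {n : ℕ} (hn : 1 ≤ n) :
    1 ≤ lam n := by
  rw [← h.lam_one]
  rcases hn.eq_or_lt with h1 | h1
  · rw [h1]
  · exact (h.lam_strictMono 1 n le_rfl h1).le

theorem lam_ne_zero (h : IsContinuedDirichletSeries lam f σ φ P r) {n : ℕ} (hn : 1 ≤ n) :
    (lam n : ℂ) ≠ 0 := by
  exact_mod_cast (h.lam_pos n hn).ne'

theorem norm_cpow_lam (h : IsContinuedDirichletSeries lam f σ φ P r) {n : ℕ} (hn : 1 ≤ n)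
    (s : ℂ) : ‖(lam n : ℂ) ^ s‖ = lam n ^ s.re :=
  Complex.norm_cpow_eq_rpow_re_of_pos (h.lam_pos n hn) s

theorem norm_term (h : IsContinuedDirichletSeries lam f σ φ P r) {n : ℕ} (hn : 1 ≤ n) (s : ℂ) :
    ‖f n / (lam n : ℂ) ^ s‖ = ‖f n‖ * lam n ^ (-s.re) := by
  rw [norm_div, h.norm_cpow_lam hn, Real.rpow_neg (h.lam_pos n hn).le, div_eq_mul_inv]

theorem summable_coeff (h : IsContinuedDirichletSeries lam f σ φ P r) {τ : ℝ} (hτ : σ < τ) :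
    Summable fun n : ℕ+ => ‖f n‖ * lam n ^ (-τ) := by
  have := h.summable_of_lt (τ : ℂ) (by simpa using hτ)
  refine this.congr fun n => ?_
  rw [h.norm_term n.pos]; simp

theorem norm_term_le (h : IsContinuedDirichletSeries lam f σ φ P r) {τ : ℝ} {n : ℕ}
    (hn : 1 ≤ n) {s : ℂ} (hs : τ ≤ s.re) :
    ‖f n / (lam n : ℂ) ^ s‖ ≤ ‖f n‖ * lam n ^ (-τ) := by
  rw [h.norm_term hn]
  gcongr
  · exact h.one_le_lam hn

theorem hasSum (h : IsContinuedDirichletSeries lam f σ φ P r) {s : ℂ} (hs : σ < s.re) :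
    HasSum (fun n : ℕ+ => f n / (lam n : ℂ) ^ s) (φ s) := by
  rw [h.eq_tsum s hs]
  exact (h.summable_of_lt s hs).of_norm.hasSum

theorem exists_norm_le (h : IsContinuedDirichletSeries lam f σ φ P r) {τ : ℝ} (hτ : σ < τ) :
    ∃ C, 0 ≤ C ∧ ∀ s : ℂ, τ ≤ s.re → ‖φ s‖ ≤ C := by
  refine ⟨∑' n : ℕ+, ‖f n‖ * lam n ^ (-τ), tsum_nonneg fun n => ?_, fun s hs => ?_⟩
  · have := h.lam_pos n n.pos
    positivity
  · rw [h.eq_tsum s (hτ.trans_le hs)]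
    exact tsum_of_norm_bounded (h.summable_coeff hτ).hasSum fun n => h.norm_term_le n.pos hs

/-- A pole to the right of `σ` would lie where the series is bounded, which forces its residue to
vanish. -/
theorem pole_le (h : IsContinuedDirichletSeries lam f σ φ P r) {p : ℝ} (hp : p ∈ P) : p ≤ σ := by
  by_contra hlt
  push Not at hlt
  obtain ⟨C, hC, hle⟩ := h.exists_norm_le (τ := (σ + p) / 2) (by linarith)
  obtain ⟨h0, hlim⟩ := h.simple_pole p hp
  refine h0 (tendsto_nhds_unique hlim ?_)
  have hnear : ∀ᶠ s : ℂ in nhdsWithin (p : ℂ) {(p : ℂ)}ᶜ, (σ + p) / 2 < s.re :=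
    nhdsWithin_le_nhds ((isOpen_lt continuous_const Complex.continuous_re).mem_nhds
      (by simp; linarith))
  have hz : Filter.Tendsto (fun s : ℂ => ‖s - p‖ * C) (nhdsWithin (p : ℂ) {(p : ℂ)}ᶜ) (nhds 0) := by
    have : ContinuousAt (fun s : ℂ => ‖s - p‖ * C) p := by fun_prop
    have h1 := this.tendsto.mono_left (nhdsWithin_le_nhds (s := {(p : ℂ)}ᶜ))
    simpa using h1
  refine squeeze_zero_norm' ?_ hz
  filter_upwards [hnear] with s hs
  rw [norm_mul]
  exact mul_le_mul_of_nonneg_left (hle s hs.le) (norm_nonneg _)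

theorem differentiableAt_of_lt (h : IsContinuedDirichletSeries lam f σ φ P r) {s : ℂ}
    (hs : σ < s.re) : DifferentiableAt ℂ φ s := by
  refine h.differentiableAt s fun p hp hsp => ?_
  rw [hsp, Complex.ofReal_re] at hs
  exact absurd (h.pole_le hp) (not_le.2 hs)

theorem exists_eq_add_principal_parts (h : IsContinuedDirichletSeries lam f σ φ P r) :
    ∃ η : ℂ → ℂ, Differentiable ℂ η ∧
      ∀ s : ℂ, (∀ p ∈ P, s ≠ (p : ℂ)) → φ s = η s + ∑ p ∈ P, r p / (s - p) := by
  classical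
  have hmem : ∀ s : ℂ, s ∉ P.image (fun p : ℝ => (p : ℂ)) ↔ ∀ p ∈ P, s ≠ (p : ℂ) := fun s => by
    simp [eq_comm]
  have key : ∃ η : ℂ → ℂ, Differentiable ℂ η ∧ ∀ s ∉ P.image (fun p : ℝ => (p : ℂ)),
      φ s - ∑ p ∈ P, r p / (s - p) = η s := by
    refine exists_differentiable_eq_off_finset
      (f := fun s => φ s - ∑ p ∈ P, r p / (s - p)) (fun s hs => ?_) fun q hq => ?_
    · rw [hmem] at hs
      exact (h.differentiableAt s hs).sub (DifferentiableAt.fun_sum fun p hp =>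
        (differentiableAt_const _).div (by fun_prop) (sub_ne_zero.2 (hs p hp)))
    · obtain ⟨p, hp, rfl⟩ := Finset.mem_image.1 hq
      have h1 := (h.simple_pole p hp).2
      have h2 : Filter.Tendsto (fun s : ℂ => r p + (s - p) * ∑ q ∈ P.erase p, r q / (s - q))
          (nhdsWithin (p : ℂ) {(p : ℂ)}ᶜ) (nhds (r p)) := by
        have hc : ContinuousAt (fun s : ℂ => r p + (s - p) * ∑ q ∈ P.erase p, r q / (s - q)) p := by
          refine continuousAt_const.add (ContinuousAt.mul (by fun_prop)
            (tendsto_finsetSum _ fun q hq => ?_))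
          refine ContinuousAt.div (by fun_prop) (by fun_prop) (sub_ne_zero.2 ?_)
          exact_mod_cast (Finset.ne_of_mem_erase hq).symm
        have h3 := hc.tendsto.mono_left (nhdsWithin_le_nhds (s := {(p : ℂ)}ᶜ))
        simpa using h3
      have h3 := h1.sub h2
      rw [sub_self] at h3
      refine h3.congr' ?_
      filter_upwards [self_mem_nhdsWithin] with s hs
      have hne : s - p ≠ 0 := sub_ne_zero.2 hs
      rw [← Finset.add_sum_erase P _ hp]
      field_simp
  obtain ⟨η, hη, heq⟩ := key
  exact ⟨η, hη, fun s hs => by rw [← heq s ((hmem s).2 hs)]; ring⟩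

/-- Denominators are cleared so that the integrands take the form `H(z) / ∏ (z - p)` required by the
contour shift. -/
theorem exists_mul_prod_eq (h : IsContinuedDirichletSeries lam f σ φ P r) :
    ∃ B : ℂ → ℂ, Differentiable ℂ B ∧
      ∀ s : ℂ, (∀ p ∈ P, s ≠ (p : ℂ)) → φ s * ∏ p ∈ P, (s - p) = B s := by
  obtain ⟨η, hη, hφη⟩ := h.exists_eq_add_principal_parts
  refine ⟨fun z => η z * ∏ p ∈ P, (z - p) + ∑ p ∈ P, r p * ∏ q ∈ P.erase p, (z - q), ?_, ?_⟩
  · refine (hη.mul fun z => DifferentiableAt.fun_finsetProd fun p _ => by fun_prop).add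
      fun z => DifferentiableAt.fun_sum fun p _ => ?_
    exact (DifferentiableAt.fun_finsetProd fun p _ => by fun_prop).const_mul _
  · intro z hz
    rw [hφη z hz, add_mul, Finset.sum_mul]
    congr 1
    refine Finset.sum_congr rfl fun p hp => ?_
    rw [← Finset.mul_prod_erase P _ hp]
    have := sub_ne_zero.2 (hz p hp)
    field_simp

theorem continuous_term (h : IsContinuedDirichletSeries lam f σ φ P r) {n : ℕ} (hn : 1 ≤ n)
    {s : ℝ → ℂ} (hs : Continuous s) : Continuous fun t => f n / (lam n : ℂ) ^ s t :=
  continuous_const.div (hs.const_cpow (Or.inl (h.lam_ne_zero hn))) fun t => by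
    rw [Complex.cpow_def_of_ne_zero (h.lam_ne_zero hn)]
    exact Complex.exp_ne_zero _

/-- A Dirichlet series does not tend to zero along a vertical line in its half-plane of absolute
convergence. -/
theorem not_tendsto_zero (h : IsContinuedDirichletSeries lam f σ φ P r) {τ : ℝ} (hτ : σ < τ) :
    ¬ Filter.Tendsto (fun t : ℝ => φ (τ + t * Complex.I)) Filter.atTop (nhds 0) := by
  intro hlim
  obtain ⟨n₀, hn₀, hf⟩ := h.coeff_ne_zero
  obtain ⟨C, hC, hle⟩ := h.exists_norm_le hτ
  have hre : ∀ x : ℝ, ((τ : ℂ) + x * Complex.I).re = τ := fun x => by simp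
  have hunit : ∀ x : ℝ, ‖(lam n₀ : ℂ) ^ (x * Complex.I)‖ = 1 := fun x => by
    rw [h.norm_cpow_lam hn₀]; simp
  have hcont : Continuous fun t : ℝ => φ (τ + t * Complex.I) :=
    continuous_iff_continuousAt.2 fun t =>
      ContinuousAt.comp (f := fun t : ℝ => (τ : ℂ) + t * Complex.I)
        (h.differentiableAt_of_lt (by rw [hre]; exact hτ)).continuousAt (by fun_prop)
  -- The mean value of `φ(τ + iy) λ_{n₀}^{iy}` over `0 ≤ y ≤ T`, rescaled to `[0, 1]`. If `φ` tended
  -- to zero it would tend to zero as well.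
  have hA : Filter.Tendsto (fun T : ℝ => ∫ x in (0 : ℝ)..1,
      φ (τ + (T * x : ℝ) * Complex.I) * (lam n₀ : ℂ) ^ ((T * x : ℝ) * Complex.I))
      Filter.atTop (nhds (∫ x in (0 : ℝ)..1, (0 : ℂ))) := by
    refine intervalIntegral.tendsto_integral_filter_of_dominated_convergence (fun _ => C) ?_ ?_
      intervalIntegrable_const ?_
    · refine Filter.Eventually.of_forall fun T => Continuous.aestronglyMeasurable ?_
      refine (hcont.comp (by fun_prop : Continuous fun x : ℝ => T * x)).mul
        (Continuous.const_cpow (by fun_prop) (Or.inl (h.lam_ne_zero hn₀)))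
    · refine Filter.Eventually.of_forall fun T => Filter.Eventually.of_forall fun x _ => ?_
      rw [norm_mul, hunit, mul_one]
      exact hle _ (by rw [hre])
    · refine Filter.Eventually.of_forall fun x hx => ?_
      rw [Set.uIoc_of_le zero_le_one] at hx
      have h1 : Filter.Tendsto (fun T : ℝ => T * x) Filter.atTop Filter.atTop :=
        Filter.tendsto_id.atTop_mul_const hx.1
      rw [tendsto_zero_iff_norm_tendsto_zero]
      refine ((tendsto_zero_iff_norm_tendsto_zero.1 hlim).comp h1).congr fun T => ?_
      rw [norm_mul, hunit, mul_one]; rfl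
  rw [intervalIntegral.integral_zero] at hA
  -- the mean value computed termwise
  set θ : ℕ+ → ℝ := fun n => Real.log (lam n₀) - Real.log (lam n) with hθ
  have hterm : ∀ (n : ℕ+) (y : ℝ), f n / (lam n : ℂ) ^ (τ + y * Complex.I) *
      (lam n₀ : ℂ) ^ (y * Complex.I) =
      f n / (lam n : ℂ) ^ (τ : ℂ) * Complex.exp (y * θ n * Complex.I) := by
    intro n y
    have hn := h.lam_ne_zero n.pos
    rw [Complex.cpow_add _ _ hn, Complex.cpow_def_of_ne_zero hn (y * Complex.I),
      Complex.cpow_def_of_ne_zero (h.lam_ne_zero hn₀), ← Complex.ofReal_log (h.lam_pos n n.pos).le,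
      ← Complex.ofReal_log (h.lam_pos n₀ hn₀).le, div_mul_eq_div_div, div_mul_eq_mul_div,
      mul_div_assoc, ← Complex.exp_sub]
    congr 2
    simp only [hθ]; push_cast; ring
  have hS : ∀ T : ℝ, HasSum (fun n : ℕ+ => f n / (lam n : ℂ) ^ (τ : ℂ) *
      ∫ x in (0 : ℝ)..1, Complex.exp ((T * θ n * Complex.I) * x))
      (∫ x in (0 : ℝ)..1,
      φ (τ + (T * x : ℝ) * Complex.I) * (lam n₀ : ℂ) ^ ((T * x : ℝ) * Complex.I)) := by
    intro T
    have hK : MeasureTheory.Integrable (fun x : ℝ => (lam n₀ : ℂ) ^ ((T * x : ℝ) * Complex.I))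
        (MeasureTheory.volume.restrict (Set.Ioc (0 : ℝ) 1)) :=
      (Continuous.integrableOn_Icc (Continuous.const_cpow (by fun_prop)
        (Or.inl (h.lam_ne_zero hn₀)))).mono_set Set.Ioc_subset_Icc_self
    have h1 := (hasSum_integral_mul hK
      (e := fun (n : ℕ+) (x : ℝ) => f n / (lam n : ℂ) ^ (τ + (T * x : ℝ) * Complex.I))
      (fun n => h.continuous_term n.pos (by fun_prop)) (h.summable_coeff hτ)
      (fun n x => h.norm_term_le n.pos (by rw [hre]))).2
    simp only [intervalIntegral.integral_of_le zero_le_one]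
    convert h1 using 1
    · funext n
      rw [← MeasureTheory.integral_const_mul]
      congr 1; funext x
      rw [mul_comm ((lam n₀ : ℂ) ^ _), hterm]
      congr 2
      push_cast; ring
    · congr 1; funext x
      rw [← h.eq_tsum _ (by rw [hre]; exact hτ), mul_comm]
  -- Termwise only the frequency `θ n = 0`, that is `n = n₀`, survives, because `lam` is injective.
  -- The limit is the nonzero coefficient at `n₀`.
  have hB : Filter.Tendsto (fun T : ℝ => ∑' n : ℕ+, f n / (lam n : ℂ) ^ (τ : ℂ) *
      ∫ x in (0 : ℝ)..1, Complex.exp ((T * θ n * Complex.I) * x)) Filter.atTop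
      (nhds (∑' n : ℕ+, f n / (lam n : ℂ) ^ (τ : ℂ) * if (n : ℕ) = n₀ then 1 else 0)) := by
    refine tendsto_tsum_of_dominated_convergence (h.summable_coeff hτ) (fun n => ?_)
      (Filter.Eventually.of_forall fun T n => ?_)
    · refine Filter.Tendsto.const_mul _ ?_
      split_ifs with hn
      · refine tendsto_const_nhds.congr fun T => ?_
        simp [hθ, hn]
      · refine tendsto_integral_exp_mul_atTop ?_
        intro h0
        have h1 := Real.log_injOn_pos (h.lam_pos n₀ hn₀) (h.lam_pos n n.pos) (sub_eq_zero.1 h0)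
        rcases lt_or_gt_of_ne hn with h2 | h2
        · exact absurd h1.symm (h.lam_strictMono _ _ n.pos h2).ne
        · exact absurd h1 (h.lam_strictMono _ _ hn₀ h2).ne
    · rw [norm_mul]
      have h1 : ‖∫ x in (0 : ℝ)..1, Complex.exp ((T * θ n * Complex.I) * x)‖ ≤ 1 := by
        refine (intervalIntegral.norm_integral_le_of_norm_le_const (C := 1) fun x _ => ?_).trans ?_
        · have : (T * θ n * Complex.I * x : ℂ) = (T * θ n * x : ℝ) * Complex.I := by
            push_cast; ring
          rw [this, Complex.norm_exp_ofReal_mul_I]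
        · simp
      calc _ ≤ ‖f n / (lam n : ℂ) ^ (τ : ℂ)‖ * 1 := by gcongr
        _ ≤ _ := by rw [mul_one]; exact h.norm_term_le n.pos (by simp)
  obtain ⟨m₀, rfl⟩ : ∃ m : ℕ+, (m : ℕ) = n₀ := ⟨⟨n₀, hn₀⟩, rfl⟩
  have hval : ∑' n : ℕ+, f n / (lam n : ℂ) ^ (τ : ℂ) * (if (n : ℕ) = m₀ then 1 else 0) =
      f m₀ / (lam m₀ : ℂ) ^ (τ : ℂ) := by
    rw [tsum_eq_single m₀]
    · simp
    · intro n hn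
      rw [if_neg, mul_zero]
      exact fun h0 => hn (PNat.eq h0)
  simp only [(hS _).tsum_eq] at hB
  have h0 := tendsto_nhds_unique hA hB
  rw [hval, eq_comm, div_eq_zero_iff] at h0
  rcases h0 with h0 | h0
  · exact hf h0
  · rw [Complex.cpow_def_of_ne_zero (h.lam_ne_zero hn₀)] at h0
    exact Complex.exp_ne_zero _ h0

/-- The Dirichlet series of `twistedConv lam f a` is `φ(s) φ(s - a)`. -/
theorem hasSum_twistedConv (h : IsContinuedDirichletSeries lam f σ φ P r) {a : ℂ} {τ : ℝ}
    (h1 : σ < τ) (h2 : σ < τ - a.re) :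
    (Summable fun n : ℕ+ => ‖twistedConv lam f a n‖ * lam n ^ (-τ)) ∧
    ∀ s : ℂ, s.re = τ → HasSum (fun n : ℕ+ => twistedConv lam f a n / (lam n : ℂ) ^ s)
      (φ s * φ (s - a)) := by
  have main : ∀ s : ℂ, s.re = τ →
      (Summable fun n : ℕ+ => ‖twistedConv lam f a n / (lam n : ℂ) ^ s‖) ∧
      HasSum (fun n : ℕ+ => twistedConv lam f a n / (lam n : ℂ) ^ s) (φ s * φ (s - a)) := by
    intro s hs
    set A : ℕ+ → ℂ := fun n => f n / (lam n : ℂ) ^ (s - a) with hA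
    set B : ℕ+ → ℂ := fun n => f n / (lam n : ℂ) ^ s with hB
    set F : ℕ+ × ℕ+ → ℂ := fun x => A x.1 * B x.2 with hF
    have hs1 : σ < s.re := by rw [hs]; exact h1
    have hs2 : σ < (s - a).re := by rw [Complex.sub_re, hs]; exact h2
    have hFn : Summable fun x => ‖F x‖ :=
      Summable.mul_norm (f := A) (g := B) (h.summable_of_lt _ hs2) (h.summable_of_lt _ hs1)
    have hFs : HasSum F (φ (s - a) * φ s) :=
      HasSum.mul (f := A) (g := B) (h.hasSum hs2) (h.hasSum hs1) hFn.of_norm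
    -- The double series is regrouped by `n = d e`; multiplicativity of `lam` turns `λ_d^{-s}
    -- λ_e^{-s}` into `λ_n^{-s}`.
    rw [← sigmaAntidiagonalEquivProd.hasSum_iff] at hFs
    rw [← sigmaAntidiagonalEquivProd.summable_iff] at hFn
    have hinner : ∀ n : ℕ+, ∑ x : Nat.divisorsAntidiagonal n,
        F (sigmaAntidiagonalEquivProd ⟨n, x⟩) = twistedConv lam f a n / (lam n : ℂ) ^ s := by
      intro n
      have e1 : ∀ x : Nat.divisorsAntidiagonal n, F (sigmaAntidiagonalEquivProd ⟨n, x⟩) =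
          (fun y : ℕ × ℕ => (lam y.1 : ℂ) ^ a * f y.1 * f y.2 / (lam n : ℂ) ^ s) x := by
        intro x
        obtain ⟨h1, h2⟩ := sigmaAntidiagonalEquivProd_coe n x
        obtain ⟨⟨d, e⟩, hx⟩ := x
        simp only at h1 h2
        simp only [hF, hA, hB, h1, h2]
        have hde := (Nat.mem_divisorsAntidiagonal.1 hx).1
        have hne := (Nat.mem_divisorsAntidiagonal.1 hx).2
        have hd : 1 ≤ d := Nat.one_le_iff_ne_zero.2 fun h0 => hne (by rw [← hde, h0]; simp)
        have he : 1 ≤ e := Nat.one_le_iff_ne_zero.2 fun h0 => hne (by rw [← hde, h0]; simp)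
        have hl : lam d * lam e = lam n := (h.lam_mul d e n hd he n.pos).2 hde
        rw [← hl]
        push_cast
        rw [Complex.mul_cpow_ofReal_nonneg (h.lam_pos d hd).le (h.lam_pos e he).le,
          Complex.cpow_sub _ _ (h.lam_ne_zero hd)]
        have z1 : (lam d : ℂ) ^ s ≠ 0 := by
          rw [Complex.cpow_def_of_ne_zero (h.lam_ne_zero hd)]; exact Complex.exp_ne_zero _
        have z2 : (lam e : ℂ) ^ s ≠ 0 := by
          rw [Complex.cpow_def_of_ne_zero (h.lam_ne_zero he)]; exact Complex.exp_ne_zero _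
        have z3 : (lam d : ℂ) ^ a ≠ 0 := by
          rw [Complex.cpow_def_of_ne_zero (h.lam_ne_zero hd)]; exact Complex.exp_ne_zero _
        field_simp
      rw [Finset.sum_congr rfl fun x _ => e1 x, Finset.sum_coe_sort (Nat.divisorsAntidiagonal n)
        (fun y : ℕ × ℕ => (lam y.1 : ℂ) ^ a * f y.1 * f y.2 / (lam n : ℂ) ^ s),
        Nat.sum_divisorsAntidiagonal (fun d e => (lam d : ℂ) ^ a * f d * f e / (lam n : ℂ) ^ s),
        twistedConv, Finset.sum_div]
    have hout := hFs.sigma fun n => hasSum_fintype _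
    simp only [Function.comp_def, hinner] at hout
    refine ⟨?_, by rw [mul_comm]; exact hout⟩
    have hnorm := hFn.hasSum.sigma fun n => hasSum_fintype _
    refine Summable.of_nonneg_of_le (fun n => norm_nonneg _) (fun n => ?_) hnorm.summable
    rw [← hinner]
    exact norm_sum_le _ _
  refine ⟨?_, fun s hs => (main s hs).2⟩
  refine ((main (τ : ℂ) (by simp)).1).congr fun n => ?_
  rw [norm_div, h.norm_cpow_lam n.pos, Complex.ofReal_re, Real.rpow_neg (h.lam_pos n n.pos).le,
    div_eq_mul_inv]

end IsContinuedDirichletSeries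

end

noncomputable section

/-! ### Consequences of the functional equation -/

/-- The isometry `s ↦ δ - s` exchanges the two half-planes and preserves `|Im s|`, so it carries `χ`
and the exceptional set over. -/
theorem HasHeckeContinuation.symm {δ : ℝ} {φ ψ : ℂ → ℂ} (h : HasHeckeContinuation δ φ ψ) :
    HasHeckeContinuation δ ψ φ := by
  obtain ⟨S, χ, ε, α, β, hS, hSb, hSc, hχ, hε, hε', hgr, hα, hβ⟩ := h
  set e := IsometryEquiv.subLeft (δ : ℂ) with he
  have hee : ∀ s, e s = δ - s := fun s => rfl
  have hinv : ∀ s, e (e s) = s := fun s => by simp [hee]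
  have himg : (e '' S)ᶜ = e '' Sᶜ := (Set.image_compl_eq e.bijective).symm
  refine ⟨e '' S, fun s => χ (δ - s), ε, δ - β, δ - α, ?_, ?_, ?_, ?_, hε, hε', ?_, ?_, ?_⟩
  · exact e.toHomeomorph.isClosedMap _ hS
  · exact e.isometry.lipschitz.isBounded_image hSb
  · rw [himg]
    exact hSc.image _ e.continuous.continuousOn
  · refine hχ.comp (by fun_prop) fun s hs => ?_
    rw [himg] at hs
    obtain ⟨w, hw, rfl⟩ := hs
    rw [← hee, hinv]; exact hw
  · intro σ₁ σ₂ h12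
    obtain ⟨M, T, hM⟩ := hgr (δ - σ₂) (δ - σ₁) (by linarith)
    refine ⟨M, T, fun s h1 h2 h3 => ?_⟩
    have := hM (δ - s) (by simp; linarith) (by simp; linarith) (by simpa using h3)
    simpa using this
  · intro s hs
    show χ (δ - s) = _
    rw [hβ (δ - s) (by simp; linarith)]
    congr 3 <;> ring_nf
  · intro s hs
    show χ (δ - s) = _
    rw [hα (δ - s) (by simp; linarith)]
    congr 3; ring_nf

namespace HeckePair

variable {δ : ℝ} {lam mu : ℕ → ℝ} {f g : ℕ → ℂ} {σφ σψ : ℝ} {φ ψ : ℂ → ℂ} {Pφ Pψ : Finset ℝ}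
  {rφ rψ : ℝ → ℂ}

theorem symm (h : HeckePair δ lam mu f g σφ σψ φ ψ Pφ Pψ rφ rψ) :
    HeckePair δ mu lam g f σψ σφ ψ φ Pψ Pφ rψ rφ where
  delta_pos := h.delta_pos
  left := h.right
  right := h.left
  functionalEquation_left := h.functionalEquation_right
  functionalEquation_right := h.functionalEquation_left
  continuation := h.continuation.symm
  abscissa_left := h.abscissa_right
  abscissa_right := h.abscissa_left

theorem eq_of_im_ne_zero (h : HeckePair δ lam mu f g σφ σψ φ ψ Pφ Pψ rφ rψ) {z : ℂ}
    (hz : z.im ≠ 0) :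
    φ z = (2 * Real.pi : ℂ) ^ (2 * z - δ) * (Complex.Gamma (δ - z) * (Complex.Gamma z)⁻¹) *
      ψ (δ - z) := by
  have hre : ∀ x : ℝ, z ≠ x := fun x hx => hz (by rw [hx]; simp)
  have hre' : ∀ x : ℝ, (δ : ℂ) - z ≠ x := fun x hx => hre (δ - x) (by
    push_cast; linear_combination -hx)
  have hm : ∀ m : ℕ, z ≠ -(m : ℂ) := fun m => by simpa using hre (-m)
  have hfe := h.functionalEquation_left z hm (fun m => by simpa using hre' (-m))
    (fun p _ => hre p) (fun q _ => hre' q)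
  have hG := Complex.Gamma_ne_zero hm
  have h2 : (2 * Real.pi : ℂ) ≠ 0 := by simp [Real.pi_ne_zero]
  have e1 : (2 * Real.pi : ℂ) ^ (2 * z - δ) =
      (2 * Real.pi : ℂ) ^ z * (2 * Real.pi : ℂ) ^ (z - δ) := by
    rw [← Complex.cpow_add _ _ h2]; congr 1; ring
  have e2 : (2 * Real.pi : ℂ) ^ z * (2 * Real.pi : ℂ) ^ (-z) = 1 := by
    rw [← Complex.cpow_add _ _ h2]; simp
  calc φ z = ((2 * Real.pi : ℂ) ^ z * (2 * Real.pi : ℂ) ^ (-z)) *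
        (Complex.Gamma z * (Complex.Gamma z)⁻¹) * φ z := by
        rw [e2, mul_inv_cancel₀ hG]; ring
    _ = (2 * Real.pi : ℂ) ^ z * (Complex.Gamma z)⁻¹ *
        ((2 * Real.pi : ℂ) ^ (-z) * Complex.Gamma z * φ z) := by ring
    _ = _ := by rw [hfe, e1]; ring

/-- If `p ≤ δ - γ`, then `Re(δ - p) ≥ γ > σψ` and the right side of the functional equation is
continuous at `p`. Approaching `p` vertically, where the equation holds, shows that the residue is
zero. -/
theorem lt_pole (h : HeckePair δ lam mu f g σφ σψ φ ψ Pφ Pψ rφ rψ) {γ : ℝ} (hγ : σψ < γ)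
    (hγ0 : 0 < γ) {p : ℝ} (hp : p ∈ Pφ) : δ - γ < p := by
  by_contra hle
  push Not at hle
  obtain ⟨h0, hlim⟩ := h.left.simple_pole p hp
  have hpath : Filter.Tendsto (fun y : ℝ => (p : ℂ) + y * Complex.I) (nhdsWithin 0 {0}ᶜ)
      (nhdsWithin (p : ℂ) {(p : ℂ)}ᶜ) := by
    refine tendsto_nhdsWithin_iff.2 ⟨?_, ?_⟩
    · have : ContinuousAt (fun y : ℝ => (p : ℂ) + y * Complex.I) 0 := by fun_prop
      have h1 := this.tendsto.mono_left (nhdsWithin_le_nhds (s := {(0 : ℝ)}ᶜ))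
      simpa using h1
    · filter_upwards [self_mem_nhdsWithin] with y hy
      have hy : y ≠ 0 := hy
      simpa using hy
  refine h0 (tendsto_nhds_unique (hlim.comp hpath) ?_)
  have hc : ContinuousAt (fun z : ℂ => (z - p) * ((2 * Real.pi : ℂ) ^ (2 * z - δ) *
      (Complex.Gamma (δ - z) * (Complex.Gamma z)⁻¹) * ψ (δ - z))) p := by
    have c1 : ContinuousAt (fun z : ℂ => (2 * Real.pi : ℂ) ^ (2 * z - δ)) p :=
      ContinuousAt.const_cpow (by fun_prop) (Or.inl (by simp [Real.pi_ne_zero]))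
    have c2 : ContinuousAt (fun z : ℂ => Complex.Gamma (δ - z)) p := by
      refine ContinuousAt.comp (f := fun z : ℂ => (δ : ℂ) - z)
        (Complex.differentiableAt_Gamma _ fun m hm => ?_).continuousAt (by fun_prop)
      have := congrArg Complex.re hm
      simp at this
      have : (0 : ℝ) ≤ m := m.cast_nonneg
      linarith
    have c3 : ContinuousAt (fun z : ℂ => (Complex.Gamma z)⁻¹) p :=
      Complex.differentiable_one_div_Gamma.continuous.continuousAt
    have c4 : ContinuousAt (fun z : ℂ => ψ (δ - z)) p :=
      ContinuousAt.comp (f := fun z : ℂ => (δ : ℂ) - z)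
        (h.right.differentiableAt_of_lt (by simp; linarith)).continuousAt (by fun_prop)
    exact ContinuousAt.mul (by fun_prop) ((c1.mul (c2.mul c3)).mul c4)
  have h1 := hc.tendsto.comp (hpath.mono_right nhdsWithin_le_nhds)
  rw [sub_self, zero_mul] at h1
  refine h1.congr' ?_
  filter_upwards [self_mem_nhdsWithin] with y hy
  have hy : y ≠ 0 := hy
  simp only [Function.comp]
  rw [h.eq_of_im_ne_zero (z := (p : ℂ) + y * Complex.I) (by simpa using hy)]

/-- The functional equation reflects the line into the half-plane of absolute convergence of `ψ`,
where `ψ` is bounded; the growth comes from the Gamma quotient alone. -/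
theorem exists_norm_le_left (h : HeckePair δ lam mu f g σφ σψ φ ψ Pφ Pψ rφ rψ) {γ : ℝ}
    (hγ : σψ < γ) :
    ∃ C, 0 ≤ C ∧ ∀ t : ℝ, 1 ≤ |t| →
      ‖φ ((δ - γ : ℝ) + t * Complex.I)‖ ≤ C * |t| ^ (2 * γ - δ) := by
  obtain ⟨C₁, hC₁, h1⟩ := h.right.exists_norm_le hγ
  obtain ⟨C₂, hC₂, h2⟩ := exists_norm_Gamma_div_le γ (δ - γ)
  refine ⟨(2 * Real.pi) ^ (δ - 2 * γ) * C₂ * C₁, by positivity, fun t ht => ?_⟩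
  have ht0 : t ≠ 0 := fun h => by rw [h] at ht; simp at ht; linarith
  rw [h.eq_of_im_ne_zero (by simpa using ht0), norm_mul, norm_mul]
  have e1 : ‖(2 * Real.pi : ℂ) ^ (2 * (((δ - γ : ℝ) : ℂ) + t * Complex.I) - δ)‖ =
      (2 * Real.pi) ^ (δ - 2 * γ) := by
    have : (2 * Real.pi : ℂ) = ((2 * Real.pi : ℝ) : ℂ) := by push_cast; ring
    rw [this, Complex.norm_cpow_eq_rpow_re_of_pos (by positivity)]
    congr 1; simp; ring
  have e2 : (δ : ℂ) - (((δ - γ : ℝ) : ℂ) + t * Complex.I) = γ + (-t : ℝ) * Complex.I := by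
    push_cast; ring
  have e3 : ((δ - γ : ℝ) : ℂ) + t * Complex.I = ((δ - γ : ℝ) : ℂ) - (-t : ℝ) * Complex.I := by
    push_cast; ring
  rw [e1, e2, e3]
  have h3 := h2 (-t) (by simpa using ht)
  rw [abs_neg, show γ - (δ - γ) = 2 * γ - δ by ring] at h3
  calc _ ≤ (2 * Real.pi) ^ (δ - 2 * γ) * (C₂ * |t| ^ (2 * γ - δ)) * C₁ := by
        gcongr
        exact h1 _ (by simp)
    _ = _ := by ring

/-- Otherwise `φ` would be bounded on `Re z = δ - γ`, and the functional equation would give `ψ(γ +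
it) = O(|t|^(-(2γ-δ)))`. A nonzero Dirichlet series cannot tend to zero on a line of absolute
convergence. -/
theorem le_abscissa (h : HeckePair δ lam mu f g σφ σψ φ ψ Pφ Pψ rφ rψ) {γ : ℝ} (hγ : σψ < γ)
    (hγδ : δ / 2 < γ) : δ - γ ≤ σφ := by
  by_contra hlt
  push Not at hlt
  obtain ⟨C, hC, hle⟩ := h.symm.exists_norm_le_left (γ := δ - γ) hlt
  refine h.right.not_tendsto_zero hγ ?_
  have hz : Filter.Tendsto (fun t : ℝ => C * t ^ (-(2 * γ - δ))) Filter.atTop (nhds 0) := by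
    simpa using (tendsto_rpow_neg_atTop (y := 2 * γ - δ) (by linarith)).const_mul C
  refine squeeze_zero_norm' ?_ hz
  filter_upwards [Filter.eventually_ge_atTop 1] with t ht
  have h1 := hle t (ht.trans (le_abs_self t))
  rw [abs_of_nonneg (by linarith)] at h1
  rwa [show δ - (δ - γ) = γ by ring, show 2 * (δ - γ) - δ = -(2 * γ - δ) by ring] at h1

/-- The meromorphic continuation and Hecke's function `χ` agree. -/
theorem exists_norm_le_exp (h : HeckePair δ lam mu f g σφ σψ φ ψ Pφ Pψ rφ rψ) {a b : ℝ}
    (hab : a < b) :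
    ∃ C T A : ℝ, 0 ≤ A ∧ 0 ≤ C ∧ ∀ z : ℂ, a ≤ z.re → z.re ≤ b → T ≤ |z.im| →
      ‖φ z‖ ≤ C * Real.exp (A * |z.im|) := by
  classical
  obtain ⟨S, χ, ε, α, β, hS, hSb, hSc, hχ, hε, hε', hgr, hα, -⟩ := h.continuation
  obtain ⟨B, hBd, hφB⟩ := h.left.exists_mul_prod_eq
  have h2π : (2 * Real.pi : ℂ) ≠ 0 := by simp [Real.pi_ne_zero]
  set Q : ℂ → ℂ := fun z => ∏ p ∈ Pφ, (z - p) with hQ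
  -- Solving for `φ` and multiplying by `Q` gives a function holomorphic off `S`; it is compared
  -- with the entire function `φ Q` by the identity theorem on the connected set `Sᶜ`.
  set A : ℂ → ℂ := fun z => χ z * (2 * Real.pi : ℂ) ^ z * (Complex.Gamma z)⁻¹ * Q z with hA
  have hQd : Differentiable ℂ Q := by
    intro z; exact DifferentiableAt.fun_finsetProd fun p _ => by fun_prop
  have hQ0 : ∀ z : ℂ, (∀ p ∈ Pφ, z ≠ p) → Q z ≠ 0 := fun z hz =>
    Finset.prod_ne_zero_iff.2 fun p hp => sub_ne_zero.2 (hz p hp)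
  have hAd : DifferentiableOn ℂ A Sᶜ := by
    refine ((hχ.mul (Differentiable.differentiableOn ?_)).mul
      Complex.differentiable_one_div_Gamma.differentiableOn).mul hQd.differentiableOn
    exact fun z => DifferentiableAt.const_cpow (by fun_prop) (Or.inl h2π)
  obtain ⟨R, hR⟩ := hSb.subset_ball 0
  have hlarge : ∀ z : ℂ, max α (max σφ 0) < z.re → A z = B z := by
    intro z hz
    have hz1 : α < z.re := (le_max_left _ _).trans_lt hz
    have hz2 : σφ < z.re := ((le_max_left _ _).trans (le_max_right _ _)).trans_lt hz
    have hz3 : 0 < z.re := ((le_max_right _ _).trans (le_max_right _ _)).trans_lt hz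
    have hzP : ∀ p ∈ Pφ, z ≠ (p : ℂ) := fun p hp hzp => by
      have := h.left.pole_le hp
      rw [hzp, Complex.ofReal_re] at hz2
      linarith
    rw [← hφB z hzP, hA]
    simp only
    rw [hα z hz1]
    have hG := Complex.Gamma_ne_zero_of_re_pos hz3
    have e2 : (2 * Real.pi : ℂ) ^ (-z) * (2 * Real.pi : ℂ) ^ z = 1 := by
      rw [← Complex.cpow_add _ _ h2π]; simp
    calc _ = ((2 * Real.pi : ℂ) ^ (-z) * (2 * Real.pi : ℂ) ^ z) *
        (Complex.Gamma z * (Complex.Gamma z)⁻¹) * φ z * Q z := by ring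
      _ = _ := by rw [e2, mul_inv_cancel₀ hG]; ring
  set x₀ : ℝ := max (max α (max σφ 0)) R + 1 with hx₀
  have hx₀1 : max α (max σφ 0) < x₀ := lt_of_le_of_lt (le_max_left _ _) (lt_add_one _)
  have hx₀2 : R < x₀ := lt_of_le_of_lt (le_max_right _ _) (lt_add_one _)
  have hSout : ∀ z : ℂ, R ≤ ‖z‖ → z ∈ Sᶜ := fun z hz hzS => by
    have := hR hzS
    rw [mem_ball_zero_iff] at this
    linarith
  have hEq : Set.EqOn A B Sᶜ := by
    refine (hAd.analyticOnNhd hS.isOpen_compl).eqOn_of_preconnected_of_eventuallyEq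
      (hBd.differentiableOn.analyticOnNhd hS.isOpen_compl) hSc.isPreconnected
      (z₀ := (x₀ : ℂ)) (hSout _ ?_) ?_
    · rw [Complex.norm_real]
      exact hx₀2.le.trans (le_abs_self _)
    · filter_upwards [(isOpen_lt continuous_const Complex.continuous_re).mem_nhds
        (show max α (max σφ 0) < (x₀ : ℂ).re by simpa using hx₀1)] with z hz
      exact hlarge z hz
  obtain ⟨M, T, hM⟩ := hgr a b hab
  obtain ⟨C, hC, hG⟩ := exists_norm_Gamma_inv_le_strip a b
  refine ⟨|M| * (2 * Real.pi) ^ b * C, max (max T 1) R, ε + Real.pi, by positivity, by positivity,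
    fun z h1 h2 h3 => ?_⟩
  have h3T : T ≤ |z.im| := ((le_max_left _ _).trans (le_max_left _ _)).trans h3
  have h31 : 1 ≤ |z.im| := ((le_max_right _ _).trans (le_max_left _ _)).trans h3
  have h3R : R ≤ |z.im| := (le_max_right _ _).trans h3
  have hzP : ∀ p ∈ Pφ, z ≠ (p : ℂ) := fun p _ hzp => by
    rw [hzp] at h31; simp at h31; linarith
  have hφ : φ z = χ z * (2 * Real.pi : ℂ) ^ z * (Complex.Gamma z)⁻¹ := by
    have e := hEq (hSout z (h3R.trans (Complex.abs_im_le_norm z)))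
    rw [← hφB z hzP] at e
    exact (mul_right_cancel₀ (hQ0 z hzP) e).symm
  have hp : ‖(2 * Real.pi : ℂ) ^ z‖ ≤ (2 * Real.pi) ^ b := by
    have : (2 * Real.pi : ℂ) = ((2 * Real.pi : ℝ) : ℂ) := by push_cast; ring
    rw [this, Complex.norm_cpow_eq_rpow_re_of_pos (by positivity)]
    exact Real.rpow_le_rpow_of_exponent_le (by linarith [Real.pi_gt_three]) h2
  rw [hφ, norm_mul, norm_mul]
  calc _ ≤ (|M| * Real.exp (ε * |z.im|)) * (2 * Real.pi) ^ b *
        (C * Real.exp (Real.pi * |z.im|)) := by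
        gcongr
        · exact (hM z h1 h2 h3T).trans (by gcongr; exact le_abs_self M)
        · exact hG z h1 h2 h31
    _ = |M| * (2 * Real.pi) ^ b * C * (Real.exp (ε * |z.im|) * Real.exp (Real.pi * |z.im|)) := by
        ring
    _ = _ := by rw [← Real.exp_add, add_mul]

/-- Phragmén–Lindelöf for the entire part `η` of `φ` divided by `(z - w)^k`. The principal parts are
bounded for `|Im z| ≥ 1`, so passing between `φ` and `η` costs a constant. -/
theorem exists_norm_le_strip (h : HeckePair δ lam mu f g σφ σψ φ ψ Pφ Pψ rφ rψ) {γ b : ℝ}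
    (hγ : σψ < γ) (hb : σφ < b) (hab : δ - γ < b) {k : ℕ} (hk : 2 * γ - δ ≤ k) :
    ∃ C, 0 ≤ C ∧ ∀ z : ℂ, δ - γ ≤ z.re → z.re ≤ b → 1 ≤ |z.im| → ‖φ z‖ ≤ C * |z.im| ^ k := by
  set a : ℝ := δ - γ with ha
  obtain ⟨η, hη, hφη⟩ := h.left.exists_eq_add_principal_parts
  set D : ℝ := ∑ p ∈ Pφ, ‖rφ p‖ with hD
  have hD0 : 0 ≤ D := Finset.sum_nonneg fun p _ => norm_nonneg _
  have hsum : ∀ z : ℂ, 1 ≤ |z.im| → ‖∑ p ∈ Pφ, rφ p / (z - p)‖ ≤ D := by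
    intro z hz
    refine (norm_sum_le _ _).trans (Finset.sum_le_sum fun p _ => ?_)
    rw [norm_div]
    refine div_le_self (norm_nonneg _) (hz.trans ?_)
    simpa using Complex.abs_im_le_norm (z - p)
  have hne : ∀ z : ℂ, 1 ≤ |z.im| → ∀ p ∈ Pφ, z ≠ (p : ℂ) := fun z hz p _ hzp => by
    rw [hzp] at hz; simp at hz; linarith
  have hηφ : ∀ z : ℂ, 1 ≤ |z.im| → ‖η z‖ ≤ ‖φ z‖ + D := by
    intro z hz
    have e : η z = φ z - ∑ p ∈ Pφ, rφ p / (z - p) := by rw [hφη z (hne z hz)]; ring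
    rw [e]
    exact (norm_sub_le _ _).trans (by gcongr; exact hsum z hz)
  have hφη' : ∀ z : ℂ, 1 ≤ |z.im| → ‖φ z‖ ≤ ‖η z‖ + D := by
    intro z hz
    rw [hφη z (hne z hz)]
    exact (norm_add_le _ _).trans (by gcongr; exact hsum z hz)
  -- The point `w` lies one unit left of the strip, so `|z - w|` is at least `1` and at least `|Im
  -- z|` there.
  set w : ℂ := ((a - 1 : ℝ) : ℂ) with hw
  have hwre : ∀ z : ℂ, a ≤ z.re → 1 ≤ ‖z - w‖ := fun z hz => by
    refine le_trans ?_ (Complex.re_le_norm _)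
    simp [hw]; linarith
  have hwim : ∀ z : ℂ, |z.im| ≤ ‖z - w‖ := fun z => by
    simpa [hw] using Complex.abs_im_le_norm (z - w)
  -- the bound on the two boundary lines
  have hline : ∀ x : ℝ, (∃ C, 0 ≤ C ∧ ∀ t : ℝ, 1 ≤ |t| →
      ‖φ ((x : ℂ) + t * Complex.I)‖ ≤ C * |t| ^ k) → a ≤ x →
      ∃ C, 0 ≤ C ∧ ∀ z : ℂ, z.re = x → ‖η z / (z - w) ^ k‖ ≤ C := by
    rintro x ⟨C, hC, hle⟩ hx
    obtain ⟨C', hC'⟩ := (isCompact_Icc (a := (-1 : ℝ)) (b := 1)).exists_bound_of_continuousOn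
      (f := fun t : ℝ => η ((x : ℂ) + t * Complex.I))
      (hη.continuous.comp (by fun_prop)).continuousOn
    refine ⟨C + D + |C'|, by positivity, fun z hz => ?_⟩
    have hzx : z = (x : ℂ) + z.im * Complex.I := by apply Complex.ext <;> simp [hz]
    have h1 := hwre z (by rw [hz]; exact hx)
    have h1k : 1 ≤ ‖z - w‖ ^ k := one_le_pow₀ h1
    rw [norm_div, norm_pow, div_le_iff₀ (by positivity)]
    rcases le_total 1 |z.im| with ht | ht
    · have hφz : ‖φ z‖ ≤ C * |z.im| ^ k := by rw [hzx]; simpa using hle z.im ht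
      calc ‖η z‖ ≤ C * |z.im| ^ k + D := (hηφ z ht).trans (by gcongr)
        _ ≤ C * ‖z - w‖ ^ k + D * ‖z - w‖ ^ k := by
            gcongr
            · exact hwim z
            · exact le_mul_of_one_le_right hD0 h1k
        _ ≤ _ := by
            rw [add_mul, add_mul]
            have : 0 ≤ |C'| * ‖z - w‖ ^ k := by positivity
            linarith
    · have h2 := hC' z.im (abs_le.1 ht)
      simp only [← hzx] at h2
      calc ‖η z‖ ≤ |C'| * 1 := by rw [mul_one]; exact h2.trans (le_abs_self _)
        _ ≤ |C'| * ‖z - w‖ ^ k := by gcongr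
        _ ≤ _ := by gcongr; linarith
  obtain ⟨C₁, hC₁, hle₁⟩ := hline a (by
    obtain ⟨C, hC, hle⟩ := h.exists_norm_le_left hγ
    refine ⟨C, hC, fun t ht => (hle t ht).trans ?_⟩
    rw [← Real.rpow_natCast]
    gcongr) le_rfl
  obtain ⟨C₂, hC₂, hle₂⟩ := hline b (by
    obtain ⟨C, hC, hle⟩ := h.left.exists_norm_le hb
    exact ⟨C, hC, fun t ht => (hle _ (by simp)).trans (le_mul_of_one_le_right hC
      (one_le_pow₀ ht))⟩) hab.le
  have hPL : ∀ z : ℂ, a ≤ z.re → z.re ≤ b → ‖η z / (z - w) ^ k‖ ≤ max C₁ C₂ := by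
    intro z hz1 hz2
    refine PhragmenLindelof.vertical_strip (a := a) (b := b) (f := fun z => η z / (z - w) ^ k)
      ?_ ?_ (fun z hz => (hle₁ z hz).trans (le_max_left _ _))
      (fun z hz => (hle₂ z hz).trans (le_max_right _ _)) hz1 hz2
    · refine DifferentiableOn.diffContOnCl fun z hz => ?_
      rw [Complex.closure_preimage_re, closure_Ioo hab.ne] at hz
      refine (hη z).differentiableWithinAt.div (by fun_prop) (pow_ne_zero _ ?_)
      have := hwre z hz.1
      exact norm_pos_iff.1 (by linarith)
    · obtain ⟨C, T, A, hA, hC, hle⟩ := h.exists_norm_le_exp hab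
      have hba : 0 < b - a := sub_pos.2 hab
      -- Half of the critical exponent `π/(b - a)`; any single exponential is dominated by the
      -- double one.
      set c : ℝ := Real.pi / (2 * (b - a)) with hc
      have hc0 : 0 < c := by positivity
      refine ⟨c, ?_, A / c, ?_⟩
      · rw [hc]
        gcongr
        linarith
      · refine Asymptotics.IsBigO.of_bound (C + D) ?_
        have hT : ∀ᶠ z : ℂ in Filter.comap (_root_.abs ∘ Complex.im) Filter.atTop,
            max T 1 ≤ |z.im| :=
          (Filter.eventually_ge_atTop (max T 1)).comap (_root_.abs ∘ Complex.im)
        filter_upwards [Filter.mem_inf_of_left hT, Filter.mem_inf_of_right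
          (Filter.mem_principal_self (Complex.re ⁻¹' Set.Ioo a b))] with z hz1 hz2
        have hz2 : z.re ∈ Set.Ioo a b := hz2
        have hzT : T ≤ |z.im| := (le_max_left _ _).trans hz1
        have hz1' : 1 ≤ |z.im| := (le_max_right _ _).trans hz1
        have hE : Real.exp (A * |z.im|) ≤ Real.exp (A / c * Real.exp (c * |z.im|)) := by
          refine Real.exp_le_exp.2 ?_
          have h1 := Real.add_one_le_exp (c * |z.im|)
          calc A * |z.im| = A / c * (c * |z.im|) := by field_simp
            _ ≤ _ := by gcongr; linarith
        have hE1 : 1 ≤ Real.exp (A * |z.im|) := Real.one_le_exp (by positivity)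
        have h1k : 1 ≤ ‖z - w‖ ^ k := one_le_pow₀ (hwre z hz2.1.le)
        rw [Real.norm_of_nonneg (Real.exp_pos _).le, norm_div, norm_pow]
        calc ‖η z‖ / ‖z - w‖ ^ k ≤ ‖η z‖ := div_le_self (norm_nonneg _) h1k
          _ ≤ C * Real.exp (A * |z.im|) + D :=
              (hηφ z hz1').trans (by gcongr; exact hle z hz2.1.le hz2.2.le hzT)
          _ ≤ (C + D) * Real.exp (A * |z.im|) := by nlinarith
          _ ≤ _ := by gcongr
  have hC₀ : 0 ≤ max C₁ C₂ := hC₁.trans (le_max_left _ _)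
  refine ⟨max C₁ C₂ * (b - a + 2) ^ k + D, by
    have : 0 ≤ b - a + 2 := by linarith
    positivity, fun z hz1 hz2 ht => ?_⟩
  have h1 := hPL z hz1 hz2
  have hpos := hwre z hz1
  rw [norm_div, norm_pow, div_le_iff₀ (by positivity)] at h1
  have h2 : ‖z - w‖ ≤ (b - a + 2) * |z.im| := by
    refine (Complex.norm_le_abs_re_add_abs_im _).trans ?_
    have e1 : |(z - w).re| ≤ b - a + 1 := by
      simp only [hw, Complex.sub_re, Complex.ofReal_re]
      rw [abs_le]; constructor <;> linarith
    have e2 : (z - w).im = z.im := by simp [hw]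
    rw [e2]
    nlinarith
  calc ‖φ z‖ ≤ max C₁ C₂ * ‖z - w‖ ^ k + D := (hφη' z ht).trans (by gcongr)
    _ ≤ max C₁ C₂ * ((b - a + 2) * |z.im|) ^ k + D * |z.im| ^ k := by
        gcongr
        exact le_mul_of_one_le_right hD0 (one_le_pow₀ ht)
    _ = _ := by rw [mul_pow]; ring

end HeckePair

end

noncomputable section

/-! ### The kernel of the Riesz means -/

theorem integrable_of_norm_le_rpow {F : ℝ → ℂ} (hF : Continuous F) {C a T : ℝ} (ha : a < -1)
    (hT : 1 ≤ T) (h : ∀ t : ℝ, T ≤ |t| → ‖F t‖ ≤ C * |t| ^ a) : MeasureTheory.Integrable F := by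
  obtain ⟨D, hD⟩ := (isCompact_Icc (a := -T) (b := T)).exists_bound_of_continuousOn
    hF.continuousOn
  have hint := (integrable_one_add_norm (E := ℝ) (μ := MeasureTheory.volume) (r := -a)
    (by simp; linarith)).const_mul ((|C| + |D|) * (1 + T) ^ (-a))
  refine hint.mono' hF.aestronglyMeasurable (Filter.Eventually.of_forall fun t => ?_)
  rw [neg_neg, Real.norm_eq_abs]
  have hpos : 0 < 1 + |t| := by positivity
  have hT1 : 0 < 1 + T := by linarith
  rcases le_total T |t| with ht | ht
  · have h1 : |t| ^ a ≤ ((1 + |t|) / (1 + T)) ^ a :=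
      Real.rpow_le_rpow_of_nonpos (by positivity)
        ((div_le_iff₀ hT1).2 (by nlinarith)) (by linarith)
    rw [Real.div_rpow hpos.le hT1.le] at h1
    calc ‖F t‖ ≤ C * |t| ^ a := h t ht
      _ ≤ (|C| + |D|) * ((1 + |t|) ^ a / (1 + T) ^ a) := by
          gcongr
          linarith [le_abs_self C, abs_nonneg D]
      _ = _ := by rw [Real.rpow_neg hT1.le]; ring
  · have h1 : (1 + T) ^ a ≤ (1 + |t|) ^ a :=
      Real.rpow_le_rpow_of_nonpos hpos (by linarith) (by linarith)
    calc ‖F t‖ ≤ D := hD t (abs_le.1 ht)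
      _ ≤ |C| + |D| := by linarith [le_abs_self D, abs_nonneg C]
      _ = (|C| + |D|) * ((1 + T) ^ (-a) * (1 + T) ^ a) := by
          rw [← Real.rpow_add hT1]; simp
      _ ≤ (|C| + |D|) * ((1 + T) ^ (-a) * (1 + |t|) ^ a) := by gcongr
      _ = _ := by ring

/-- `1 / (w (w + 1) ⋯ (w + k))`, that is `Γ(w) / Γ(w + k + 1)`. -/
def rieszKernel (k : ℕ) (w : ℂ) : ℂ := (∏ j ∈ Finset.range (k + 1), (w + j))⁻¹

/-- At `w = -j` with `j ≤ k` both sides have the conventional value `0`. For `j > k` the quotient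
reads `0/0 = 0` while the kernel is finite and nonzero, so these points are excluded. -/
theorem Gamma_div_Gamma_eq_rieszKernel {k : ℕ} {w : ℂ}
    (hw : ∀ j : ℕ, k < j → w ≠ -(j : ℂ)) :
    Complex.Gamma w / Complex.Gamma (w + k + 1) = rieszKernel k w := by
  by_cases h : ∃ j : ℕ, w = -(j : ℂ)
  · obtain ⟨j, rfl⟩ := h
    have hj : j ≤ k := by
      by_contra hlt
      exact hw j (not_le.1 hlt) rfl
    rw [Complex.Gamma_neg_nat_eq_zero, zero_div, rieszKernel,
      Finset.prod_eq_zero (Finset.mem_range.2 (Nat.lt_succ_of_le hj)), inv_zero]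
    simp
  · push Not at h
    have h1 := Complex.Gamma_add_nat_div_Gamma_eq (n := k + 1) w h
    have h2 : ∀ n : ℕ, (ascPochhammer ℂ n).eval w = ∏ j ∈ Finset.range n, (w + j) := fun n => by
      induction n with
      | zero => simp
      | succ n ih => rw [ascPochhammer_succ_eval, ih, Finset.prod_range_succ]
    rw [rieszKernel, ← h2, ← h1, inv_div]
    push_cast
    rw [add_assoc]

theorem norm_rieszKernel_le (k : ℕ) {w : ℂ} (hw : w.im ≠ 0) :
    ‖rieszKernel k w‖ ≤ (|w.im| ^ (k + 1))⁻¹ := by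
  rw [rieszKernel, norm_inv, norm_prod]
  have h0 : 0 < |w.im| := abs_pos.2 hw
  refine inv_anti₀ (by positivity) ?_
  calc |w.im| ^ (k + 1) = ∏ _j ∈ Finset.range (k + 1), |w.im| := by simp
    _ ≤ _ := Finset.prod_le_prod (fun _ _ => abs_nonneg _) fun j _ => by
        simpa using Complex.abs_im_le_norm (w + j)

theorem continuous_rieszKernel_comp {k : ℕ} {w : ℝ → ℂ} (hw : Continuous w)
    (h0 : ∀ t, ∀ j ≤ k, w t + (j : ℂ) ≠ 0) : Continuous fun t => rieszKernel k (w t) := by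
  refine Continuous.inv₀ (continuous_finsetProd _ fun j _ => by fun_prop) fun t => ?_
  exact Finset.prod_ne_zero_iff.2 fun j hj => h0 t j (Nat.lt_succ_iff.1 (Finset.mem_range.1 hj))

theorem integrable_rieszKernel_line {k : ℕ} (hk : 1 ≤ k) {c : ℝ} (hc : 0 < c) (τ : ℝ) :
    MeasureTheory.Integrable fun t : ℝ => rieszKernel k (c + (t - τ : ℝ) * Complex.I) := by
  have h0 : MeasureTheory.Integrable fun t : ℝ => rieszKernel k (c + t * Complex.I) := by
    refine integrable_of_norm_le_rpow (continuous_rieszKernel_comp (by fun_prop) ?_) (C := 1)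
      (a := -(k + 1 : ℕ)) ?_ le_rfl fun t ht => ?_
    · intro t j _ h
      have := congrArg Complex.re h
      have hj : (0 : ℝ) ≤ j := j.cast_nonneg
      simp at this
      linarith
    · have : (1 : ℝ) ≤ k := by exact_mod_cast hk
      push_cast; linarith
    · have ht0 : t ≠ 0 := fun h => by rw [h] at ht; simp at ht; linarith
      refine (norm_rieszKernel_le k (by simpa using ht0)).trans (le_of_eq ?_)
      rw [Real.rpow_neg (abs_nonneg _), Real.rpow_natCast]
      simp
  exact h0.comp_sub_right τ

/-- The Mellin transform is the Beta integral `B(s, k+1) = k! / (s(s+1)⋯(s+k))`. The condition `1 ≤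
k` makes the truncated power vanish beyond `1`. -/
theorem hasMellin_truncated_power {k : ℕ} (hk : 1 ≤ k) {s : ℂ} (hs : 0 < s.re) :
    HasMellin (fun y : ℝ => (((max (1 - y) 0) ^ k : ℝ) : ℂ)) s
      (k.factorial * rieszKernel k s) := by
  have hconv := Complex.betaIntegral_convergent (v := k + 1) hs (by
    simp; positivity)
  rw [intervalIntegrable_iff_integrableOn_Ioc_of_le zero_le_one] at hconv
  have heq : ∀ y ∈ Set.Ioc (0 : ℝ) 1, (y : ℂ) ^ (s - 1) * (1 - (y : ℂ)) ^ ((k : ℂ) + 1 - 1) =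
      (y : ℂ) ^ (s - 1) • (((max (1 - y) 0) ^ k : ℝ) : ℂ) := by
    intro y hy
    rw [add_sub_cancel_right, Complex.cpow_natCast, max_eq_left (by linarith [hy.2]), smul_eq_mul]
    push_cast; rfl
  have hconv' := hconv.congr_fun heq measurableSet_Ioc
  have hzero : ∀ y ∈ Set.Ioi (0 : ℝ) \ Set.Ioc 0 1,
      (y : ℂ) ^ (s - 1) • (((max (1 - y) 0) ^ k : ℝ) : ℂ) = 0 := by
    rintro y ⟨hy0, hy1⟩
    have hy2 : 1 < y := by
      by_contra hle
      exact hy1 ⟨hy0, not_lt.1 hle⟩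
    rw [max_eq_right (by linarith), zero_pow (by omega)]
    simp
  refine ⟨hconv'.of_forall_sdiff_eq_zero measurableSet_Ioi hzero, ?_⟩
  rw [mellin, MeasureTheory.setIntegral_eq_of_subset_of_forall_sdiff_eq_zero measurableSet_Ioi
    Set.Ioc_subset_Ioi_self hzero, ← MeasureTheory.setIntegral_congr_fun measurableSet_Ioc heq,
    ← intervalIntegral.integral_of_le zero_le_one]
  have := Complex.betaIntegral_eval_nat_add_one_right hs k
  rw [Complex.betaIntegral] at this
  rw [this, rieszKernel, div_eq_mul_inv]

/-- Mellin inversion at the point `1/X`. The translation by `τ` does not change the integral and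
accommodates the imaginary part of `u`. -/
theorem integral_rieszKernel_mul_cpow {k : ℕ} (hk : 1 ≤ k) {c X : ℝ} (hc : 0 < c) (hX : 0 < X)
    (τ : ℝ) :
    ∫ t : ℝ, rieszKernel k (c + (t - τ : ℝ) * Complex.I) * (X : ℂ) ^
      (c + (t - τ : ℝ) * Complex.I) =
      2 * Real.pi / k.factorial * ((max (1 - X⁻¹) 0 ^ k : ℝ) : ℂ) := by
  rw [MeasureTheory.integral_sub_right_eq_self (fun t : ℝ => rieszKernel k (c + t * Complex.I) *
    (X : ℂ) ^ (c + t * Complex.I)) τ]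
  have hre : ∀ y : ℝ, 0 < ((c : ℂ) + y * Complex.I).re := fun y => by simpa using hc
  have hinv := mellinInv_mellin_eq c (fun y : ℝ => (((max (1 - y) 0) ^ k : ℝ) : ℂ))
    (inv_pos.2 hX) (hasMellin_truncated_power hk (by simpa using hc)).1 ?_ ?_
  · rw [mellinInv] at hinv
    have hfac : (k.factorial : ℂ) ≠ 0 := by exact_mod_cast k.factorial_ne_zero
    have hpi : (Real.pi : ℂ) ≠ 0 := by simp [Real.pi_ne_zero]
    have hcongr : ∀ y : ℝ, ((X⁻¹ : ℝ) : ℂ) ^ (-((c : ℂ) + y * Complex.I)) •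
        mellin (fun y : ℝ => (((max (1 - y) 0) ^ k : ℝ) : ℂ)) (c + y * Complex.I) =
        k.factorial * (rieszKernel k (c + y * Complex.I) * (X : ℂ) ^ (c + y * Complex.I)) := by
      intro y
      rw [(hasMellin_truncated_power hk (hre y)).2, smul_eq_mul, Complex.ofReal_inv,
        Complex.inv_cpow _ _ (by
          rw [Complex.arg_ofReal_of_nonneg hX.le]; exact Real.pi_pos.ne),
        Complex.cpow_neg, inv_inv]
      ring
    simp only [hcongr] at hinv
    rw [MeasureTheory.integral_const_mul] at hinv
    rw [← hinv, Complex.real_smul]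
    generalize (∫ t : ℝ, rieszKernel k (c + t * Complex.I) * (X : ℂ) ^ (c + t * Complex.I)) = I
    push_cast
    field_simp
  · have h1 := (integrable_rieszKernel_line hk hc 0).const_mul (k.factorial : ℂ)
    refine h1.congr (Filter.Eventually.of_forall fun y => ?_)
    simp only [sub_zero]
    exact ((hasMellin_truncated_power hk (hre y)).2).symm
  · exact Continuous.continuousAt (by fun_prop)

theorem ofReal_mul_mul_inv_cpow {a b c : ℝ} (ha : 0 < a) (hb : 0 < b) (hc : 0 < c) (s : ℂ) :
    ((a * b / c : ℝ) : ℂ) ^ s = (a : ℂ) ^ s * (b : ℂ) ^ s / (c : ℂ) ^ s := by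
  have h1 := Complex.mul_cpow_ofReal_nonneg (div_pos (mul_pos ha hb) hc).le hc.le s
  rw [← Complex.ofReal_mul, div_mul_cancel₀ _ hc.ne', Complex.ofReal_mul,
    Complex.mul_cpow_ofReal_nonneg ha.le hb.le] at h1
  rw [h1, mul_div_cancel_right₀]
  intro h
  exact hc.ne' (by exact_mod_cast (Complex.cpow_eq_zero_iff _ _ |>.1 h).1)

/-! ### Riesz sums as integrals over a vertical line -/

section riesz

variable {lam mu : ℕ → ℝ} {f g : ℕ → ℂ} {σφ σψ : ℝ} {φ ψ : ℂ → ℂ} {Pφ Pψ : Finset ℝ}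
  {rφ rψ : ℝ → ℂ}

/-- The weights `g(n) μ_n^{-v} f(m) λ_m^{-u}` of the double Riesz sum. -/
def rieszWeight (lam mu : ℕ → ℝ) (f g : ℕ → ℂ) (u v : ℂ) (p : ℕ+ × ℕ+) : ℂ :=
  g p.1 / (mu p.1 : ℂ) ^ v * (f p.2 / (lam p.2 : ℂ) ^ u)

theorem hasSum_rieszWeight (hL : IsContinuedDirichletSeries lam f σφ φ Pφ rφ)
    (hR : IsContinuedDirichletSeries mu g σψ ψ Pψ rψ) {u v : ℂ} (hu : σφ < u.re)
    (hv : σψ < v.re) :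
    (Summable fun p => ‖rieszWeight lam mu f g u v p‖) ∧
      HasSum (rieszWeight lam mu f g u v) (ψ v * φ u) := by
  have hn := Summable.mul_norm (f := fun n : ℕ+ => g n / (mu n : ℂ) ^ v)
    (g := fun n : ℕ+ => f n / (lam n : ℂ) ^ u) (hR.summable_of_lt v hv) (hL.summable_of_lt u hu)
  exact ⟨hn, HasSum.mul (f := fun n : ℕ+ => g n / (mu n : ℂ) ^ v)
    (g := fun n : ℕ+ => f n / (lam n : ℂ) ^ u) (hR.hasSum hv) (hL.hasSum hu) hn.of_norm⟩

/-- The factor `μ_n^{-k}` is absorbed into the power: `(μ_n x - λ_m)^k / μ_n^k = (x - λ_m/μ_n)^k`,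
and the truncation is the positive part. -/
theorem rieszTerm_eq_tsum (hR : IsContinuedDirichletSeries mu g σψ ψ Pψ rψ) {k : ℕ} (hk : 1 ≤ k)
    (u v : ℂ) (x : ℝ) (n : ℕ+) :
    rieszTerm k lam mu f g u v x n = ∑' m : ℕ+, rieszWeight lam mu f g u v (n, m) *
      ((max (x - lam m / mu n) 0 ^ k : ℝ) : ℂ) := by
  rw [rieszTerm, ← tsum_mul_left]
  congr 1; funext m
  have hmu := hR.lam_pos n n.pos
  have hmu0 := hR.lam_ne_zero n.pos
  split_ifs with h
  · rw [max_eq_left (sub_nonneg.2 ((div_le_iff₀ hmu).2 (by linarith))), rieszWeight,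
      Complex.cpow_add _ _ hmu0, Complex.cpow_natCast]
    push_cast
    have e : (x : ℂ) - lam m / mu n = (mu n * x - lam m) / mu n := by field_simp
    rw [e, div_pow]
    simp only [div_eq_mul_inv, mul_inv]
    ring
  · rw [max_eq_right (sub_nonpos.2 ((le_div_iff₀ hmu).2 (by linarith))), zero_pow (by omega)]
    simp

theorem hasSum_rieszTerm (hR : IsContinuedDirichletSeries mu g σψ ψ Pψ rψ) {u v : ℂ} {k : ℕ} (hk : 1 ≤ k) {x : ℝ} {A : ℂ}
    (hA : HasSum (fun p => rieszWeight lam mu f g u v p *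
      ((max (x - lam p.2 / mu p.1) 0 ^ k : ℝ) : ℂ)) A) :
    HasSum (fun n : ℕ+ => rieszTerm k lam mu f g u v x n) A := by
  refine hA.prod_fiberwise fun n => ?_
  rw [rieszTerm_eq_tsum hR hk]
  exact (hA.summable.prod_factor n).hasSum

theorem integrable_rieszKernel_mul_cpow {u : ℂ} {b : ℝ} (hub : u.re < b) {k : ℕ} (hk : 1 ≤ k)
    {x : ℝ} (hx : 0 < x) :
    MeasureTheory.Integrable (fun t : ℝ => rieszKernel k (b + t * Complex.I - u) *
        (x : ℂ) ^ (b + t * Complex.I - u + k)) := by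
  have h1 := integrable_rieszKernel_line hk (sub_pos.2 hub) u.im
  have hz : ∀ t : ℝ, (b : ℂ) + t * Complex.I - u =
      ((b - u.re : ℝ) : ℂ) + (t - u.im : ℝ) * Complex.I := fun t => by
    apply Complex.ext <;> simp
  simp only [← hz] at h1
  refine h1.mul_bdd (c := x ^ (b - u.re + k)) (Continuous.aestronglyMeasurable
    (Continuous.const_cpow (by fun_prop) (Or.inl (by exact_mod_cast hx.ne'))))
    (Filter.Eventually.of_forall fun t => ?_)
  rw [Complex.norm_cpow_eq_rpow_re_of_pos hx]
  simp

theorem continuous_mul_line (hL : IsContinuedDirichletSeries lam f σφ φ Pφ rφ)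
    (hR : IsContinuedDirichletSeries mu g σψ ψ Pψ rψ) {w : ℂ} {b : ℝ}
    (hb : σφ < b) (hvb : σψ < w.re - b) :
    Continuous fun t : ℝ => φ (b + t * Complex.I) * ψ (w - (b + t * Complex.I)) := by
  refine continuous_iff_continuousAt.2 fun t => ContinuousAt.mul ?_ ?_
  · exact ContinuousAt.comp (f := fun t : ℝ => (b : ℂ) + t * Complex.I)
      (hL.differentiableAt_of_lt (by simpa using hb)).continuousAt (by fun_prop)
  · exact ContinuousAt.comp (f := fun t : ℝ => w - ((b : ℂ) + t * Complex.I))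
      (hR.differentiableAt_of_lt (by simpa using hvb)).continuousAt (by fun_prop)

theorem integrable_riesz_line (hL : IsContinuedDirichletSeries lam f σφ φ Pφ rφ)
    (hR : IsContinuedDirichletSeries mu g σψ ψ Pψ rψ) {u v : ℂ} {b : ℝ} (hub : u.re < b)
    (hb : σφ < b) (hvb : σψ < u.re + v.re - b) {k : ℕ} (hk : 1 ≤ k) {x : ℝ} (hx : 0 < x) :
    MeasureTheory.Integrable (fun t : ℝ => rieszKernel k (b + t * Complex.I - u) *
        (x : ℂ) ^ (b + t * Complex.I - u + k) *
        (φ (b + t * Complex.I) * ψ (v + u - (b + t * Complex.I)))) := by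
  obtain ⟨C, hC, hle⟩ := hL.exists_norm_le hb
  obtain ⟨C', hC', hle'⟩ := hR.exists_norm_le hvb
  refine (integrable_rieszKernel_mul_cpow hub hk hx).mul_bdd (c := C * C')
    (continuous_mul_line hL hR hb (by simp; linarith)).aestronglyMeasurable
    (Filter.Eventually.of_forall fun t => ?_)
  rw [norm_mul]
  exact mul_le_mul (hle _ (by simp)) (hle' _ (by simp; linarith)) (norm_nonneg _) hC

/-- Both Dirichlet series converge absolutely on `Re z = b`; expanding them under the integral
leaves, for each pair, the kernel integral with `X = μ_n x / λ_m`. -/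
theorem hasSum_riesz_eq_integral (hL : IsContinuedDirichletSeries lam f σφ φ Pφ rφ)
    (hR : IsContinuedDirichletSeries mu g σψ ψ Pψ rψ) {u v : ℂ} {b : ℝ} (hub : u.re < b)
    (hb : σφ < b) (hvb : σψ < u.re + v.re - b) {k : ℕ} (hk : 1 ≤ k) {x : ℝ} (hx : 0 < x) :
    HasSum (fun p => rieszWeight lam mu f g u v p *
      ((max (x - lam p.2 / mu p.1) 0 ^ k : ℝ) : ℂ))
      (k.factorial / (2 * Real.pi) * ∫ t : ℝ, rieszKernel k (b + t * Complex.I - u) *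
        (x : ℂ) ^ (b + t * Complex.I - u + k) *
        (φ (b + t * Complex.I) * ψ (v + u - (b + t * Complex.I)))) := by
  have hre : ∀ t : ℝ, ((b : ℂ) + t * Complex.I).re = b := fun t => by simp
  have hre' : ∀ t : ℝ, (v + u - ((b : ℂ) + t * Complex.I)).re = u.re + v.re - b := fun t => by
    simp; ring
  set e : ℕ+ × ℕ+ → ℝ → ℂ := fun p t => g p.1 / (mu p.1 : ℂ) ^ (v + u - (b + t * Complex.I)) *
    (f p.2 / (lam p.2 : ℂ) ^ (b + t * Complex.I)) with he
  have hsum := (hasSum_integral_mul (integrable_rieszKernel_mul_cpow hub hk hx) (e := e)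
    (b := fun p => (‖g p.1‖ * mu p.1 ^ (-(u.re + v.re - b))) * (‖f p.2‖ * lam p.2 ^ (-b)))
    (fun p => (hR.continuous_term p.1.pos (by fun_prop)).mul
      (hL.continuous_term p.2.pos (by fun_prop)))
    (Summable.mul_of_nonneg (f := fun n : ℕ+ => ‖g n‖ * mu n ^ (-(u.re + v.re - b)))
      (g := fun n : ℕ+ => ‖f n‖ * lam n ^ (-b))
      (hR.summable_coeff hvb) (hL.summable_coeff hb)
      (fun n => mul_nonneg (norm_nonneg _) (Real.rpow_nonneg (hR.lam_pos n n.pos).le _))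
      (fun n => mul_nonneg (norm_nonneg _) (Real.rpow_nonneg (hL.lam_pos n n.pos).le _)))
    (fun p t => by
      rw [he, norm_mul]
      exact mul_le_mul (hR.norm_term_le p.1.pos (hre' t).ge) (hL.norm_term_le p.2.pos (hre t).ge)
        (norm_nonneg _) (mul_nonneg (norm_nonneg _)
          (Real.rpow_nonneg (hR.lam_pos p.1 p.1.pos).le _)))).2
  have hprod : ∀ t : ℝ, ∑' p, e p t = φ (b + t * Complex.I) * ψ (v + u - (b + t * Complex.I)) := by
    intro t
    have h1 := (hasSum_rieszWeight hL hR (u := b + t * Complex.I)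
      (v := v + u - (b + t * Complex.I)) (by rw [hre]; exact hb) (by rw [hre']; exact hvb)).2
    rw [mul_comm, ← h1.tsum_eq]
    rfl
  simp only [hprod] at hsum
  have hfin := hsum.mul_left (k.factorial / (2 * Real.pi) : ℂ)
  refine hfin.congr_fun fun p => ?_
  have hl := hL.lam_pos p.2 p.2.pos
  have hm := hR.lam_pos p.1 p.1.pos
  have hl0 := hL.lam_ne_zero p.2.pos
  have hm0 := hR.lam_ne_zero p.1.pos
  have hx0 : (x : ℂ) ≠ 0 := by exact_mod_cast hx.ne'
  have hX : 0 < mu p.1 * x / lam p.2 := by positivity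
  have hker := integral_rieszKernel_mul_cpow hk (sub_pos.2 hub) hX u.im
  have hz : ∀ t : ℝ, ((b - u.re : ℝ) : ℂ) + (t - u.im : ℝ) * Complex.I =
      (b : ℂ) + t * Complex.I - u := fun t => by
    apply Complex.ext <;> simp
  simp only [hz] at hker
  have hpt : ∀ t : ℝ, rieszKernel k (b + t * Complex.I - u) *
      (x : ℂ) ^ (b + t * Complex.I - u + k) * e p t =
      (rieszWeight lam mu f g u v p * (x : ℂ) ^ k) * (rieszKernel k (b + t * Complex.I - u) *
        ((mu p.1 * x / lam p.2 : ℝ) : ℂ) ^ (b + t * Complex.I - u)) := by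
    intro t
    set z : ℂ := b + t * Complex.I with hzdef
    have c1 : ((mu p.1 * x / lam p.2 : ℝ) : ℂ) ^ (z - u) =
        (mu p.1 : ℂ) ^ (z - u) * (x : ℂ) ^ (z - u) / (lam p.2 : ℂ) ^ (z - u) := 
      ofReal_mul_mul_inv_cpow hm hx hl _
    rw [c1, he, rieszWeight]
    simp only
    rw [← hzdef, Complex.cpow_add _ _ hx0, Complex.cpow_natCast,
      show v + u - z = v - (z - u) by ring, Complex.cpow_sub _ _ hm0]
    conv_lhs => rw [show (lam p.2 : ℂ) ^ z = (lam p.2 : ℂ) ^ u * (lam p.2 : ℂ) ^ (z - u) by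
      rw [← Complex.cpow_add _ _ hl0]; congr 1; ring]
    have n1 : (mu p.1 : ℂ) ^ v ≠ 0 := fun h => hm0 (Complex.cpow_eq_zero_iff _ _ |>.1 h).1
    have n2 : (mu p.1 : ℂ) ^ (z - u) ≠ 0 := fun h => hm0 (Complex.cpow_eq_zero_iff _ _ |>.1 h).1
    have n3 : (lam p.2 : ℂ) ^ u ≠ 0 := fun h => hl0 (Complex.cpow_eq_zero_iff _ _ |>.1 h).1
    have n4 : (lam p.2 : ℂ) ^ (z - u) ≠ 0 := fun h => hl0 (Complex.cpow_eq_zero_iff _ _ |>.1 h).1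
    field_simp
  simp only [hpt]
  rw [MeasureTheory.integral_const_mul, hker]
  have hmax : max (x - lam p.2 / mu p.1) 0 = x * max (1 - (mu p.1 * x / lam p.2)⁻¹) 0 := by
    rw [mul_max_of_nonneg _ _ hx.le, mul_zero]
    congr 1
    field_simp
  have hfac : (k.factorial : ℂ) ≠ 0 := by exact_mod_cast k.factorial_ne_zero
  have hpi : (Real.pi : ℂ) ≠ 0 := by simp [Real.pi_ne_zero]
  rw [hmax, mul_pow]
  push_cast
  field_simp

end riesz

end

noncomputable section

/-! ### The Meijer `G`-functions -/

theorem meijerIntegrand_eq (δ : ℝ) (k : ℕ) (u z s : ℂ) :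
    meijerIntegrand 1 1 (upperParams δ k u) (lowerParams δ u) z s =
      Complex.Gamma (δ - u - s) / Complex.Gamma (δ - u - s + k + 1) *
        (Complex.Gamma s * (Complex.Gamma (δ - s))⁻¹) * z ^ s := by
  have h1 : (∏ j : Fin 1 with j.val < 1, Complex.Gamma (lowerParams δ u j - s)) =
      Complex.Gamma (δ - u - s) := by
    simp [lowerParams]
  have h2 : (∏ j : Fin 3 with j.val < 1, Complex.Gamma (1 - upperParams δ k u j + s)) =
      Complex.Gamma s := by
    simp [Finset.prod_filter, upperParams]
  have h3 : (∏ j : Fin 1 with 1 ≤ j.val, Complex.Gamma (1 - lowerParams δ u j + s)) = 1 := by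
    simp
  have h4 : (∏ j : Fin 3 with 1 ≤ j.val, Complex.Gamma (upperParams δ k u j - s)) =
      Complex.Gamma (δ - u - s + k + 1) * Complex.Gamma (δ - s) := by
    simp [Finset.prod_filter, Fin.prod_univ_three, upperParams]
    left; congr 1; ring
  rw [meijerIntegrand, h1, h2, h3, h4, one_mul, div_mul_eq_div_div, div_eq_mul_inv,
    div_eq_mul_inv, div_eq_mul_inv]
  ring

/-- Only `t = Im w` can hit a real value, so the conventional values of `Complex.Gamma` at its poles
do not affect the `G`-integrals. -/
theorem ae_line_ne (γ : ℝ) (w : ℂ) :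
    ∀ᵐ t : ℝ, ∀ j : ℕ, w - ((γ : ℂ) + t * Complex.I) ≠ -(j : ℂ) := by
  have hc : ({w.im} : Set ℝ).Countable := Set.countable_singleton _
  filter_upwards [hc.ae_notMem MeasureTheory.volume] with t ht j h
  refine ht ?_
  have := congrArg Complex.im h
  simp at this
  simp; linarith

/-- The integrand of the `G`-functions with the rational kernel in place of the quotient of
Gamma functions. -/
def meijerKernel (γ δ : ℝ) (k : ℕ) (u : ℂ) (y : ℝ) (t : ℝ) : ℂ :=
  rieszKernel k (δ - u - (γ + t * Complex.I)) * (Complex.Gamma (γ + t * Complex.I) *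
    (Complex.Gamma (δ - (γ + t * Complex.I)))⁻¹) * (y : ℂ) ^ ((γ : ℂ) + t * Complex.I)

theorem meijerIntegrand_ae_eq (γ δ : ℝ) (k : ℕ) (u : ℂ) (y : ℝ) :
    (fun t : ℝ => meijerIntegrand 1 1 (upperParams δ k u) (lowerParams δ u) y
      ((γ : ℂ) + (t : ℂ) * Complex.I)) =ᵐ[MeasureTheory.volume] meijerKernel γ δ k u y := by
  filter_upwards [ae_line_ne γ (δ - u)] with t ht
  rw [meijerIntegrand_eq, Gamma_div_Gamma_eq_rieszKernel fun j _ => ht j, meijerKernel]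

theorem integrable_meijerKernel {γ δ : ℝ} {k : ℕ} {u : ℂ} (hγ : 0 < γ) (hk : 2 * γ - δ < k)
    (hu : ∀ j : ℕ, j ≤ k → u.re + γ - δ ≠ j) {y : ℝ} (hy : 0 < y) :
    MeasureTheory.Integrable (meijerKernel γ δ k u y) := by
  obtain ⟨C, hC, hG⟩ := exists_norm_Gamma_div_le γ (δ - γ)
  have hcont : Continuous (meijerKernel γ δ k u y) := by
    refine ((continuous_rieszKernel_comp (by fun_prop) ?_).mul (Continuous.mul ?_ ?_)).mul
      (Continuous.const_cpow (by fun_prop) (Or.inl (by exact_mod_cast hy.ne')))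
    · intro t j hj h
      have := congrArg Complex.re h
      simp at this
      exact hu j hj (by linarith)
    · refine continuous_iff_continuousAt.2 fun t => ContinuousAt.comp
        (f := fun t : ℝ => (γ : ℂ) + t * Complex.I)
        (Complex.differentiableAt_Gamma _ fun m hm => ?_).continuousAt (by fun_prop)
      have := congrArg Complex.re hm
      simp at this
      have : (0 : ℝ) ≤ m := m.cast_nonneg
      linarith
    · exact Complex.differentiable_one_div_Gamma.continuous.comp (by fun_prop)
  -- The threshold ensures `|Im u + t| ≥ |t|/2`. The kernel contributes `|t|^(-k-1)` and the Gamma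
  -- quotient `|t|^(2γ-δ)`; the total exponent is below `-1` exactly when `2γ - δ < k`.
  refine integrable_of_norm_le_rpow hcont (T := 2 * |u.im| + 1) (a := 2 * γ - δ - (k + 1))
    (C := 2 ^ (k + 1) * C * y ^ γ) (by linarith) (by linarith [abs_nonneg u.im]) fun t ht => ?_
  have ht1 : 1 ≤ |t| := by linarith [abs_nonneg u.im]
  have hG' := hG t ht1
  rw [show γ - (δ - γ) = 2 * γ - δ by ring] at hG'
  have e1 : (δ : ℂ) - (γ + t * Complex.I) = ((δ - γ : ℝ) : ℂ) - t * Complex.I := by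
    push_cast; ring
  have him : ((δ : ℂ) - u - (γ + t * Complex.I)).im = -(u.im + t) := by simp; ring
  have him2 : |t| / 2 ≤ |((δ : ℂ) - u - (γ + t * Complex.I)).im| := by
    rw [him, abs_neg]
    have := abs_sub_abs_le_abs_sub t (-u.im)
    rw [abs_neg, sub_neg_eq_add, add_comm t] at this
    linarith
  have h0 : 0 < |t| / 2 := by linarith
  have hK : ‖rieszKernel k (δ - u - (γ + t * Complex.I))‖ ≤ 2 ^ (k + 1) * (|t| ^ (k + 1))⁻¹ := by
    refine (norm_rieszKernel_le k (abs_pos.1 (h0.trans_le him2))).trans ?_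
    calc _ ≤ ((|t| / 2) ^ (k + 1))⁻¹ := by gcongr
      _ = _ := by rw [div_pow, inv_div, div_eq_mul_inv]
  have hY : ‖(y : ℂ) ^ ((γ : ℂ) + t * Complex.I)‖ = y ^ γ := by
    rw [Complex.norm_cpow_eq_rpow_re_of_pos hy]; simp
  rw [meijerKernel, norm_mul, norm_mul, hY, e1]
  calc _ ≤ 2 ^ (k + 1) * (|t| ^ (k + 1))⁻¹ * (C * |t| ^ (2 * γ - δ)) * y ^ γ := by gcongr
    _ = _ := by
      rw [Real.rpow_sub (by linarith) (2 * γ - δ) (k + 1),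
        show ((k : ℝ) + 1) = ((k + 1 : ℕ) : ℝ) by push_cast; ring, Real.rpow_natCast]
      ring

theorem gArg_eq (lam : ℕ → ℝ) (x : ℝ) (n : ℕ) :
    gArg lam x n = ((1 / (4 * Real.pi ^ 2 * lam n * x) : ℝ) : ℂ) := by
  rw [gArg]; push_cast; ring

/-- The integrand of the contour integrals: `x^{z-u+k} φ(z) ψ(v+u-z) / ((z-u) ⋯ (z-u+k))`. -/
def rieszIntegrand (k : ℕ) (φ ψ : ℂ → ℂ) (u v : ℂ) (x : ℝ) (z : ℂ) : ℂ :=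
  rieszKernel k (z - u) * (x : ℂ) ^ (z - u + k) * (φ z * ψ (v + u - z))

namespace HeckePair

variable {δ : ℝ} {lam mu : ℕ → ℝ} {f g : ℕ → ℂ} {σφ σψ : ℝ} {φ ψ : ℂ → ℂ} {Pφ Pψ : Finset ℝ}
  {rφ rψ : ℝ → ℂ}

/-- The functional equation on the line `Re z = δ - γ`. -/
theorem rieszIntegrand_eq (h : HeckePair δ lam mu f g σφ σψ φ ψ Pφ Pψ rφ rψ) (γ : ℝ) (k : ℕ)
    (u v : ℂ) {x : ℝ} (hx : 0 < x) {t : ℝ} (ht : t ≠ 0) :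
    rieszIntegrand k φ ψ u v x ((δ - γ : ℝ) + (-t : ℝ) * Complex.I) =
      (2 * Real.pi : ℂ) ^ (δ : ℂ) * (x : ℂ) ^ ((δ : ℂ) - u + k) *
        (meijerKernel γ δ k u (1 / (4 * Real.pi ^ 2 * x)) t *
        (ψ (γ + t * Complex.I) * ψ (γ + t * Complex.I - (δ - u - v)))) := by
  set s : ℂ := γ + t * Complex.I with hs
  have hz : ((δ - γ : ℝ) : ℂ) + (-t : ℝ) * Complex.I = δ - s := by rw [hs]; push_cast; ring
  have hx0 : (x : ℂ) ≠ 0 := by exact_mod_cast hx.ne'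
  have hp0 : (2 * Real.pi : ℂ) ≠ 0 := by simp [Real.pi_ne_zero]
  rw [hz, rieszIntegrand, h.eq_of_im_ne_zero (z := δ - s) (by simpa [hs] using ht), meijerKernel,
    ← hs]
  have e1 : (x : ℂ) ^ (δ - s - u + k) = (x : ℂ) ^ ((δ : ℂ) - u + k) * (x : ℂ) ^ (-s) := by
    rw [← Complex.cpow_add _ _ hx0]; congr 1; ring
  have e2 : (2 * Real.pi : ℂ) ^ (2 * (δ - s) - δ) =
      (2 * Real.pi : ℂ) ^ (δ : ℂ) * ((2 * Real.pi : ℂ) ^ (-s) * (2 * Real.pi : ℂ) ^ (-s)) := by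
    rw [← Complex.cpow_add _ _ hp0, ← Complex.cpow_add _ _ hp0]; congr 1; ring
  have e3 : ((1 / (4 * Real.pi ^ 2 * x) : ℝ) : ℂ) ^ s =
      (2 * Real.pi : ℂ) ^ (-s) * (2 * Real.pi : ℂ) ^ (-s) * (x : ℂ) ^ (-s) := by
    have h2p : (2 * Real.pi : ℂ) = ((2 * Real.pi : ℝ) : ℂ) := by push_cast; ring
    rw [show 1 / (4 * Real.pi ^ 2 * x) = ((2 * Real.pi) * (2 * Real.pi) * x)⁻¹ by
        rw [one_div]; ring_nf,
      Complex.ofReal_inv, Complex.inv_cpow _ _ (by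
        rw [Complex.arg_ofReal_of_nonneg (by positivity)]; exact Real.pi_pos.ne),
      Complex.ofReal_mul, Complex.mul_cpow_ofReal_nonneg (by positivity) hx.le,
      Complex.ofReal_mul, Complex.mul_cpow_ofReal_nonneg (by positivity) (by positivity), h2p,
      Complex.cpow_neg, Complex.cpow_neg]
    simp only [mul_inv]
  rw [e1, e2, e3, show (δ : ℂ) - s - u = δ - u - s by ring,
    show (δ : ℂ) - (δ - s) = s by ring, show v + u - (δ - s) = s - (δ - u - v) by ring]
  ring

/-- The series `G_{g,k}` as an integral over the line `Re z = δ - γ`. -/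
theorem gSeries_eq_integral (h : HeckePair δ lam mu f g σφ σψ φ ψ Pφ Pψ rφ rψ) {γ : ℝ} {k : ℕ}
    {u v : ℂ} (hγ : σψ < γ) (hγ0 : 0 < γ) (hγuv : σψ < u.re + v.re + γ - δ) (hk : 2 * γ - δ < k)
    (hu : ∀ j : ℕ, j ≤ k → u.re + γ - δ ≠ j) {x : ℝ} (hx : 0 < x) :
    (∀ n : ℕ, 1 ≤ n → MeasureTheory.Integrable (fun t : ℝ => meijerIntegrand 1 1
        (upperParams δ k u) (lowerParams δ u) (gArg mu x n) ((γ : ℂ) + (t : ℂ) * Complex.I))) ∧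
    (Summable fun n : ℕ+ => gTerm γ δ k mu g u v x n) ∧
    MeasureTheory.Integrable (fun t : ℝ =>
      rieszIntegrand k φ ψ u v x ((δ - γ : ℝ) + t * Complex.I)) ∧
    gSeries γ δ k mu g u v x = 1 / (2 * Real.pi) *
      ∫ t : ℝ, rieszIntegrand k φ ψ u v x ((δ - γ : ℝ) + t * Complex.I) := by
  set y : ℝ := 1 / (4 * Real.pi ^ 2 * x) with hy
  have hy0 : 0 < y := by positivity
  have hint := integrable_meijerKernel hγ0 hk hu hy0
  have hre : ∀ t : ℝ, ((γ : ℂ) + t * Complex.I).re = γ := fun t => by simp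
  have hre' : ∀ t : ℝ, ((γ : ℂ) + t * Complex.I - (δ - u - v)).re = u.re + v.re + γ - δ :=
    fun t => by simp; ring
  -- the argument of the `n`-th term
  have hker : ∀ n : ℕ, 1 ≤ n → ∀ t : ℝ,
      meijerKernel γ δ k u (1 / (4 * Real.pi ^ 2 * mu n * x)) t =
      meijerKernel γ δ k u y t * ((mu n : ℂ) ^ ((γ : ℂ) + t * Complex.I))⁻¹ := by
    intro n hn t
    have hmu := h.right.lam_pos n hn
    have e : ((1 / (4 * Real.pi ^ 2 * mu n * x) : ℝ) : ℂ) ^ ((γ : ℂ) + t * Complex.I) =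
        (y : ℂ) ^ ((γ : ℂ) + t * Complex.I) * ((mu n : ℂ) ^ ((γ : ℂ) + t * Complex.I))⁻¹ := by
      rw [show 1 / (4 * Real.pi ^ 2 * mu n * x) = y * 1 / mu n by rw [hy]; field_simp,
        ofReal_mul_mul_inv_cpow hy0 one_pos hmu]
      simp [div_eq_mul_inv]
    rw [meijerKernel, e, meijerKernel]
    ring
  have hcpow : ∀ n : ℕ, 1 ≤ n → Continuous fun t : ℝ =>
      ((mu n : ℂ) ^ ((γ : ℂ) + t * Complex.I))⁻¹ := fun n hn =>
    (Continuous.const_cpow (by fun_prop) (Or.inl (h.right.lam_ne_zero hn))).inv₀ fun t h0 =>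
      h.right.lam_ne_zero hn (Complex.cpow_eq_zero_iff _ _ |>.1 h0).1
  have hnorm : ∀ n : ℕ, 1 ≤ n → ∀ t : ℝ,
      ‖((mu n : ℂ) ^ ((γ : ℂ) + t * Complex.I))⁻¹‖ = mu n ^ (-γ) := fun n hn t => by
    rw [norm_inv, h.right.norm_cpow_lam hn, hre, Real.rpow_neg (h.right.lam_pos n hn).le]
  have hae : ∀ n : ℕ, 1 ≤ n → (fun t : ℝ => meijerIntegrand 1 1 (upperParams δ k u)
      (lowerParams δ u) (gArg mu x n) ((γ : ℂ) + (t : ℂ) * Complex.I)) =ᵐ[MeasureTheory.volume]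
      fun t => meijerKernel γ δ k u y t * ((mu n : ℂ) ^ ((γ : ℂ) + t * Complex.I))⁻¹ := by
    intro n hn
    rw [gArg_eq]
    filter_upwards [meijerIntegrand_ae_eq γ δ k u (1 / (4 * Real.pi ^ 2 * mu n * x))] with t ht
    rw [ht, hker n hn]
  obtain ⟨hsumm, hconv⟩ := h.right.hasSum_twistedConv (a := δ - u - v) hγ
    (by simp; linarith)
  -- The `n`-th Meijer kernel is the one for `n = 1` times `μ_n^{-s}`, so a single integrable kernel
  -- serves the whole series.
  have hser := (hasSum_integral_mul hint (e := fun (n : ℕ+) (t : ℝ) =>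
    twistedConv mu g (δ - u - v) n * ((mu n : ℂ) ^ ((γ : ℂ) + t * Complex.I))⁻¹)
    (fun n => continuous_const.mul (hcpow n n.pos)) hsumm
    (fun n t => by rw [norm_mul, hnorm n n.pos])).2
  have htsum : ∀ t : ℝ, ∑' n : ℕ+,
      twistedConv mu g (δ - u - v) n * ((mu n : ℂ) ^ ((γ : ℂ) + t * Complex.I))⁻¹ =
      ψ (γ + t * Complex.I) * ψ (γ + t * Complex.I - (δ - u - v)) := fun t => by
    rw [← (hconv _ (hre t)).tsum_eq]
    simp only [div_eq_mul_inv]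
  simp only [htsum] at hser
  have hterm : ∀ n : ℕ+, gTerm γ δ k mu g u v x n =
      (x : ℂ) ^ ((δ : ℂ) - u + k) * (1 / (2 * Real.pi)) * ∫ t : ℝ, meijerKernel γ δ k u y t *
        (twistedConv mu g (δ - u - v) n * ((mu n : ℂ) ^ ((γ : ℂ) + t * Complex.I))⁻¹) := by
    intro n
    rw [gTerm, meijerG, MeasureTheory.integral_congr_ae (hae n n.pos)]
    simp only [mul_left_comm _ (twistedConv mu g (δ - u - v) n)]
    rw [MeasureTheory.integral_const_mul]
    ring
  have hG : HasSum (fun n : ℕ+ => gTerm γ δ k mu g u v x n) ((x : ℂ) ^ ((δ : ℂ) - u + k) *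
      (1 / (2 * Real.pi)) * ∫ t : ℝ, meijerKernel γ δ k u y t *
        (ψ (γ + t * Complex.I) * ψ (γ + t * Complex.I - (δ - u - v)))) :=
    (hser.mul_left _).congr_fun hterm
  obtain ⟨C, hC, hle⟩ := h.right.exists_norm_le hγ
  obtain ⟨C', hC', hle'⟩ := h.right.exists_norm_le hγuv
  have hψc : Continuous fun t : ℝ => ψ (γ + t * Complex.I) * ψ (γ + t * Complex.I - (δ - u - v)) :=
    continuous_iff_continuousAt.2 fun t => ContinuousAt.mul
      (ContinuousAt.comp (f := fun t : ℝ => (γ : ℂ) + t * Complex.I)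
        (h.right.differentiableAt_of_lt (by rw [hre]; exact hγ)).continuousAt (by fun_prop))
      (ContinuousAt.comp (f := fun t : ℝ => (γ : ℂ) + t * Complex.I - (δ - u - v))
        (h.right.differentiableAt_of_lt (by rw [hre']; exact hγuv)).continuousAt (by fun_prop))
  have hint2 : MeasureTheory.Integrable fun t : ℝ => meijerKernel γ δ k u y t *
      (ψ (γ + t * Complex.I) * ψ (γ + t * Complex.I - (δ - u - v))) := by
    refine hint.mul_bdd (c := C * C') hψc.aestronglyMeasurable
      (Filter.Eventually.of_forall fun t => ?_)
    rw [norm_mul]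
    exact mul_le_mul (hle _ (hre t).ge) (hle' _ (hre' t).ge) (norm_nonneg _) hC
  have hne : ∀ᵐ t : ℝ, t ≠ 0 := by
    have hc : ({0} : Set ℝ).Countable := Set.countable_singleton _
    filter_upwards [hc.ae_notMem MeasureTheory.volume] with t ht using ht
  have hae2 : (fun t : ℝ => rieszIntegrand k φ ψ u v x ((δ - γ : ℝ) + (-t : ℝ) * Complex.I))
      =ᵐ[MeasureTheory.volume] fun t => (2 * Real.pi : ℂ) ^ (δ : ℂ) *
        (x : ℂ) ^ ((δ : ℂ) - u + k) * (meijerKernel γ δ k u y t *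
        (ψ (γ + t * Complex.I) * ψ (γ + t * Complex.I - (δ - u - v)))) := by
    filter_upwards [hne] with t ht
    exact h.rieszIntegrand_eq γ k u v hx ht
  refine ⟨fun n hn => ?_, hG.summable, ?_, ?_⟩
  · refine (hint.mul_bdd (c := mu n ^ (-γ)) (hcpow n hn).aestronglyMeasurable
      (Filter.Eventually.of_forall fun t => (hnorm n hn t).le)).congr (hae n hn).symm
  -- The substitution `z = δ - s` reverses the line, hence the change `t ↦ -t`.
  · have h1 := ((hint2.const_mul ((2 * Real.pi : ℂ) ^ (δ : ℂ) *
      (x : ℂ) ^ ((δ : ℂ) - u + k))).congr hae2.symm).comp_neg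
    simpa only [neg_neg] using h1
  · rw [gSeries, hG.tsum_eq, ← MeasureTheory.integral_neg_eq_self (fun t : ℝ =>
        rieszIntegrand k φ ψ u v x ((δ - γ : ℝ) + t * Complex.I)),
      MeasureTheory.integral_congr_ae hae2, MeasureTheory.integral_const_mul]
    ring

end HeckePair

end

noncomputable section

/-! ### Shifting the contour -/

/-- The integral of a function with finitely many poles over the boundary of a rectangle does not
depend on the height of the rectangle, if all poles lie below that height. -/
theorem rectIntegral_eq_rectIntegral {a b B T T' : ℝ} (hab : a ≤ b) (hbB : b < B) (hT : 0 ≤ T)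
    (hT' : 0 ≤ T') (m : Multiset ℂ) (hmb : ∀ p ∈ m, p.re < b) (hmT : ∀ p ∈ m, |p.im| < T)
    (hmT' : ∀ p ∈ m, |p.im| < T') (hma : ∀ p ∈ m, p.re ≠ a)
    (H : ℂ → ℂ) (hH : DifferentiableOn ℂ H {z | z.re < B}) :
    rectIntegral a b T (fun z => H z * (m.map (fun p => z - p)).prod⁻¹) =
      rectIntegral a b T' (fun z => H z * (m.map (fun p => z - p)).prod⁻¹) := by
  set U : Set ℂ := {z | z.re < B}
  set S : Set ℂ := {p | p ∈ m}
  have hfr : ∀ z ∈ rectFrame a b T, z ∈ U \ S := fun z hz =>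
    ⟨lt_of_le_of_lt hz.1.2 hbB, fun hzm =>
      ne_of_mem_rectFrame (hma z hzm) (hmb z hzm).ne (hmT z hzm) hz rfl⟩
  have hfr' : ∀ z ∈ rectFrame a b T', z ∈ U \ S := fun z hz =>
    ⟨lt_of_le_of_lt hz.1.2 hbB, fun hzm =>
      ne_of_mem_rectFrame (hma z hzm) (hmb z hzm).ne (hmT' z hzm) hz rfl⟩
  have hdiff : ∀ F : ℂ → ℂ, DifferentiableOn ℂ F U → ∀ R : ℝ, rectIntegral a b R F = 0 :=
    fun F hF R => rectIntegral_eq_zero_of_differentiableOn hab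
      (hF.mono fun z hz => lt_of_le_of_lt hz.2 hbB)
  have key := eq_zero_of_principal_parts (U := U) (S := S)
    (isOpen_lt Complex.continuous_re continuous_const)
    (fun p hp => (hmb p hp).trans hbB)
    (fun F => rectIntegral a b T F - rectIntegral a b T' F) ?_ ?_ ?_ ?_ ?_ m (fun p hp => hp) H hH
  · exact sub_eq_zero.1 key
  · intro F G hFG
    exact congrArg₂ _ (rectIntegral_congr hab hT fun z hz => hFG (hfr z hz))
      (rectIntegral_congr hab hT' fun z hz => hFG (hfr' z hz))
  · intro F G hF hG
    rw [rectIntegral_add hab hT (hF.mono hfr) (hG.mono hfr),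
      rectIntegral_add hab hT' (hF.mono hfr') (hG.mono hfr')]
    ring
  · intro r F
    rw [rectIntegral_const_mul, rectIntegral_const_mul]
    ring
  · intro F hF
    rw [hdiff F hF, hdiff F hF, sub_self]
  · intro p hp n
    have hcont : ContinuousOn (fun z => ((z - p) ^ (n + 1))⁻¹) (U \ S) :=
      ContinuousOn.inv₀ (by fun_prop) fun z hz => pow_ne_zero _ (sub_ne_zero.2 fun h =>
        hz.2 (h ▸ hp))
    rcases n with _ | n
    · simp only [zero_add, pow_one]
      rcases lt_or_gt_of_ne (hma p hp) with h | h
      · have hd : DifferentiableOn ℂ (fun z => (z - p)⁻¹) {z | z.re ∈ Set.Icc a b} := by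
          intro z hz
          refine (DifferentiableAt.inv (by fun_prop) (sub_ne_zero.2 ?_)).differentiableWithinAt
          rintro rfl
          exact absurd hz.1 (not_le.2 h)
        rw [rectIntegral_eq_zero_of_differentiableOn hab hd,
          rectIntegral_eq_zero_of_differentiableOn hab hd, sub_self]
      · rw [rectIntegral_inv_sub h (hmb p hp) (hmT p hp),
          rectIntegral_inv_sub h (hmb p hp) (hmT' p hp), sub_self]
    · have hder : ∀ z ∈ U \ S, HasDerivAt (fun z => -((n : ℂ) + 1)⁻¹ * ((z - p) ^ (n + 1))⁻¹)
          ((z - p) ^ (n + 2))⁻¹ z := fun z hz =>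
        hasDerivAt_inv_pow p z n fun h => hz.2 (h ▸ hp)
      show rectIntegral a b T (fun z => ((z - p) ^ (n + 2))⁻¹) -
        rectIntegral a b T' (fun z => ((z - p) ^ (n + 2))⁻¹) = 0
      rw [rectIntegral_eq_zero_of_hasDerivAt hab hT (hcont.mono hfr) fun z hz => hder z (hfr z hz),
        rectIntegral_eq_zero_of_hasDerivAt hab hT' (hcont.mono hfr') fun z hz =>
          hder z (hfr' z hz), sub_self]

/-- The possible poles of `rieszIntegrand` to the left of the region of convergence of `ψ`. -/
def rieszPoles (k : ℕ) (u : ℂ) (P : Finset ℝ) : Multiset ℂ :=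
  (Multiset.range (k + 1)).map (fun j : ℕ => u - j) + P.val.map (fun p : ℝ => (p : ℂ))

theorem mem_rieszPoles {k : ℕ} {u : ℂ} {P : Finset ℝ} {p : ℂ} :
    p ∈ rieszPoles k u P ↔ (∃ j : ℕ, j ≤ k ∧ u - j = p) ∨ ∃ q ∈ P, (q : ℂ) = p := by
  simp only [rieszPoles, Multiset.mem_add, Multiset.mem_map, Multiset.mem_range, Nat.lt_succ_iff,
    Finset.mem_val]

theorem prod_rieszPoles (k : ℕ) (u : ℂ) (P : Finset ℝ) (z : ℂ) :
    ((rieszPoles k u P).map (fun p => z - p)).prod =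
      (∏ j ∈ Finset.range (k + 1), (z - u + j)) * ∏ p ∈ P, (z - (p : ℂ)) := by
  rw [rieszPoles, Multiset.map_add, Multiset.prod_add, Multiset.map_map, Multiset.map_map]
  congr 1
  rw [Finset.prod]
  simp only [Finset.range_val]
  congr 1
  refine Multiset.map_congr rfl fun j _ => ?_
  simp only [Function.comp]
  ring

/-- The factor `ψ(v+u-z)` is holomorphic for `Re z < Re u + Re v - σψ`, so only the zeros of the
kernel denominator and the poles of `φ` remain. Listing them as a multiset allows some `u - j` to
coincide with a pole of `φ`. -/
theorem exists_rieszIntegrand_eq {lam mu : ℕ → ℝ} {f g : ℕ → ℂ} {σφ σψ : ℝ} {φ ψ : ℂ → ℂ}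
    {Pφ Pψ : Finset ℝ} {rφ rψ : ℝ → ℂ} (hL : IsContinuedDirichletSeries lam f σφ φ Pφ rφ)
    (hR : IsContinuedDirichletSeries mu g σψ ψ Pψ rψ) (k : ℕ) (u v : ℂ) {x : ℝ} (hx : 0 < x) :
    ∃ H : ℂ → ℂ, DifferentiableOn ℂ H {z | z.re < u.re + v.re - σψ} ∧
      ∀ z : ℂ, (∀ p ∈ Pφ, z ≠ (p : ℂ)) → rieszIntegrand k φ ψ u v x z =
        H z * ((rieszPoles k u Pφ).map (fun p => z - p)).prod⁻¹ := by
  obtain ⟨B, hB, hφ⟩ := hL.exists_mul_prod_eq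
  have hx0 : (x : ℂ) ≠ 0 := by exact_mod_cast hx.ne'
  refine ⟨fun z => B z * (x : ℂ) ^ (z - u + k) * ψ (v + u - z), fun z hz => ?_, fun z hz => ?_⟩
  · refine DifferentiableAt.differentiableWithinAt ?_
    refine ((hB z).mul (DifferentiableAt.const_cpow (by fun_prop) (Or.inl hx0))).mul ?_
    refine DifferentiableAt.comp (f := fun z : ℂ => v + u - z) z (hR.differentiableAt_of_lt ?_)
      (by fun_prop)
    have : z.re < u.re + v.re - σψ := hz
    simp
    linarith
  · have h0 : ∏ p ∈ Pφ, (z - (p : ℂ)) ≠ 0 :=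
      Finset.prod_ne_zero_iff.2 fun p hp => sub_ne_zero.2 (hz p hp)
    simp only
    rw [rieszIntegrand, rieszKernel, prod_rieszPoles, ← hφ z hz, mul_inv]
    field_simp

/-- A curve takes a given value with nonzero velocity at countably many parameters only. -/
theorem countable_preimage_deriv_ne_zero (c : ℝ → ℂ) (q : ℂ) :
    {t | c t = q ∧ deriv c t ≠ 0}.Countable := by
  set s : Set ℝ := {t | c t = q ∧ deriv c t ≠ 0} with hs
  refine Set.Countable.mono (fun t ht => ?_) (countable_setOfPred_isolated_right_within (s := s))
  refine ⟨ht, ?_⟩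
  have hd : DifferentiableAt ℝ c t := by
    by_contra h
    exact ht.2 (deriv_zero_of_not_differentiableAt h)
  have h1 := hd.hasDerivAt.eventually_ne ht.2 (c := q)
  rw [← Filter.empty_mem_iff_bot]
  have h2 : ∀ᶠ y in nhdsWithin t (s ∩ Set.Ioi t), c y ≠ q :=
    h1.filter_mono (nhdsWithin_mono _ fun y hy => ne_of_gt hy.2)
  filter_upwards [h2, self_mem_nhdsWithin] with y hy hys
  exact hy hys.1.1

/-- A curve may pass through `u - j` with `j > k`, where the Gamma quotient has a spurious value.
This happens with nonzero velocity only for countably many parameters, and elsewhere `deriv c` kills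
the integrand. -/
theorem polarTerm_eq (k : ℕ) (φ ψ : ℂ → ℂ) (u v : ℂ) (x : ℝ) (c : ℝ → ℂ) :
    polarTerm k φ ψ u v x c =
      1 / (2 * Real.pi * Complex.I) * contourIntegral c (rieszIntegrand k φ ψ u v x) := by
  rw [polarTerm]
  congr 1
  refine intervalIntegral.integral_congr_ae ?_
  have hcount : (⋃ j : ℕ, {t | c t = u - j ∧ deriv c t ≠ 0}).Countable :=
    Set.countable_iUnion fun j => countable_preimage_deriv_ne_zero c _
  filter_upwards [hcount.ae_notMem MeasureTheory.volume] with t ht _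
  by_cases h0 : deriv c t = 0
  · simp [h0]
  · rw [Gamma_div_Gamma_eq_rieszKernel, rieszIntegrand]
    · ring
    · intro j _ hj
      exact ht (Set.mem_iUnion.2 ⟨j, by linear_combination hj, h0⟩)

end

/-! ### The shift to `Re z = δ - γ` and the identities for the Riesz sums. -/

noncomputable section

namespace HeckePair

variable {δ : ℝ} {lam mu : ℕ → ℝ} {f g : ℕ → ℂ} {σφ σψ : ℝ} {φ ψ : ℂ → ℂ} {Pφ Pψ : Finset ℝ}
  {rφ rψ : ℝ → ℂ}

theorem rieszPoles_re_ne (h : HeckePair δ lam mu f g σφ σψ φ ψ Pφ Pψ rφ rψ) {γ : ℝ} {k : ℕ}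
    {u : ℂ} (hγ : σψ < γ) (hγ0 : 0 < γ) (hu' : ∀ j : ℕ, j ≤ k → u.re + γ - δ ≠ j) :
    ∀ p ∈ rieszPoles k u Pφ, p.re ≠ δ - γ := by
  intro p hp
  rcases mem_rieszPoles.1 hp with ⟨j, hj, rfl⟩ | ⟨q, hq, rfl⟩
  · intro h0
    simp at h0
    exact hu' j hj (by linarith)
  · exact (h.lt_pole hγ hγ0 hq).ne'

theorem _root_.rieszPoles_im_lt {k : ℕ} {u : ℂ} {P : Finset ℝ} {T : ℝ} (hT : |u.im| < T) :
    ∀ p ∈ rieszPoles k u P, |p.im| < T := by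
  intro p hp
  rcases mem_rieszPoles.1 hp with ⟨j, hj, rfl⟩ | ⟨q, hq, rfl⟩
  · simpa using hT
  · simpa using (abs_nonneg _).trans_lt hT

theorem _root_.IsContinuedDirichletSeries.rieszPoles_re_lt
    (hL : IsContinuedDirichletSeries lam f σφ φ Pφ rφ) {k : ℕ} {u : ℂ} {b : ℝ} (hub : u.re < b)
    (hb : σφ < b) : ∀ p ∈ rieszPoles k u Pφ, p.re < b := by
  intro p hp
  rcases mem_rieszPoles.1 hp with ⟨j, hj, rfl⟩ | ⟨q, hq, rfl⟩
  · have : (0 : ℝ) ≤ j := j.cast_nonneg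
    simp
    linarith
  · simpa using (hL.pole_le hq).trans_lt hb

theorem exists_norm_rieszIntegrand_le (h : HeckePair δ lam mu f g σφ σψ φ ψ Pφ Pψ rφ rψ)
    {γ b : ℝ} {k : ℕ} {u v : ℂ} (hγ : σψ < γ) (hb : σφ < b) (hab : δ - γ < b)
    (hvb : σψ < u.re + v.re - b) (hk : 2 * γ - δ < k) {x : ℝ} (hx : 0 < x) :
    ∃ C, 0 ≤ C ∧ ∀ z : ℂ, δ - γ ≤ z.re → z.re ≤ b → 2 * |u.im| + 1 ≤ |z.im| →
      ‖rieszIntegrand k φ ψ u v x z‖ ≤ C / |z.im| := by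
  obtain ⟨C, hC, hφ⟩ := h.exists_norm_le_strip hγ hb hab hk.le
  obtain ⟨C', hC', hψ⟩ := h.right.exists_norm_le hvb
  obtain ⟨X, hX⟩ := isCompact_Icc.exists_bound_of_continuousOn (s := Set.Icc (δ - γ) b)
    (f := fun y : ℝ => x ^ (y - u.re + k)) (Continuous.continuousOn (by
      refine Continuous.rpow continuous_const (by fun_prop) fun y => Or.inl hx.ne'))
  have hX0 : 0 ≤ X := (norm_nonneg _).trans (hX b ⟨hab.le, le_rfl⟩)
  refine ⟨2 ^ (k + 1) * X * (C * C'), by positivity, fun z hz1 hz2 hz3 => ?_⟩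
  have ht1 : 1 ≤ |z.im| := by linarith [abs_nonneg u.im]
  have him : |z.im| / 2 ≤ |(z - u).im| := by
    have := abs_sub_abs_le_abs_sub z.im u.im
    rw [Complex.sub_im]
    linarith
  have h0 : 0 < |z.im| / 2 := by linarith
  have hK : ‖rieszKernel k (z - u)‖ ≤ 2 ^ (k + 1) * (|z.im| ^ (k + 1))⁻¹ := by
    refine (norm_rieszKernel_le k (abs_pos.1 (h0.trans_le him))).trans ?_
    calc _ ≤ ((|z.im| / 2) ^ (k + 1))⁻¹ := by gcongr
      _ = _ := by rw [div_pow, inv_div, div_eq_mul_inv]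
  have hx1 : ‖(x : ℂ) ^ (z - u + k)‖ ≤ X := by
    rw [Complex.norm_cpow_eq_rpow_re_of_pos hx]
    have := hX z.re ⟨hz1, hz2⟩
    rw [Real.norm_of_nonneg (Real.rpow_nonneg hx.le _)] at this
    simpa using this
  have hψ' : ‖ψ (v + u - z)‖ ≤ C' := hψ _ (by simp; linarith)
  rw [rieszIntegrand, norm_mul, norm_mul, norm_mul]
  calc _ ≤ 2 ^ (k + 1) * (|z.im| ^ (k + 1))⁻¹ * X * (C * |z.im| ^ k * C') := by
        gcongr
        exact hφ z hz1 hz2 ht1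
    _ = _ := by
      have : |z.im| ≠ 0 := by linarith
      field_simp
      ring

/-- The horizontal sides have fixed length and integrand `O(1/T)`; the vertical sides converge by
integrability. -/
theorem _root_.tendsto_rectIntegral {a b C T₀ : ℝ} (hab : a ≤ b) {F : ℂ → ℂ}
    (hF : ∀ z : ℂ, a ≤ z.re → z.re ≤ b → T₀ ≤ |z.im| → ‖F z‖ ≤ C / |z.im|)
    (ha : MeasureTheory.Integrable fun t : ℝ => F (a + t * Complex.I))
    (hb : MeasureTheory.Integrable fun t : ℝ => F (b + t * Complex.I)) :
    Filter.Tendsto (fun T => rectIntegral a b T F) Filter.atTop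
      (nhds (Complex.I * (∫ t : ℝ, F (b + t * Complex.I)) -
        Complex.I * ∫ t : ℝ, F (a + t * Complex.I))) := by
  have hz : Filter.Tendsto (fun T : ℝ => C / T * |b - a|) Filter.atTop (nhds 0) := by
    simpa using (tendsto_const_nhds.div_atTop Filter.tendsto_id).mul_const |b - a|
  have hhor : ∀ s : ℝ, |s| = 1 → Filter.Tendsto (fun T : ℝ =>
      ∫ x in a..b, F (x + (s * T : ℝ) * Complex.I)) Filter.atTop (nhds 0) := by
    intro s hs
    refine squeeze_zero_norm' ?_ hz
    filter_upwards [Filter.eventually_ge_atTop T₀, Filter.eventually_ge_atTop 0] with T hT hT0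
    have hT' : |s * T| = T := by rw [abs_mul, hs, one_mul, abs_of_nonneg hT0]
    refine intervalIntegral.norm_integral_le_of_norm_le_const fun x hx => ?_
    rw [Set.uIoc_of_le hab] at hx
    have him : ((x : ℂ) + (s * T : ℝ) * Complex.I).im = s * T := by
      simp only [Complex.add_im, Complex.ofReal_im, Complex.mul_I_im, Complex.ofReal_re, zero_add]
    have hre : ((x : ℂ) + (s * T : ℝ) * Complex.I).re = x := by
      simp only [Complex.add_re, Complex.ofReal_re, Complex.mul_I_re, Complex.ofReal_im, neg_zero,
        add_zero]
    have := hF (x + (s * T : ℝ) * Complex.I) (by rw [hre]; exact hx.1.le) (by rw [hre]; exact hx.2)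
      (by rw [him, hT']; exact hT)
    rwa [him, hT'] at this
  have h1 := hhor (-1) (by simp)
  have h2 := hhor 1 (by simp)
  simp only [neg_mul, one_mul] at h1 h2
  have hvert : ∀ G : ℝ → ℂ, MeasureTheory.Integrable G → Filter.Tendsto
      (fun T : ℝ => ∫ t in (-T)..T, G t) Filter.atTop (nhds (∫ t, G t)) := fun G hG =>
    MeasureTheory.intervalIntegral_tendsto_integral hG Filter.tendsto_neg_atTop_atBot
      Filter.tendsto_id
  have := (((h1.sub h2).add ((hvert _ hb).const_mul Complex.I)).sub
    ((hvert _ ha).const_mul Complex.I))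
  simp only [sub_zero, zero_add] at this
  exact this

/-- The shift of the line of integration from `Re z = b` to `Re z = δ - γ`. -/
theorem integral_line_eq_add (h : HeckePair δ lam mu f g σφ σψ φ ψ Pφ Pψ rφ rψ)
    {γ b T : ℝ} {k : ℕ} {u v : ℂ} (hγ : σψ < γ) (hγ0 : 0 < γ) (hγδ : δ / 2 < γ)
    (hk : 2 * γ - δ < k) (hub : u.re < b) (hb : σφ < b)
    (hvb : σψ < u.re + v.re - b) (hu' : ∀ j : ℕ, j ≤ k → u.re + γ - δ ≠ j)
    (hT : |u.im| < T) {x : ℝ} (hx : 0 < x) :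
    1 / (2 * Real.pi) * ∫ t : ℝ, rieszIntegrand k φ ψ u v x (b + t * Complex.I) =
      1 / (2 * Real.pi * Complex.I) *
        rectIntegral (δ - γ) b T (rieszIntegrand k φ ψ u v x) +
      gSeries γ δ k mu g u v x := by
  have hab : δ - γ < b := (h.le_abscissa hγ hγδ).trans_lt hb
  have hk1 : 1 ≤ k := by
    have : (0 : ℝ) < k := by linarith
    exact_mod_cast this
  obtain ⟨-, -, hint, hG⟩ := h.gSeries_eq_integral (u := u) (v := v) hγ hγ0 (by linarith) hk hu' hx
  have hintb := integrable_riesz_line h.left h.right hub hb hvb hk1 hx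
  obtain ⟨C, hC, hbound⟩ := h.exists_norm_rieszIntegrand_le (u := u) (v := v) hγ hb hab hvb hk hx
  obtain ⟨H, hH, hHeq⟩ := exists_rieszIntegrand_eq h.left h.right k u v hx
  have hlim := tendsto_rectIntegral hab.le hbound hint hintb
  have hmb := h.left.rieszPoles_re_lt (k := k) hub hb
  have hma := h.rieszPoles_re_ne hγ hγ0 hu'
  have hfr : ∀ T' : ℝ, |u.im| < T' → rectIntegral (δ - γ) b T' (rieszIntegrand k φ ψ u v x) =
      rectIntegral (δ - γ) b T' (fun z => H z *
        ((rieszPoles k u Pφ).map (fun p => z - p)).prod⁻¹) := fun T' hT' =>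
    rectIntegral_congr hab.le ((abs_nonneg _).trans hT'.le) fun z hz => hHeq z fun p hp =>
      have hp' : (p : ℂ) ∈ rieszPoles k u Pφ := mem_rieszPoles.2 (Or.inr ⟨p, hp, rfl⟩)
      ne_of_mem_rectFrame (hma _ hp') (hmb _ hp').ne (rieszPoles_im_lt hT' _ hp') hz
  -- All poles have imaginary part `0` or `Im u`, so the rectangle integral is constant once the
  -- height exceeds `|Im u|`, and its limit is its value at `T`.
  have hconst : Filter.Tendsto (fun T' => rectIntegral (δ - γ) b T'
      (rieszIntegrand k φ ψ u v x)) Filter.atTop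
      (nhds (rectIntegral (δ - γ) b T (rieszIntegrand k φ ψ u v x))) := by
    refine tendsto_const_nhds.congr' ?_
    filter_upwards [Filter.eventually_gt_atTop |u.im|] with T' hT'
    rw [hfr T hT, hfr T' hT']
    exact rectIntegral_eq_rectIntegral hab.le (B := u.re + v.re - σψ) (by linarith)
      ((abs_nonneg _).trans hT.le) ((abs_nonneg _).trans hT'.le) _ hmb (rieszPoles_im_lt hT)
      (rieszPoles_im_lt hT') hma H hH
  rw [tendsto_nhds_unique hconst hlim, hG]
  have hpi : (Real.pi : ℂ) ≠ 0 := by simp [Real.pi_ne_zero]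
  have hI : Complex.I ≠ 0 := Complex.I_ne_zero
  generalize ∫ t : ℝ, rieszIntegrand k φ ψ u v x (b + t * Complex.I) = J
  generalize ∫ t : ℝ, rieszIntegrand k φ ψ u v x ((δ - γ : ℝ) + t * Complex.I) = J'
  field_simp
  ring

theorem hasSum_riesz (h : HeckePair δ lam mu f g σφ σψ φ ψ Pφ Pψ rφ rψ)
    {γ b T : ℝ} {k : ℕ} {u v : ℂ} (hγ : σψ < γ) (hγ0 : 0 < γ) (hγδ : δ / 2 < γ)
    (hk : 2 * γ - δ < k) (hub : u.re < b) (hb : σφ < b)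
    (hvb : σψ < u.re + v.re - b) (hu' : ∀ j : ℕ, j ≤ k → u.re + γ - δ ≠ j)
    (hT : |u.im| < T) {x : ℝ} (hx : 0 < x) :
    HasSum (fun p => rieszWeight lam mu f g u v p *
      ((max (x - lam p.2 / mu p.1) 0 ^ k : ℝ) : ℂ))
      (k.factorial * (1 / (2 * Real.pi * Complex.I) *
        rectIntegral (δ - γ) b T (rieszIntegrand k φ ψ u v x) +
      gSeries γ δ k mu g u v x)) := by
  have hk1 : 1 ≤ k := by
    have : (0 : ℝ) < k := by linarith
    exact_mod_cast this
  have := hasSum_riesz_eq_integral h.left h.right hub hb hvb hk1 hx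
  rw [← h.integral_line_eq_add hγ hγ0 hγδ hk hub hb hvb hu' hT hx]
  convert this using 1
  rw [← mul_assoc, mul_one_div]
  rfl

/-- Curve and rectangle wind once around each pole of the integrand with real part between `δ - γ`
and `b`, and no pole lies on `Re z = δ - γ`. -/
theorem contourIntegral_rieszIntegrand_eq (h : HeckePair δ lam mu f g σφ σψ φ ψ Pφ Pψ rφ rψ)
    {γ b T B : ℝ} {k : ℕ} {u v : ℂ} (hγ : σψ < γ) (hγ0 : 0 < γ) (hγδ : δ / 2 < γ)
    (hub : u.re < b) (hb : σφ < b) (hvb : σψ < u.re + v.re - b)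
    (hu' : ∀ j : ℕ, j ≤ k → u.re + γ - δ ≠ j) (hB : B ≤ u.re + v.re - σψ)
    (hT : |u.im| < T) {x : ℝ} (hx : 0 < x) {c : ℝ → ℂ}
    (hc : IsAdmissibleContour γ δ B k u Pφ Pψ c) :
    contourIntegral c (rieszIntegrand k φ ψ u v x) =
      rectIntegral (δ - γ) b T (rieszIntegrand k φ ψ u v x) := by
  have hab : δ - γ < b := (h.le_abscissa hγ hγδ).trans_lt hb
  obtain ⟨H, hH, hHeq⟩ := exists_rieszIntegrand_eq h.left h.right k u v hx
  have hmb := h.left.rieszPoles_re_lt (k := k) hub hb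
  have hma := h.rieszPoles_re_ne hγ hγ0 hu'
  have hT0 : 0 ≤ T := (abs_nonneg _).trans hT.le
  have hshift := hc.isClosedCurve.contourIntegral_eq_rectIntegral (T := T) hab.le
    (B := u.re + v.re - σψ) (by linarith) hT0
    (fun t ht => ⟨(hc.in_strip t ht).1, (hc.in_strip t ht).2.trans_le hB⟩) _ hmb
    (rieszPoles_im_lt hT) hma (fun p hp hpa => ?_) H hH
  · rw [rectIntegral_congr hab.le hT0 fun z hz => hHeq z fun p hp =>
        have hp' : (p : ℂ) ∈ rieszPoles k u Pφ := mem_rieszPoles.2 (Or.inr ⟨p, hp, rfl⟩)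
        ne_of_mem_rectFrame (hma _ hp') (hmb _ hp').ne (rieszPoles_im_lt hT _ hp') hz, ← hshift]
    refine intervalIntegral.integral_congr fun t ht => ?_
    rw [Set.uIcc_of_le zero_le_one] at ht
    simp only
    rw [hHeq _ fun p hp => (hc.encircles_left p hp).1 t ht]
  · rcases mem_rieszPoles.1 hp with ⟨j, hj, rfl⟩ | ⟨q, hq, rfl⟩
    · exact hc.encircles_gamma j hj hpa
    · exact hc.encircles_left q hq

/-- The identity for the Riesz sums. -/
theorem rieszTerm_identity (h : HeckePair δ lam mu f g σφ σψ φ ψ Pφ Pψ rφ rψ)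
    {γ b B : ℝ} {k : ℕ} {u v : ℂ} (hγ : σψ < γ) (hγ0 : 0 < γ) (hγδ : δ / 2 < γ)
    (hk : 2 * γ - δ < k) (hub : u.re < b) (hb : σφ < b) (hvb : σψ < u.re + v.re - b)
    (hu' : ∀ j : ℕ, j ≤ k → u.re + γ - δ ≠ j) (hB : B ≤ u.re + v.re - σψ)
    {x : ℝ} (hx : 0 < x) {c : ℝ → ℂ} (hc : IsAdmissibleContour γ δ B k u Pφ Pψ c) :
    (Summable fun n : ℕ+ => rieszTerm k lam mu f g u v x n) ∧
      1 / Complex.Gamma (k + 1) * ∑' n : ℕ+, rieszTerm k lam mu f g u v x n =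
        polarTerm k φ ψ u v x c + gSeries γ δ k mu g u v x := by
  have hk1 : 1 ≤ k := by
    have : (0 : ℝ) < k := by linarith
    exact_mod_cast this
  have hs := hasSum_rieszTerm h.right hk1 (h.hasSum_riesz (T := |u.im| + 1) hγ hγ0 hγδ hk hub hb hvb
    hu' (by linarith) hx)
  refine ⟨hs.summable, ?_⟩
  have hfac : (k.factorial : ℂ) ≠ 0 := by exact_mod_cast k.factorial_ne_zero
  rw [hs.tsum_eq, Complex.Gamma_nat_eq_factorial, polarTerm_eq,
    h.contourIntegral_rieszIntegrand_eq (T := |u.im| + 1) hγ hγ0 hγδ hub hb hvb hu' hB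
      (by linarith) hx hc, ← mul_assoc, one_div_mul_cancel hfac, one_mul]

end HeckePair

end

noncomputable section

/-! ### Iterated derivatives -/

/-- A chain of derivatives. -/
theorem contDiffOn_and_iteratedDeriv_eq_of_chain {U : Set ℝ} (hU : IsOpen U) (n : ℕ) :
    ∀ F : ℕ → ℝ → ℂ, (∀ j < n, ∀ x ∈ U, HasDerivAt (F j) (F (j + 1) x) x) →
      ContinuousOn (F n) U →
      ContDiffOn ℝ n (F 0) U ∧ ∀ x ∈ U, iteratedDeriv n (F 0) x = F n x := by
  induction n with
  | zero =>
    intro F _ hc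
    exact ⟨by simpa using hc, fun x _ => by simp⟩
  | succ n ih =>
    intro F hF hc
    obtain ⟨h1, h2⟩ := ih (fun j => F (j + 1)) (fun j hj => hF (j + 1) (by omega)) hc
    have hd : Set.EqOn (deriv (F 0)) (F 1) U := fun x hx => (hF 0 (by omega) x hx).deriv
    refine ⟨?_, fun x hx => ?_⟩
    · rw [Nat.cast_succ, contDiffOn_succ_iff_deriv_of_isOpen hU]
      refine ⟨fun x hx => (hF 0 (by omega) x hx).differentiableAt.differentiableWithinAt,
        fun h => by simp at h, h1.congr hd⟩
    · rw [iteratedDeriv_succ', ← h2 x hx]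
      exact Filter.EventuallyEq.iteratedDeriv_eq n
        (Filter.eventuallyEq_of_mem (hU.mem_nhds hx) hd)

theorem hasMeanDerivAt_of_chain {U : Set ℝ} (hU : IsOpen U) {x : ℝ} (hx : x ∈ U) (n : ℕ)
    (F : ℕ → ℝ → ℂ) (hF : ∀ j < n, ∀ y ∈ U, HasDerivAt (F j) (F (j + 1) y) y)
    (hc : ContinuousOn (F n) U) {L R : ℂ} (hL : HasDerivWithinAt (F n) L (Set.Iic x) x)
    (hR : HasDerivWithinAt (F n) R (Set.Ici x) x) {G : ℝ → ℂ} (hG : Set.EqOn G (F 0) U) :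
    HasMeanDerivAt (n + 1) G x ((L + R) / 2) := by
  obtain ⟨h1, h2⟩ := contDiffOn_and_iteratedDeriv_eq_of_chain hU n F hF hc
  have hev : iteratedDeriv n G =ᶠ[nhds x] F n := by
    filter_upwards [hU.mem_nhds hx] with y hy
    rw [← h2 y hy]
    exact Filter.EventuallyEq.iteratedDeriv_eq n (Filter.eventuallyEq_of_mem (hU.mem_nhds hy) hG)
  refine ⟨(h1.congr hG).contDiffAt (hU.mem_nhds hx), L, R, ?_, ?_, rfl⟩
  · exact hL.congr_of_eventuallyEq (hev.filter_mono nhdsWithin_le_nhds) hev.self_of_nhds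
  · exact hR.congr_of_eventuallyEq (hev.filter_mono nhdsWithin_le_nhds) hev.self_of_nhds

/-! ### Sums of truncated powers -/

theorem hasDerivAt_max_zero_pow {k : ℕ} (hk : 1 ≤ k) (x : ℝ) :
    HasDerivAt (fun x : ℝ => max x 0 ^ (k + 1)) ((k + 1) * max x 0 ^ k) x := by
  have hp : ∀ x : ℝ, HasDerivAt (fun x : ℝ => x ^ (k + 1)) ((k + 1) * x ^ k) x := fun x => by
    simpa using hasDerivAt_pow (k + 1) x
  rcases lt_trichotomy x 0 with hx | rfl | hx
  · rw [max_eq_right hx.le, zero_pow (by omega), mul_zero]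
    refine (hasDerivAt_const x (0 : ℝ)).congr_of_eventuallyEq ?_
    filter_upwards [Iio_mem_nhds hx] with y hy
    rw [max_eq_right (le_of_lt hy), zero_pow (by omega)]
  · have h1 : HasDerivWithinAt (fun x : ℝ => max x 0 ^ (k + 1)) 0 (Set.Iic 0) 0 :=
      (hasDerivWithinAt_const (0 : ℝ) _ (0 : ℝ)).congr
        (fun y hy => by rw [max_eq_right hy, zero_pow (by omega)]) (by simp)
    have h2 : HasDerivWithinAt (fun x : ℝ => max x 0 ^ (k + 1)) 0 (Set.Ici 0) 0 := by
      refine HasDerivWithinAt.congr (f := fun x : ℝ => x ^ (k + 1)) ?_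
        (fun y hy => by rw [max_eq_left hy]) (by simp)
      simpa [zero_pow (show k ≠ 0 by omega)] using (hp 0).hasDerivWithinAt
    have h3 := h1.union h2
    rw [Set.Iic_union_Ici, hasDerivWithinAt_univ] at h3
    simpa [zero_pow (show k ≠ 0 by omega)] using h3
  · rw [max_eq_left hx.le]
    refine (hp x).congr_of_eventuallyEq ?_
    filter_upwards [Ioi_mem_nhds hx] with y hy
    rw [max_eq_left (le_of_lt hy)]

section truncatedPowers

variable {ι : Type*} {w : ι → ℂ} {y : ι → ℝ}

/-- `∑ w_i (x - y_i)_+^k / k!`. -/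
def truncatedPowerSum (w : ι → ℂ) (y : ι → ℝ) (k : ℕ) (x : ℝ) : ℂ :=
  ∑' i, w i * ((max (x - y i) 0 ^ k / k.factorial : ℝ) : ℂ)

theorem norm_truncatedPower_le (hy : ∀ i, 0 ≤ y i) {B x : ℝ} (hB : 0 ≤ B) (hx : x ≤ B) (k : ℕ)
    (i : ι) : ‖w i * ((max (x - y i) 0 ^ k / k.factorial : ℝ) : ℂ)‖ ≤ ‖w i‖ * B ^ k := by
  rw [norm_mul, Complex.norm_real, Real.norm_of_nonneg (by positivity)]
  gcongr
  refine (div_le_self (by positivity) (by exact_mod_cast k.factorial_pos)).trans ?_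
  gcongr
  exact max_le (by linarith [hy i]) hB

theorem summable_truncatedPower (hw : Summable fun i => ‖w i‖) (hy : ∀ i, 0 ≤ y i) (k : ℕ)
    (x : ℝ) : Summable fun i => w i * ((max (x - y i) 0 ^ k / k.factorial : ℝ) : ℂ) :=
  Summable.of_norm_bounded (hw.mul_right (|x| ^ k)) fun i =>
    norm_truncatedPower_le hy (abs_nonneg x) (le_abs_self x) k i

/-- Termwise differentiation, dominated on a half-line because `y i ≥ 0`. It stops at `k = 1`: with
exponent `0` the truncated power would be the constant `1` instead of a step function. -/
theorem hasDerivAt_truncatedPowerSum (hw : Summable fun i => ‖w i‖) (hy : ∀ i, 0 ≤ y i) {k : ℕ}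
    (hk : 1 ≤ k) (x : ℝ) :
    HasDerivAt (truncatedPowerSum w y (k + 1)) (truncatedPowerSum w y k x) x := by
  have hB : 0 ≤ |x| + 1 := by positivity
  refine hasDerivAt_tsum_of_isPreconnected (t := Set.Iio (|x| + 1)) (y₀ := x)
    (hw.mul_right ((|x| + 1) ^ k)) isOpen_Iio isPreconnected_Iio (fun i z _ => ?_)
    (fun i z hz => norm_truncatedPower_le hy hB (le_of_lt hz) k i)
    (lt_of_le_of_lt (le_abs_self x) (by linarith)) (summable_truncatedPower hw hy _ x)
    (lt_of_le_of_lt (le_abs_self x) (by linarith))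
  refine HasDerivAt.const_mul _ (HasDerivAt.ofReal_comp ?_)
  have h1 : HasDerivAt (fun x : ℝ => max (x - y i) 0 ^ (k + 1)) ((k + 1) * max (z - y i) 0 ^ k) z :=
    HasDerivAt.comp_sub_const z (y i) (hasDerivAt_max_zero_pow hk (z - y i))
  refine (h1.div_const _).congr_deriv ?_
  rw [Nat.factorial_succ]
  have : (k.factorial : ℝ) ≠ 0 := by exact_mod_cast k.factorial_ne_zero
  push_cast
  field_simp

theorem continuous_truncatedPowerSum (hw : Summable fun i => ‖w i‖) (hy : ∀ i, 0 ≤ y i) (k : ℕ) :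
    Continuous (truncatedPowerSum w y k) := by
  refine continuous_iff_continuousAt.2 fun x => ?_
  have hB : 0 ≤ |x| + 1 := by positivity
  have h1 : ContinuousOn (truncatedPowerSum w y k) (Set.Iio (|x| + 1)) :=
    continuousOn_tsum (fun i => Continuous.continuousOn (by fun_prop)) (hw.mul_right _)
      fun i z hz => norm_truncatedPower_le hy hB (le_of_lt hz) k i
  exact h1.continuousAt (Iio_mem_nhds (lt_of_le_of_lt (le_abs_self x) (by linarith)))

/-- Differentiation of `truncatedPowerSum w y 1` within a set, term by term. -/
theorem hasDerivWithinAt_truncatedPowerSum_one (hw : Summable fun i => ‖w i‖)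
    (hy : ∀ i, 0 ≤ y i) {s : Set ℝ} {x : ℝ} {e : ι → ℝ}
    (he : ∀ i, HasDerivWithinAt (fun x => max (x - y i) 0) (e i) s x) :
    HasDerivWithinAt (truncatedPowerSum w y 1) (∑' i, w i * (e i : ℂ)) s x := by
  rw [hasDerivWithinAt_iff_tendsto_slope]
  have hs : ∀ z, slope (truncatedPowerSum w y 1) x z =
      ∑' i, w i * (slope (fun x => max (x - y i) 0) x z : ℂ) := by
    intro z
    rw [slope_def_module, truncatedPowerSum, truncatedPowerSum,
      ← (summable_truncatedPower hw hy 1 z).tsum_sub (summable_truncatedPower hw hy 1 x),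
      ← tsum_const_smul'' ]
    refine tsum_congr fun i => ?_
    rw [slope_def_module, Complex.real_smul, smul_eq_mul]
    push_cast
    simp
    ring
  rw [funext hs]
  -- The positive part is `1`-Lipschitz, so every difference quotient is bounded by `1` and `‖w i‖`
  -- dominates.
  refine tendsto_tsum_of_dominated_convergence hw (fun i => ?_) (Filter.Eventually.of_forall
    fun z i => ?_)
  · exact (Complex.continuous_ofReal.continuousAt.tendsto.comp
      (hasDerivWithinAt_iff_tendsto_slope.1 (he i))).const_mul (w i)
  · rw [norm_mul, Complex.norm_real, slope_def_field, norm_div]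
    refine mul_le_of_le_one_right (norm_nonneg _) (div_le_one_of_le₀ ?_ (norm_nonneg _))
    have := abs_max_sub_max_le_abs (z - y i) (x - y i) 0
    simpa using this

/-- A corner at `y i = x` has slope `0` from the left and `1` from the right; this is the source of
`<` here and `≤` in the right-hand version. -/
theorem hasDerivWithinAt_truncatedPowerSum_one_Iic (hw : Summable fun i => ‖w i‖)
    (hy : ∀ i, 0 ≤ y i) (x : ℝ) :
    HasDerivWithinAt (truncatedPowerSum w y 1) (∑' i, if y i < x then w i else 0) (Set.Iic x) x := by
  have := hasDerivWithinAt_truncatedPowerSum_one hw hy (s := Set.Iic x) (x := x)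
    (e := fun i => if y i < x then 1 else 0) fun i => ?_
  · exact this.congr_deriv (tsum_congr fun i => by split_ifs <;> simp)
  · split_ifs with h
    · refine ((hasDerivAt_id x).sub_const (y i)).hasDerivWithinAt.congr_of_eventuallyEq ?_ ?_
      · filter_upwards [nhdsWithin_le_nhds (Ioi_mem_nhds h)] with z hz
        exact max_eq_left (sub_nonneg.2 (le_of_lt hz))
      · exact max_eq_left (sub_nonneg.2 h.le)
    · rw [not_lt] at h
      exact (hasDerivWithinAt_const x _ (0 : ℝ)).congr
        (fun z hz => max_eq_right (by have : z ≤ x := hz; linarith)) (max_eq_right (by linarith))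

theorem hasDerivWithinAt_truncatedPowerSum_one_Ici (hw : Summable fun i => ‖w i‖)
    (hy : ∀ i, 0 ≤ y i) (x : ℝ) :
    HasDerivWithinAt (truncatedPowerSum w y 1) (∑' i, if y i ≤ x then w i else 0) (Set.Ici x) x := by
  have := hasDerivWithinAt_truncatedPowerSum_one hw hy (s := Set.Ici x) (x := x)
    (e := fun i => if y i ≤ x then 1 else 0) fun i => ?_
  · exact this.congr_deriv (tsum_congr fun i => by split_ifs <;> simp)
  · split_ifs with h
    · exact ((hasDerivAt_id x).sub_const (y i)).hasDerivWithinAt.congr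
        (fun z hz => max_eq_left (by have : x ≤ z := hz; simp; linarith))
        (max_eq_left (by simp; linarith))
    · rw [not_le] at h
      refine (hasDerivWithinAt_const x _ (0 : ℝ)).congr_of_eventuallyEq ?_ ?_
      · filter_upwards [nhdsWithin_le_nhds (Iio_mem_nhds h)] with z hz
        exact max_eq_right (sub_nonpos.2 (le_of_lt hz))
      · exact max_eq_right (sub_nonpos.2 h.le)

end truncatedPowers

/-! ### Parameter dependence of integrals over rectangles -/

theorem hasDerivAt_intervalIntegral_of_continuousOn {α β x₀ ε : ℝ} (hε : 0 < ε)
    {F F' : ℝ → ℝ → ℂ} (hF : ∀ x ∈ Metric.ball x₀ ε, ContinuousOn (F x) (Set.uIcc α β))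
    (hF' : ContinuousOn (Function.uncurry F') (Metric.closedBall x₀ ε ×ˢ Set.uIcc α β))
    (hd : ∀ x ∈ Metric.ball x₀ ε, ∀ t ∈ Set.uIcc α β, HasDerivAt (fun x => F x t) (F' x t) x) :
    HasDerivAt (fun x => ∫ t in α..β, F x t) (∫ t in α..β, F' x₀ t) x₀ := by
  obtain ⟨C, hC⟩ := ((isCompact_closedBall x₀ ε).prod isCompact_uIcc).exists_bound_of_continuousOn
    hF'
  refine (intervalIntegral.hasDerivAt_integral_of_dominated_loc_of_deriv_le (bound := fun _ => C)
    (Metric.ball_mem_nhds x₀ hε) ?_ ?_ ?_ ?_ ?_ ?_).2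
  · filter_upwards [Metric.ball_mem_nhds x₀ hε] with x hx
    exact (intervalIntegrable_iff.1 (hF x hx).intervalIntegrable).aestronglyMeasurable
  · exact (hF x₀ (Metric.mem_ball_self hε)).intervalIntegrable
  · exact (intervalIntegrable_iff.1 (ContinuousOn.intervalIntegrable (hF'.comp
      (f := fun t => (x₀, t)) (by fun_prop)
      fun t ht => ⟨Metric.mem_closedBall_self hε.le, ht⟩))).aestronglyMeasurable
  · exact Filter.Eventually.of_forall fun t ht x hx =>
      hC (x, t) ⟨Metric.ball_subset_closedBall hx, Set.uIoc_subset_uIcc ht⟩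
  · exact intervalIntegrable_const
  · exact Filter.Eventually.of_forall fun t ht x hx => hd x hx t (Set.uIoc_subset_uIcc ht)

theorem hasDerivAt_rectIntegral {a b T x₀ ε : ℝ} (hab : a ≤ b) (hT : 0 ≤ T) (hε : 0 < ε)
    {F F' : ℝ → ℂ → ℂ} (hF : ∀ x ∈ Metric.ball x₀ ε, ContinuousOn (F x) (rectFrame a b T))
    (hF' : ContinuousOn (Function.uncurry F') (Metric.closedBall x₀ ε ×ˢ rectFrame a b T))
    (hd : ∀ x ∈ Metric.ball x₀ ε, ∀ z ∈ rectFrame a b T, HasDerivAt (fun x => F x z) (F' x z) x) :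
    HasDerivAt (fun x => rectIntegral a b T (F x)) (rectIntegral a b T (F' x₀)) x₀ := by
  have hT' : -T ≤ T := by linarith
  have side : ∀ (α β : ℝ) (l : ℝ → ℂ), Continuous l → (∀ t ∈ Set.uIcc α β, l t ∈ rectFrame a b T) →
      HasDerivAt (fun x => ∫ t in α..β, F x (l t)) (∫ t in α..β, F' x₀ (l t)) x₀ :=
    fun α β l hl hm => hasDerivAt_intervalIntegral_of_continuousOn hε
      (F := fun x t => F x (l t)) (F' := fun x t => F' x (l t))
      (fun x hx => (hF x hx).comp hl.continuousOn hm)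
      (hF'.comp (f := fun p : ℝ × ℝ => (p.1, l p.2)) (by fun_prop) fun p hp => ⟨hp.1, hm _ hp.2⟩)
      (fun x hx t ht => hd x hx _ (hm t ht))
  have h1 := side a b (fun x => x + (-T : ℝ) * Complex.I) (by fun_prop) fun x hx =>
    bottom_mem_rectFrame hT (by rwa [Set.uIcc_of_le hab] at hx)
  have h2 := side a b (fun x => x + T * Complex.I) (by fun_prop) fun x hx =>
    top_mem_rectFrame hT (by rwa [Set.uIcc_of_le hab] at hx)
  have h3 := side (-T) T (fun y => b + y * Complex.I) (by fun_prop) fun x hx =>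
    right_mem_rectFrame hab (by rwa [Set.uIcc_of_le hT'] at hx)
  have h4 := side (-T) T (fun y => a + y * Complex.I) (by fun_prop) fun x hx =>
    left_mem_rectFrame hab (by rwa [Set.uIcc_of_le hT'] at hx)
  exact ((h1.sub h2).add (h3.const_mul Complex.I)).sub (h4.const_mul Complex.I)

/-- Cauchy's integral formula for rectangles. -/
theorem rectIntegral_div_sub {a b B T : ℝ} (hbB : b < B) {q : ℂ} (h1 : a < q.re)
    (h2 : q.re < b) (h3 : |q.im| < T) {G : ℂ → ℂ} (hG : DifferentiableOn ℂ G {z | z.re < B}) :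
    rectIntegral a b T (fun z => G z / (z - q)) = 2 * Real.pi * Complex.I * G q := by
  have hab : a ≤ b := (h1.trans h2).le
  have hT : 0 ≤ T := (abs_nonneg _).trans h3.le
  have hopen : IsOpen {z : ℂ | z.re < B} := isOpen_lt Complex.continuous_re continuous_const
  have hd : DifferentiableOn ℂ (dslope G q) {z | z.re < B} :=
    (Complex.differentiableOn_dslope (hopen.mem_nhds (h2.trans hbB))).2 hG
  have hsub : ∀ z ∈ rectFrame a b T, z.re < B := fun z hz => lt_of_le_of_lt hz.1.2 hbB
  have hne : ∀ z ∈ rectFrame a b T, z - q ≠ 0 := fun z hz =>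
    sub_ne_zero.2 (ne_of_mem_rectFrame h1.ne' h2.ne h3 hz)
  have hinv : ContinuousOn (fun z => G q * (z - q)⁻¹) (rectFrame a b T) :=
    ContinuousOn.mul continuousOn_const (ContinuousOn.inv₀ (by fun_prop) hne)
  rw [rectIntegral_congr (G := fun z => dslope G q z + G q * (z - q)⁻¹) hab hT fun z hz => ?_,
    rectIntegral_add hab hT (hd.continuousOn.mono hsub) hinv,
    rectIntegral_const_mul, rectIntegral_inv_sub h1 h2 h3,
    rectIntegral_eq_zero_of_differentiableOn hab
      (hd.mono fun z hz => lt_of_le_of_lt hz.2 hbB)]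
  · ring
  · simp only
    rw [dslope_of_ne _ (sub_ne_zero.1 (hne z hz)), slope_def_field]
    field_simp [hne z hz]
    ring

end

noncomputable section

/-! ### The mean derivative of the `G`-series -/

theorem rieszKernel_succ (k : ℕ) (w : ℂ) :
    rieszKernel (k + 1) w = rieszKernel k w * (w + (k + 1 : ℕ))⁻¹ := by
  rw [rieszKernel, rieszKernel, Finset.prod_range_succ _ (k + 1), mul_inv]

/-- The derivative of `x^{w+k+1} / (w+k+1)`, with `w = z - u`, is `x^{w+k}`: exactly the last factor
of the kernel is cancelled. -/
theorem hasDerivAt_rieszIntegrand (k : ℕ) (φ ψ : ℂ → ℂ) {u v z : ℂ} (hz : z ≠ u - (k + 1 : ℕ))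
    {x : ℝ} (hx : 0 < x) :
    HasDerivAt (fun x => rieszIntegrand (k + 1) φ ψ u v x z) (rieszIntegrand k φ ψ u v x z) x := by
  have hr : z - u + k ≠ -1 := fun h0 => hz (by push_cast; linear_combination h0)
  have h1 := ((hasDerivAt_ofReal_cpow_const' hx.ne' hr).const_mul (rieszKernel k (z - u))).mul_const
    (φ z * ψ (v + u - z))
  refine h1.congr_of_eventuallyEq (Filter.Eventually.of_forall fun y => ?_)
  simp only [rieszIntegrand, rieszKernel_succ]
  push_cast
  rw [add_assoc (z - u)]
  ring

section frame

variable {lam mu : ℕ → ℝ} {f g : ℕ → ℂ} {σφ σψ : ℝ} {φ ψ : ℂ → ℂ} {Pφ Pψ : Finset ℝ}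
  {rφ rψ : ℝ → ℂ} {a b T : ℝ} {k : ℕ} {u v : ℂ}

theorem continuousOn_rieszIntegrand (hL : IsContinuedDirichletSeries lam f σφ φ Pφ rφ)
    (hR : IsContinuedDirichletSeries mu g σψ ψ Pψ rψ) {K : Set ℂ}
    (hP : ∀ z ∈ K, ∀ p ∈ Pφ, z ≠ (p : ℂ)) (hu : ∀ z ∈ K, ∀ i : ℕ, i ≤ k → z ≠ u - i)
    (hK : ∀ z ∈ K, z.re < u.re + v.re - σψ) :
    ContinuousOn (Function.uncurry fun x : ℝ => rieszIntegrand k φ ψ u v x)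
      (Set.Ioi 0 ×ˢ K) := by
  have hsnd : ContinuousOn (fun p : ℝ × ℂ => p.2) (Set.Ioi (0 : ℝ) ×ˢ K) := continuousOn_snd
  have hmaps : Set.MapsTo (fun p : ℝ × ℂ => p.2) (Set.Ioi (0 : ℝ) ×ˢ K) K := fun p hp => hp.2
  have h1 : ContinuousOn (fun z => rieszKernel k (z - u)) K := by
    refine ContinuousOn.inv₀ (by fun_prop) fun z hz => Finset.prod_ne_zero_iff.2 fun i hi h0 => ?_
    exact hu z hz i (Nat.lt_succ_iff.1 (Finset.mem_range.1 hi)) (by linear_combination h0)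
  have h2 : ContinuousOn φ K := fun z hz =>
    (hL.differentiableAt z (hP z hz)).continuousAt.continuousWithinAt
  have h3 : ContinuousOn (fun z => ψ (v + u - z)) K := fun z hz => by
    refine ContinuousAt.continuousWithinAt (ContinuousAt.comp (f := fun z : ℂ => v + u - z)
      (hR.differentiableAt_of_lt ?_).continuousAt (by fun_prop))
    have := hK z hz
    simp
    linarith
  have h4 : ContinuousOn (fun p : ℝ × ℂ => (p.1 : ℂ) ^ (p.2 - u + k)) (Set.Ioi (0 : ℝ) ×ˢ K) :=
    ContinuousOn.cpow (by fun_prop) (by fun_prop) fun p hp =>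
      Complex.ofReal_mem_slitPlane.2 hp.1
  exact ((h1.comp hsnd hmaps).mul h4).mul ((h2.comp hsnd hmaps).mul (h3.comp hsnd hmaps))

theorem hasDerivAt_rectIntegral_rieszIntegrand (hL : IsContinuedDirichletSeries lam f σφ φ Pφ rφ)
    (hR : IsContinuedDirichletSeries mu g σψ ψ Pψ rψ) (hab : a ≤ b) (hT : 0 ≤ T)
    (hP : ∀ z ∈ rectFrame a b T, ∀ p ∈ Pφ, z ≠ (p : ℂ))
    (hu : ∀ z ∈ rectFrame a b T, ∀ i : ℕ, i ≤ k + 1 → z ≠ u - i)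
    (hK : ∀ z ∈ rectFrame a b T, z.re < u.re + v.re - σψ) {x : ℝ} (hx : 0 < x) :
    HasDerivAt (fun x => rectIntegral a b T (rieszIntegrand (k + 1) φ ψ u v x))
      (rectIntegral a b T (rieszIntegrand k φ ψ u v x)) x := by
  have hpos : ∀ y ∈ Metric.closedBall x (x / 2), 0 < y := fun y hy => by
    rw [Metric.mem_closedBall, Real.dist_eq, abs_le] at hy
    linarith
  refine hasDerivAt_rectIntegral hab hT (half_pos hx) (F' := fun x => rieszIntegrand k φ ψ u v x)
    (fun y hy => ?_) ?_ fun y hy z hz => ?_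
  · exact (continuousOn_rieszIntegrand hL hR hP hu hK).comp (f := fun z : ℂ => (y, z))
      (by fun_prop) fun z hz => ⟨hpos y (Metric.ball_subset_closedBall hy), hz⟩
  · exact (continuousOn_rieszIntegrand hL hR hP (fun z hz i hi => hu z hz i (by omega)) hK).mono
      (Set.prod_mono hpos subset_rfl)
  · exact hasDerivAt_rieszIntegrand k φ ψ (hu z hz (k + 1) le_rfl)
      (hpos y (Metric.ball_subset_closedBall hy))

/-- For `k = 0` and `x = 1` the integrand is `φ(z) ψ(v+u-z) / (z-u)`, with simple poles only: `Re u
> σφ` keeps `u` away from the poles of `φ`. Partial fractions reduce it to Cauchy's formula. -/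
theorem rectIntegral_rieszIntegrand_zero (hL : IsContinuedDirichletSeries lam f σφ φ Pφ rφ)
    (hR : IsContinuedDirichletSeries mu g σψ ψ Pψ rψ)
    (hP : ∀ p ∈ Pφ, a < p) (hub : u.re < b) (hb : σφ < b) (hvb : σψ < u.re + v.re - b)
    (hau : a < u.re) (hu : σφ < u.re) (hT : |u.im| < T) :
    rectIntegral a b T (rieszIntegrand 0 φ ψ u v 1) = 2 * Real.pi * Complex.I *
      (φ u * ψ v + ∑ p ∈ Pφ, rφ p / (p - u) * ψ (v + u - p)) := by
  obtain ⟨η, hη, hφη⟩ := hL.exists_eq_add_principal_parts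
  have hab : a ≤ b := (hau.trans hub).le
  have hT0 : 0 ≤ T := (abs_nonneg _).trans hT.le
  have hbB : b < u.re + v.re - σψ := by linarith
  have hPb : ∀ p ∈ Pφ, p < b := fun p hp => (hL.pole_le hp).trans_lt hb
  have hPT : ∀ p : ℝ, |(p : ℂ).im| < T := fun p => by
    simpa using (abs_nonneg _).trans_lt hT
  have hPu : ∀ p ∈ Pφ, u ≠ (p : ℂ) := fun p hp h0 => by
    have := (hL.pole_le hp).trans_lt hu
    rw [h0] at this
    simp at this
  have hW : DifferentiableOn ℂ (fun z => ψ (v + u - z)) {z | z.re < u.re + v.re - σψ} := by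
    intro z hz
    refine DifferentiableAt.differentiableWithinAt (DifferentiableAt.comp
      (f := fun z : ℂ => v + u - z) z (hR.differentiableAt_of_lt ?_) (by fun_prop))
    have hz : z.re < u.re + v.re - σψ := hz
    simp
    linarith
  have hfrP : ∀ z ∈ rectFrame a b T, ∀ p ∈ Pφ, z - (p : ℂ) ≠ 0 := fun z hz p hp =>
    sub_ne_zero.2 (ne_of_mem_rectFrame (by simpa using (hP p hp).ne')
      (by simpa using (hPb p hp).ne) (hPT p) hz)
  have hfru : ∀ z ∈ rectFrame a b T, z - u ≠ 0 := fun z hz =>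
    sub_ne_zero.2 (ne_of_mem_rectFrame hau.ne' hub.ne hT hz)
  have hfrW : ContinuousOn (fun z => ψ (v + u - z)) (rectFrame a b T) :=
    hW.continuousOn.mono fun z hz => lt_of_le_of_lt hz.1.2 hbB
  -- From `1/((z-p)(z-u)) = (p-u)⁻¹ (1/(z-p) - 1/(z-u))`, the principal parts of `φ` contribute
  -- `-A/(z-u)`, and `η(u) - A = φ(u)`.
  set A : ℂ := ∑ p ∈ Pφ, rφ p / (p - u) with hA
  have hG : DifferentiableOn ℂ (fun z => (η z - A) * ψ (v + u - z))
      {z | z.re < u.re + v.re - σψ} :=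
    (hη.differentiableOn.sub_const A).mul hW
  have hcont : ∀ p ∈ Pφ, ContinuousOn (fun z => rφ p / (p - u) * (ψ (v + u - z) / (z - p)))
      (rectFrame a b T) := fun p hp =>
    continuousOn_const.mul (hfrW.div (by fun_prop) fun z hz => hfrP z hz p hp)
  have hpt : Set.EqOn (rieszIntegrand 0 φ ψ u v 1)
      (fun z => (η z - A) * ψ (v + u - z) / (z - u) +
        ∑ p ∈ Pφ, rφ p / (p - u) * (ψ (v + u - z) / (z - p))) (rectFrame a b T) := by
    intro z hz
    have h0 := hfru z hz
    have e : (∑ p ∈ Pφ, rφ p / (z - p)) / (z - u) = -A / (z - u) +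
        ∑ p ∈ Pφ, rφ p / (p - u) / (z - p) := by
      rw [hA, ← Finset.sum_neg_distrib, Finset.sum_div, Finset.sum_div, ← Finset.sum_add_distrib]
      refine Finset.sum_congr rfl fun p hp => ?_
      have h1 := hfrP z hz p hp
      have h2 : (p : ℂ) - u ≠ 0 := sub_ne_zero.2 (hPu p hp).symm
      field_simp
      ring
    have e2 : ∑ p ∈ Pφ, rφ p / (p - u) * (ψ (v + u - z) / (z - p)) =
        (∑ p ∈ Pφ, rφ p / (p - u) / (z - p)) * ψ (v + u - z) := by
      rw [Finset.sum_mul]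
      exact Finset.sum_congr rfl fun p _ => by ring
    simp only
    rw [e2, rieszIntegrand, hφη z fun p hp => sub_ne_zero.1 (hfrP z hz p hp)]
    simp only [rieszKernel, Complex.ofReal_one, Complex.one_cpow, mul_one, zero_add,
      Finset.prod_range_one, Nat.cast_zero, add_zero]
    linear_combination ψ (v + u - z) * e
  have hfrG : ContinuousOn (fun z => (η z - A) * ψ (v + u - z) / (z - u)) (rectFrame a b T) :=
    (hG.continuousOn.mono fun z hz => lt_of_le_of_lt hz.1.2 hbB).div (by fun_prop) hfru
  rw [rectIntegral_congr hab hT0 hpt, rectIntegral_add hab hT0 hfrG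
      (continuousOn_finsetSum _ hcont),
    rectIntegral_sum hab hT0 _ hcont, rectIntegral_div_sub hbB hau hub hT hG]
  have hsum : ∑ p ∈ Pφ, rectIntegral a b T (fun z => rφ p / (p - u) * (ψ (v + u - z) / (z - p))) =
      2 * Real.pi * Complex.I * ∑ p ∈ Pφ, rφ p / (p - u) * ψ (v + u - p) := by
    rw [Finset.mul_sum]
    refine Finset.sum_congr rfl fun p hp => ?_
    rw [rectIntegral_const_mul, rectIntegral_div_sub hbB (q := p) (by simpa using hP p hp)
      (by simpa using hPb p hp) (hPT p) hW]
    ring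
  have hφu : η u - A = φ u := by
    rw [hφη u hPu, hA, sub_eq_add_neg, ← Finset.sum_neg_distrib]
    congr 1
    refine Finset.sum_congr rfl fun p _ => ?_
    rw [← div_neg, neg_sub]
  rw [hsum, hφu, add_sub_cancel_right]
  ring

end frame

namespace HeckePair

variable {δ : ℝ} {lam mu : ℕ → ℝ} {f g : ℕ → ℂ} {σφ σψ : ℝ} {φ ψ : ℂ → ℂ} {Pφ Pψ : Finset ℝ}
  {rφ rψ : ℝ → ℂ}

/-- The `G`-series is a truncated power sum minus a rectangle integral. Both are differentiated down
a chain of orders; the limit values at order zero are a half sum and a sum of residues. -/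
theorem hasMeanDerivAt_gSeries (h : HeckePair δ lam mu f g σφ σψ φ ψ Pφ Pψ rφ rψ)
    {γ : ℝ} {k : ℕ} {u v : ℂ} (hγ : σψ < γ) (hγ0 : 0 < γ) (hγδ : δ / 2 < γ)
    (hk : 2 * γ - δ < k) (hu : σφ < u.re) (hv : σψ < v.re)
    (hu' : ∀ j : ℕ, j ≤ k → u.re + γ - δ ≠ j) :
    HasMeanDerivAt k (fun x => gSeries γ δ k mu g u v x) 1
      (((∑' p : ℕ+ × ℕ+, if lam p.2 / mu p.1 < 1 then rieszWeight lam mu f g u v p else 0) +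
        ∑' p : ℕ+ × ℕ+, if lam p.2 / mu p.1 ≤ 1 then rieszWeight lam mu f g u v p else 0) / 2 -
      (φ u * ψ v + ∑ p ∈ Pφ, rφ p / (p - u) * ψ (v + u - p))) := by
  -- Such a line exists precisely because `Re v > σψ`.
  obtain ⟨b, hub, hvb⟩ : ∃ b, u.re < b ∧ b < u.re + v.re - σψ := exists_between (by linarith)
  have hvb : σψ < u.re + v.re - b := by linarith
  have hb : σφ < b := hu.trans hub
  set a : ℝ := δ - γ with ha
  have hau : a < u.re := (h.le_abscissa hγ hγδ).trans_lt hu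
  have hab : a ≤ b := (hau.trans hub).le
  obtain ⟨T, hT⟩ : ∃ T, |u.im| < T := exists_gt _
  have hT0 : 0 ≤ T := (abs_nonneg _).trans hT.le
  obtain ⟨n, rfl⟩ : ∃ n, k = n + 1 := by
    refine ⟨k - 1, ?_⟩
    have : (0 : ℝ) < k := by linarith
    have : 0 < k := by exact_mod_cast this
    omega
  set W := rieszWeight lam mu f g u v with hW
  set y : ℕ+ × ℕ+ → ℝ := fun p => lam p.2 / mu p.1 with hy
  have hws : Summable fun p => ‖W p‖ := (hasSum_rieszWeight h.left h.right hu hv).1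
  have hy0 : ∀ p, 0 ≤ y p := fun p =>
    (div_pos (h.left.lam_pos _ p.2.pos) (h.right.lam_pos _ p.1.pos)).le
  have hfr : ∀ z ∈ rectFrame a b T, ∀ p ∈ rieszPoles (n + 1) u Pφ, z ≠ p := fun z hz p hp =>
    ne_of_mem_rectFrame (h.rieszPoles_re_ne hγ hγ0 hu' p hp)
      (h.left.rieszPoles_re_lt hub hb p hp).ne (rieszPoles_im_lt hT p hp) hz
  have hfrP : ∀ z ∈ rectFrame a b T, ∀ p ∈ Pφ, z ≠ (p : ℂ) := fun z hz p hp =>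
    hfr z hz p (mem_rieszPoles.2 (Or.inr ⟨p, hp, rfl⟩))
  have hfru : ∀ z ∈ rectFrame a b T, ∀ i : ℕ, i ≤ n + 1 → z ≠ u - i := fun z hz i hi =>
    hfr z hz _ (mem_rieszPoles.2 (Or.inl ⟨i, hi, rfl⟩))
  have hK : ∀ z ∈ rectFrame a b T, z.re < u.re + v.re - σψ := fun z hz =>
    lt_of_le_of_lt hz.1.2 (by linarith)
  set F : ℕ → ℝ → ℂ := fun m x => truncatedPowerSum W y m x -
    1 / (2 * Real.pi * Complex.I) * rectIntegral a b T (rieszIntegrand m φ ψ u v x) with hF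
  have hrect : ∀ m, m ≤ n → ∀ x : ℝ, 0 < x → HasDerivAt
      (fun x => 1 / (2 * Real.pi * Complex.I) *
        rectIntegral a b T (rieszIntegrand (m + 1) φ ψ u v x))
      (1 / (2 * Real.pi * Complex.I) * rectIntegral a b T (rieszIntegrand m φ ψ u v x)) x :=
    fun m hm x hx => (hasDerivAt_rectIntegral_rieszIntegrand h.left h.right hab hT0 hfrP
      (fun z hz i hi => hfru z hz i (by omega)) hK hx).const_mul _
  have hder : ∀ j < n, ∀ x ∈ Set.Ioi (0 : ℝ),
      HasDerivAt (F (n + 1 - j)) (F (n + 1 - (j + 1)) x) x := by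
    intro j hj x hx
    rw [show n + 1 - j = (n - j) + 1 by omega, show n + 1 - (j + 1) = n - j by omega]
    exact (hasDerivAt_truncatedPowerSum hws hy0 (by omega) x).sub (hrect (n - j) (by omega) x hx)
  have hG : Set.EqOn (fun x => gSeries γ δ (n + 1) mu g u v x) (F (n + 1 - 0)) (Set.Ioi 0) := by
    intro x hx
    have hs := h.hasSum_riesz (T := T) hγ hγ0 hγδ hk hub hb hvb hu' hT hx
    have hfac : ((n + 1).factorial : ℂ) ≠ 0 := by exact_mod_cast (n + 1).factorial_ne_zero
    have e : truncatedPowerSum W y (n + 1) x = 1 / (2 * Real.pi * Complex.I) *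
        rectIntegral a b T (rieszIntegrand (n + 1) φ ψ u v x) +
        gSeries γ δ (n + 1) mu g u v x := by
      have h2 := hs.mul_left (((n + 1).factorial : ℂ)⁻¹)
      rw [inv_mul_cancel_left₀ hfac] at h2
      rw [← h2.tsum_eq, truncatedPowerSum]
      refine tsum_congr fun p => ?_
      push_cast
      ring
    simp only [hF, Nat.sub_zero]
    rw [e, add_sub_cancel_left]
  -- The rectangle part has an ordinary derivative at `1`, the same from both sides; only the
  -- truncated sum has a corner there.
  have h1 := (hrect 0 (by omega) 1 one_pos).hasDerivWithinAt (s := Set.Iic 1)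
  have h2 := (hrect 0 (by omega) 1 one_pos).hasDerivWithinAt (s := Set.Ici 1)
  rw [rectIntegral_rieszIntegrand_zero h.left h.right (fun p hp => h.lt_pole hγ hγ0 hp) hub hb hvb
    hau hu hT, one_div_mul_eq_div, mul_div_cancel_left₀ _ (by
      simp [Real.pi_ne_zero, Complex.I_ne_zero])] at h1 h2
  have hL := (hasDerivWithinAt_truncatedPowerSum_one_Iic hws hy0 1).sub h1
  have hR := (hasDerivWithinAt_truncatedPowerSum_one_Ici hws hy0 1).sub h2
  have hc : ContinuousOn (F (n + 1 - n)) (Set.Ioi 0) := by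
    rw [Nat.add_sub_cancel_left]
    refine (continuous_truncatedPowerSum hws hy0 1).continuousOn.sub fun x hx => ?_
    exact (hrect 0 (by omega) x hx).continuousAt.continuousWithinAt
  have key := hasMeanDerivAt_of_chain isOpen_Ioi (Set.mem_Ioi.2 one_pos) n
    (fun j => F (n + 1 - j)) hder hc
    (by rw [Nat.add_sub_cancel_left]; exact hL) (by rw [Nat.add_sub_cancel_left]; exact hR) hG
  convert key using 1
  ring

/-- The two halves of the double series for `φ(u) ψ(v)`, the diagonal counted with weight `1/2`
in each. -/
theorem tsum_rieszWeight_add (h : HeckePair δ lam mu f g σφ σψ φ ψ Pφ Pψ rφ rψ) {u v : ℂ}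
    (hu : σφ < u.re) (hv : σψ < v.re) :
    ((∑' p : ℕ+ × ℕ+, if lam p.2 / mu p.1 < 1 then rieszWeight lam mu f g u v p else 0) +
        ∑' p : ℕ+ × ℕ+, if lam p.2 / mu p.1 ≤ 1 then rieszWeight lam mu f g u v p else 0) / 2 +
    ((∑' p : ℕ+ × ℕ+, if mu p.2 / lam p.1 < 1 then rieszWeight mu lam g f v u p else 0) +
        ∑' p : ℕ+ × ℕ+, if mu p.2 / lam p.1 ≤ 1 then rieszWeight mu lam g f v u p else 0) / 2 =
      φ u * ψ v := by
  obtain ⟨hs, hsum⟩ := hasSum_rieszWeight h.left h.right hu hv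
  have hswap : ∀ p : ℕ+ × ℕ+, rieszWeight mu lam g f v u p.swap = rieszWeight lam mu f g u v p :=
    fun p => mul_comm _ _
  have hml : ∀ n : ℕ+, 0 < mu n := fun n => h.right.lam_pos n n.pos
  have hll : ∀ n : ℕ+, 0 < lam n := fun n => h.left.lam_pos n n.pos
  -- Exchanging the entries of each pair makes all four sums run over the same weights, with the
  -- comparison reversed in the second half.
  rw [← (Equiv.prodComm ℕ+ ℕ+).tsum_eq fun p : ℕ+ × ℕ+ =>
      if mu p.2 / lam p.1 < 1 then rieszWeight mu lam g f v u p else 0,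
    ← (Equiv.prodComm ℕ+ ℕ+).tsum_eq fun p : ℕ+ × ℕ+ =>
      if mu p.2 / lam p.1 ≤ 1 then rieszWeight mu lam g f v u p else 0]
  simp only [Equiv.prodComm_apply, hswap, Prod.fst_swap, Prod.snd_swap, div_lt_one (hml _),
    div_lt_one (hll _), div_le_one (hml _), div_le_one (hll _)]
  have hsub : ∀ q : ℕ+ × ℕ+ → Prop, ∀ _ : DecidablePred q,
      Summable fun p => if q p then rieszWeight lam mu f g u v p else 0 := fun q _ =>
    Summable.of_norm_bounded hs fun p => by split_ifs <;> simp
  rw [← (hsub (fun p => lam p.2 < mu p.1) inferInstance).tsum_add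
      (hsub (fun p => lam p.2 ≤ mu p.1) inferInstance),
    ← (hsub (fun p => mu p.1 < lam p.2) inferInstance).tsum_add
      (hsub (fun p => mu p.1 ≤ lam p.2) inferInstance), ← add_div,
    ← Summable.tsum_add
      ((hsub (fun p => lam p.2 < mu p.1) inferInstance).add
        (hsub (fun p => lam p.2 ≤ mu p.1) inferInstance))
      ((hsub (fun p => mu p.1 < lam p.2) inferInstance).add
        (hsub (fun p => mu p.1 ≤ lam p.2) inferInstance))]
  -- Off the diagonal two of the four indicators hold, the strict and the weak one on one side; on
  -- the diagonal the two weak ones hold. The total is `2` in every case.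
  have hpt : ∀ p : ℕ+ × ℕ+, ((if lam p.2 < mu p.1 then rieszWeight lam mu f g u v p else 0) +
      if lam p.2 ≤ mu p.1 then rieszWeight lam mu f g u v p else 0) +
      ((if mu p.1 < lam p.2 then rieszWeight lam mu f g u v p else 0) +
      if mu p.1 ≤ lam p.2 then rieszWeight lam mu f g u v p else 0) =
      2 * rieszWeight lam mu f g u v p := by
    intro p
    rcases lt_trichotomy (lam p.2) (mu p.1) with h0 | h0 | h0
    · simp [h0, h0.le, h0.not_gt, h0.not_ge]; ring
    · simp [h0]; ring
    · simp [h0, h0.le, h0.not_gt, h0.not_ge]; ring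
  rw [tsum_congr hpt, tsum_mul_left, hsum.tsum_eq]
  ring

end HeckePair

end

/-! ### Assembly of the theorem from one Hecke pair and its mirror image. -/

theorem mainTheorem1 (δ : ℝ) (lam mu : ℕ → ℝ) (f g : ℕ → ℂ) (σφ σψ : ℝ) (φ ψ : ℂ → ℂ)
    (Pφ Pψ : Finset ℝ) (rφ rψ : ℝ → ℂ)
    (hpair : HeckePair δ lam mu f g σφ σψ φ ψ Pφ Pψ rφ rψ)
    (γ : ℝ) (hγ : max σφ σψ < γ) (hγδ : δ / 2 < γ)
    (k : ℕ) (hk : 2 * γ - δ < k)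
    (u v : ℂ) (hu : σφ < u.re) (hv : σψ < v.re) (huv : max σφ σψ < u.re + v.re - γ)
    -- the line `Re s = γ` meets no pole of the integrands of the two `G`-functions
    (hu' : ∀ j : ℕ, j ≤ k → u.re + γ - δ ≠ j) (hv' : ∀ j : ℕ, j ≤ k → v.re + γ - δ ≠ j) :
    -- the `G`-functions and the series `G_{g,k}`, `G_{f,k}` converge absolutely
    (∀ x : ℝ, 0 < x →
      (∀ n : ℕ, 1 ≤ n → MeasureTheory.Integrable (fun t : ℝ => meijerIntegrand 1 1
        (upperParams δ k u) (lowerParams δ u) (gArg mu x n) ((γ : ℂ) + (t : ℂ) * Complex.I))) ∧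
      (∀ n : ℕ, 1 ≤ n → MeasureTheory.Integrable (fun t : ℝ => meijerIntegrand 1 1
        (upperParams δ k v) (lowerParams δ v) (gArg lam x n) ((γ : ℂ) + (t : ℂ) * Complex.I))) ∧
      (Summable fun n : ℕ+ => gTerm γ δ k mu g u v x n) ∧
      (Summable fun n : ℕ+ => gTerm γ δ k lam f v u x n)) ∧
    -- the formula for the product
    (∃ Df Dg : ℂ,
      HasMeanDerivAt k (fun x => gSeries γ δ k lam f v u x) 1 Df ∧
      HasMeanDerivAt k (fun x => gSeries γ δ k mu g u v x) 1 Dg ∧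
      φ u * ψ v =
        -(∑ p ∈ Pψ, rψ p / ((p : ℂ) - v) * φ (v + u - p))
        - (∑ p ∈ Pφ, rφ p / ((p : ℂ) - u) * ψ (v + u - p))
        - Df - Dg) ∧
    -- the two identities for the Riesz sums
    (∀ x : ℝ, 0 < x → ∀ c : ℝ → ℂ,
      IsAdmissibleContour γ δ (u.re + v.re - max σφ σψ) k u Pφ Pψ c →
      (Summable fun n : ℕ+ => rieszTerm k lam mu f g u v x n) ∧
      1 / Complex.Gamma (k + 1) * ∑' n : ℕ+, rieszTerm k lam mu f g u v x n =
        polarTerm k φ ψ u v x c + gSeries γ δ k mu g u v x) ∧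
    (∀ x : ℝ, 0 < x → ∀ c : ℝ → ℂ,
      IsAdmissibleContour γ δ (u.re + v.re - max σφ σψ) k v Pφ Pψ c →
      (Summable fun n : ℕ+ => rieszTerm k mu lam g f v u x n) ∧
      1 / Complex.Gamma (k + 1) * ∑' n : ℕ+, rieszTerm k mu lam g f v u x n =
        polarTerm k ψ φ v u x c + gSeries γ δ k lam f v u x) := by
  obtain ⟨hγφ, hγψ⟩ := max_lt_iff.1 hγ
  have hδ := hpair.delta_pos
  have hγ0 : 0 < γ := by linarith
  obtain ⟨huvφ, huvψ⟩ := max_lt_iff.1 huv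
  obtain ⟨b, hub, hbv⟩ : ∃ b, u.re < b ∧ b < u.re + v.re - σψ := exists_between (by linarith)
  obtain ⟨b', hvb', hbu'⟩ : ∃ b, v.re < b ∧ b < v.re + u.re - σφ := exists_between (by linarith)
  have hB : u.re + v.re - max σφ σψ ≤ u.re + v.re - σψ := by linarith [le_max_right σφ σψ]
  have hB' : u.re + v.re - max σφ σψ ≤ v.re + u.re - σφ := by linarith [le_max_left σφ σψ]
  refine ⟨fun x hx => ?_, ?_, fun x hx c hc => ?_, fun x hx c hc => ?_⟩
  · obtain ⟨hg1, hg2, -⟩ := hpair.gSeries_eq_integral (u := u) (v := v) hγψ hγ0 (by linarith) hk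
      hu' hx
    obtain ⟨hf1, hf2, -⟩ := hpair.symm.gSeries_eq_integral (u := v) (v := u) hγφ hγ0 (by linarith)
      hk hv' hx
    exact ⟨hg1, hf1, hg2, hf2⟩
  · refine ⟨_, _, hpair.symm.hasMeanDerivAt_gSeries hγφ hγ0 hγδ hk hv hu hv',
      hpair.hasMeanDerivAt_gSeries hγψ hγ0 hγδ hk hu hv hu', ?_⟩
    rw [add_comm u v]
    -- The half sums give `φ(u) ψ(v)` once, and each mean derivative subtracts it once more, so `Df
    -- + Dg` is `-φ(u) ψ(v)` minus both residue sums.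
    linear_combination hpair.tsum_rieszWeight_add hu hv
  · exact hpair.rieszTerm_identity hγψ hγ0 hγδ hk hub (hu.trans hub) (by linarith) hu' hB hx hc
  -- For the mirrored pair the poles of `φ` and `ψ` change places in the admissibility of the
  -- contour.
  · exact hpair.symm.rieszTerm_identity hγφ hγ0 hγδ hk hvb' (hv.trans hvb') (by linarith) hv' hB' hx
      ⟨hc.isClosedCurve, hc.in_strip, hc.encircles_right, hc.encircles_left, hc.encircles_gamma⟩
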